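/- Let $p$ be an odd prime, $F$ any field of characteristic $p$, and $M=(c_{ij})\in F^{2\times 3}$. For $c_1,c_2\in F$ put $$\sigma(c_1,c_2)=\begin{pmatrix}1&2c_1&c_1^2+c_2\\0&1&c_1\\0&0&1\end{pmatrix},$$ and let $V_M$ be the representation of $G=(\mathbb Z/p)^3=\langle e_1,e_2,e_3\rangle$ given by $e_j\mapsto\sigma(c_{1j},c_{2j})$. Thus $G$ acts on $F[V_M]=F[x,y,z]$ by algebra automorphisms, and an element acting by $\sigma(c_1,c_2)$ sends $x\mapsto x$, $y\mapsto y+c_1x$, $z\mapsto z+2c_1y+(c_1^2+c_2)x$. For $f\in F[x,y,z]$ let $N_G(f)$ be the product of the elements of the $G$-orbit of $f$. Let $\Gamma$ be the $8\times3$ matrix whose rows $2k+1$ and $2k+2$ are $(c_{11}^{p^k},c_{12}^{p^k},c_{13}^{p^k})$ and $(c_{21}^{p^k},c_{22}^{p^k},c_{23}^{p^k})$, $k=0,1,2,3$, and let $\gamma_{ijk}$ be its minor on the rows $i,j,k$. Put $\delta=y^2-xz$ and $$\bar f_1=-\gamma_{123}\delta^p-\gamma_{124}x^py^p-\gamma_{134}\delta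 x^{2p-2}-\gamma_{234}yx^{2p-1},$$ $$\bar f_2=\gamma_{123}y^{p^2}-\gamma_{125}y^px^{p^2-p}-\gamma_{135}\delta x^{p^2-2}-\gamma_{235}yx^{p^2-1}.$$ Use the graded reverse lexicographic order with $x<y<z$. A subset $B$ of a subalgebra $A\subseteq F[x,y,z]$ is a SAGBI basis for $A$ if the lead monomials of the elements of $B$ generate the lead term algebra of $A$. To subduct an element $h$ over $B=\{g_1,\dots,g_5\}$ means to subtract repeatedly a scalar multiple of a product $g_1^{a_1}\cdots g_5^{a_5}$ having the same lead term, until $0$ is reached; if $h=T(g_1,\dots,g_5)$, the relation constructed by subducting $h$ is $T$ minus the sum of the corresponding terms $c\,t_1^{a_1}\cdots t_5^{a_5}$ in $F[t_1,\dots,t_5]$. Subducting a pair $(g^I,g^J)$ of products with equal lead monomials and disjoint supports means subducting $g^I-cg^J$ with $c\in F$ chosen so that the lead terms cancel. Suppose $\gamma_{123}\neq0$. Then there is a (unique) $\bar f_3\in F[x,y,z]$ with $$\bar f_1^{\,p}+\gamma_{123}^{p-2}\bar f_2^{\,2}+2(-\gamma_{123})^{(p-3)/2}\gamma_{125}x^{p^2-p}\bar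 f_1^{\,(p+1)/2}+2x^{p^2-2}\bar f_3=0,\qquad(*)$$ and the following hold. 1. If $\gamma_{135}\ne0$, then $\{x,\bar f_1,\bar f_2,\bar f_3,N_G(z)\}$ is a SAGBI basis for $F[V_M]^G$. The element $\bar f_3^{\,p}+\gamma_{135}^p\gamma_{123}^{p^2-2p-1}\bar f_1\bar f_2^{\,p}$ subducts to zero, and for any relation $R$ constructed by subducting it, the ideal of relations among the five generators is generated by $R$ and the relation $(*)$. 2. If $\gamma_{135}=0$, then $x$ divides $\bar f_3$, and $\{x,\bar f_1,N_G(y),\bar f_3/x,N_G(z)\}$ is a SAGBI basis for $F[V_M]^G$. Both $\bigl((\bar f_3/x)^p,\bar f_1^{\,(p^2+1)/2}\bigr)$ and $\bigl(\bar f_1^{\,p},N_G(y)^2\bigr)$ are pairs of products with equal lead monomials and disjoint supports; they subduct to zero, and the ideal of relations among the five generators is generated by any two relations $R,R'$ constructed by subducting these two pairs respectively. In both cases $F[V_M]^G$ is a complete intersection with five generators and two relations: it is generated by the five listed elements, none of which lies in the algebra generated by the other four, and the two relations form a regular sequence in the polynomial ring in five variables. -/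

import Mathlib

noncomputable section

namespace ElemAbelianInv

open MvPolynomial

/-! ### The graded reverse lexicographic order with `x < y < z`

The variables are `x = X 0`, `y = X 1`, `z = X 2`. -/

/-- Exponent vectors of monomials in `x, y, z`, to be ordered by grevlex. -/
def GrevlexExp : Type := Fin 3 →₀ ℕ

instance : AddCommMonoid GrevlexExp := inferInstanceAs (AddCommMonoid (Fin 3 →₀ ℕ))

/-- The identity `(Fin 3 →₀ ℕ) ≃+ GrevlexExp`. -/
def toGrevlex : (Fin 3 →₀ ℕ) ≃+ GrevlexExp := AddEquiv.refl _

/-- Grevlex with `x < y < z` compares `(a₀ + a₁ + a₂, a₁ + a₂, a₂)` lexicographically. -/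
def grevlexKey (a : GrevlexExp) : ℕ ×ₗ ℕ ×ₗ ℕ :=
  let b := toGrevlex.symm a
  toLex (b 0 + b 1 + b 2, toLex (b 1 + b 2, b 2))

theorem grevlexKey_injective : Function.Injective grevlexKey := by
  intro a b h
  have h1 := congrArg (fun u => (ofLex u).1) h
  have h2 := congrArg (fun u => (ofLex (ofLex u).2).1) h
  have h3 := congrArg (fun u => (ofLex (ofLex u).2).2) h
  simp only [grevlexKey, ofLex_toLex] at h1 h2 h3
  apply toGrevlex.symm.injective
  ext i
  fin_cases i <;> simp <;> omega

instance : LinearOrder GrevlexExp := LinearOrder.lift' grevlexKey grevlexKey_injective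

theorem grevlexKey_le_iff (a b : Fin 3 →₀ ℕ) :
    toGrevlex a ≤ toGrevlex b ↔
      (a 0 + a 1 + a 2 < b 0 + b 1 + b 2 ∨
        (a 0 + a 1 + a 2 = b 0 + b 1 + b 2 ∧ (a 1 + a 2 < b 1 + b 2 ∨
          (a 1 + a 2 = b 1 + b 2 ∧ a 2 ≤ b 2)))) := by
  change grevlexKey (toGrevlex a) ≤ grevlexKey (toGrevlex b) ↔ _
  simp only [grevlexKey, Prod.Lex.le_iff, ofLex_toLex, AddEquiv.symm_apply_apply]

instance : IsOrderedAddMonoid GrevlexExp where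
  add_le_add_left a b h c := by
    obtain ⟨a, rfl⟩ := toGrevlex.surjective a
    obtain ⟨b, rfl⟩ := toGrevlex.surjective b
    obtain ⟨c, rfl⟩ := toGrevlex.surjective c
    rw [← map_add, ← map_add]
    rw [grevlexKey_le_iff] at h ⊢
    simp only [Finsupp.add_apply]
    omega

instance : WellFoundedLT GrevlexExp :=
  ⟨InvImage.wf grevlexKey wellFounded_lt⟩

/-- The graded reverse lexicographic order on monomials in `x, y, z` with `x < y < z`. -/
def grevlex : MonomialOrder (Fin 3) where
  syn := GrevlexExp
  toSyn := toGrevlex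
  toSyn_monotone a b h := by
    have h0 := h 0
    have h1 := h 1
    have h2 := h 2
    rw [grevlexKey_le_iff]
    omega

/-- Total degree first; in equal degree, the monomial with the larger exponent of `x` is smaller,
and then the one with the larger exponent of `y`. -/
theorem grevlex_lt_iff (a b : Fin 3 →₀ ℕ) :
    grevlex.toSyn a < grevlex.toSyn b ↔
      (a 0 + a 1 + a 2 < b 0 + b 1 + b 2 ∨
        (a 0 + a 1 + a 2 = b 0 + b 1 + b 2 ∧ (b 0 < a 0 ∨ (a 0 = b 0 ∧ b 1 < a 1)))) := by
  rw [← not_le]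
  change ¬ (toGrevlex b ≤ toGrevlex a) ↔ _
  rw [grevlexKey_le_iff]
  omega

/-! ### SAGBI bases, tête-à-têtes, subduction -/

section Sagbi

variable {σ F : Type*} [Field F]

/-- The monic lead monomials of the non-zero elements of a set of polynomials. -/
def leadMonomials (m : MonomialOrder σ) (B : Set (MvPolynomial σ F)) : Set (MvPolynomial σ F) :=
  {u | ∃ f ∈ B, f ≠ 0 ∧ u = monomial (m.degree f) 1}

/-- The lead term algebra of a set (usually a subalgebra) `A`. -/
def leadTermAlgebra (m : MonomialOrder σ) (A : Set (MvPolynomial σ F)) :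
    Subalgebra F (MvPolynomial σ F) :=
  Algebra.adjoin F (leadMonomials m A)

/-- `B` is a SAGBI basis for the subalgebra `A`: `B ⊆ A`, and the lead monomials of the elements
of `B` generate the lead term algebra of `A`. -/
def IsSagbiBasis (m : MonomialOrder σ) (B : Set (MvPolynomial σ F))
    (A : Subalgebra F (MvPolynomial σ F)) : Prop :=
  B ⊆ A ∧ leadTermAlgebra m B = leadTermAlgebra m (A : Set (MvPolynomial σ F))

/-- `g ^ I`, the product of the `g j ^ I j`. -/
def gpow {n : ℕ} (g : Fin n → MvPolynomial σ F) (I : Fin n →₀ ℕ) : MvPolynomial σ F :=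
  ∏ j, g j ^ I j

/-- `(g ^ I, g ^ J)` is a non-trivial tête-à-tête: the lead monomials agree and the supports of
`I` and `J` are disjoint. -/
def IsTeteATete (m : MonomialOrder σ) {n : ℕ} (g : Fin n → MvPolynomial σ F)
    (I J : Fin n →₀ ℕ) : Prop :=
  m.degree (gpow g I) = m.degree (gpow g J) ∧ Disjoint I.support J.support

/-- The formal difference `t ^ I - c t ^ J` of a tête-à-tête, where `c` makes the lead terms of
`g ^ I` and `c g ^ J` cancel. -/
def teteATetePoly (m : MonomialOrder σ) {n : ℕ} (g : Fin n → MvPolynomial σ F)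
    (I J : Fin n →₀ ℕ) : MvPolynomial (Fin n) F :=
  monomial I 1 - monomial J (m.leadingCoeff (gpow g I) / m.leadingCoeff (gpow g J))

/-- `SubductsToZero m g h Q`: the polynomial `h` subducts to zero over the family `g`. As long as
`h ≠ 0`, one subtracts a term `c g ^ E` with the same lead term as `h`; the formal polynomial `Q`
is the sum of all the `c t ^ E` that were used. -/
inductive SubductsToZero (m : MonomialOrder σ) {n : ℕ} (g : Fin n → MvPolynomial σ F) :
    MvPolynomial σ F → MvPolynomial (Fin n) F → Prop
  | zero : SubductsToZero m g 0 0
  | step (h : MvPolynomial σ F) (E : Fin n →₀ ℕ) (c : F) (Q : MvPolynomial (Fin n) F)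
      (hh : h ≠ 0) (hlt : m.leadingTerm (C c * gpow g E) = m.leadingTerm h)
      (hQ : SubductsToZero m g (h - C c * gpow g E) Q) :
      SubductsToZero m g h (monomial E c + Q)

/-- `R` is a relation among the `g j` constructed by subducting `T(g)`: the polynomial `T(g)`
subducts to zero, and `R` is `T` minus the terms used in the subduction. -/
def IsSubductionRelation (m : MonomialOrder σ) {n : ℕ} (g : Fin n → MvPolynomial σ F)
    (T R : MvPolynomial (Fin n) F) : Prop :=
  ∃ Q, SubductsToZero m g (aeval g T) Q ∧ R = T - Q

/-- The algebra `A` is a complete intersection, minimally generated by `g`, with defining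
relations `rs`: the `g j` generate `A` and none of them lies in the algebra generated by the
others, the ideal of all relations among the `g j` is generated by `rs`, and `rs` is a regular
sequence in the polynomial ring. -/
structure IsCompleteIntersectionOn {n : ℕ} (A : Subalgebra F (MvPolynomial σ F))
    (g : Fin n → MvPolynomial σ F) (rs : List (MvPolynomial (Fin n) F)) : Prop where
  adjoin_eq : Algebra.adjoin F (Set.range g) = A
  minimal : ∀ i, g i ∉ Algebra.adjoin F (g '' {i}ᶜ)
  ker_eq : RingHom.ker (aeval g : MvPolynomial (Fin n) F →ₐ[F] MvPolynomial σ F) = Ideal.ofList rs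
  regular : RingTheory.Sequence.IsRegular (MvPolynomial (Fin n) F) rs

end Sagbi

/-! ### The representation `V_M` and its invariants -/

section Rep

variable {F : Type*} [Field F]

/-- The matrix `σ(c₁, c₂)`. -/
def sigma (c₁ c₂ : F) : Matrix (Fin 3) (Fin 3) F :=
  !![1, 2 * c₁, c₁ ^ 2 + c₂; 0, 1, c₁; 0, 0, 1]

theorem sigma_zero : sigma (0 : F) 0 = 1 := by
  ext i j
  fin_cases i <;> fin_cases j <;> simp [sigma]

theorem sigma_mul (c₁ c₂ d₁ d₂ : F) :
    sigma c₁ c₂ * sigma d₁ d₂ = sigma (c₁ + d₁) (c₂ + d₂) := by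
  ext i j
  fin_cases i <;> fin_cases j <;> simp [sigma, Matrix.mul_apply, Fin.sum_univ_three] <;> ring

/-- The right action of a `3 × 3` matrix `A` on `F[x, y, z]` by substitution: `x, y, z` are the
row vectors `[0 0 1]`, `[0 1 0]`, `[1 0 0]`, on which `A` acts by right multiplication. -/
def act (A : Matrix (Fin 3) (Fin 3) F) : MvPolynomial (Fin 3) F →ₐ[F] MvPolynomial (Fin 3) F :=
  aeval fun i => ∑ j, C (A i.rev j.rev) * X j

theorem act_sigma_x (c₁ c₂ : F) : act (sigma c₁ c₂) (X 0) = X 0 := by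
  simp [act, sigma, Fin.sum_univ_three, Fin.rev]

theorem act_sigma_y (c₁ c₂ : F) : act (sigma c₁ c₂) (X 1) = X 1 + C c₁ * X 0 := by
  simp [act, sigma, Fin.sum_univ_three, Fin.rev]
  ring

theorem act_sigma_z (c₁ c₂ : F) :
    act (sigma c₁ c₂) (X 2) = X 2 + C (2 * c₁) * X 1 + C (c₁ ^ 2 + c₂) * X 0 := by
  simp [act, sigma, Fin.sum_univ_three, Fin.rev]
  ring

variable (p : ℕ) [Fact p.Prime] [CharP F p]

/-- The representation of `G = (ℤ/p)³ = ⟨e₁, e₂, e₃⟩` determined by `M`, that is, by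
`e_j ↦ σ(M 0 j, M 1 j)`. -/
def rep (M : Matrix (Fin 2) (Fin 3) F) :
    Multiplicative (Fin 3 → ZMod p) →* Matrix (Fin 3) (Fin 3) F where
  toFun g := sigma (∑ j, ZMod.castHom dvd_rfl F (g.toAdd j) * M 0 j)
    (∑ j, ZMod.castHom dvd_rfl F (g.toAdd j) * M 1 j)
  map_one' := by
    simp only [toAdd_one, Pi.zero_apply, map_zero, zero_mul, Finset.sum_const_zero, sigma_zero]
  map_mul' g h := by
    simp only [toAdd_mul, Pi.add_apply, map_add, add_mul, Finset.sum_add_distrib, sigma_mul]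

theorem rep_generator (M : Matrix (Fin 2) (Fin 3) F) (j : Fin 3) :
    rep p M (Multiplicative.ofAdd (Pi.single j 1)) = sigma (M 0 j) (M 1 j) := by
  change sigma _ _ = _
  congr 1 <;> fin_cases j <;> simp [Fin.sum_univ_three, Pi.single_apply]

/-- The ring of invariants `F[V_M]^G`. -/
def invariants (M : Matrix (Fin 2) (Fin 3) F) : Subalgebra F (MvPolynomial (Fin 3) F) :=
  ⨅ g : Multiplicative (Fin 3 → ZMod p), AlgHom.equalizer (act (rep p M g)) (AlgHom.id F _)

theorem mem_invariants (M : Matrix (Fin 2) (Fin 3) F) (f : MvPolynomial (Fin 3) F) :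
    f ∈ invariants p M ↔ ∀ g, act (rep p M g) f = f := by
  simp [invariants, Algebra.mem_iInf, AlgHom.mem_equalizer]

open Classical in
/-- `N_G(f)`: the product of the elements of the `G`-orbit of `f`. -/
def orbitProd (M : Matrix (Fin 2) (Fin 3) F) (f : MvPolynomial (Fin 3) F) :
    MvPolynomial (Fin 3) F :=
  ∏ h ∈ Finset.univ.image (fun g => act (rep p M g) f), h

end Rep

/-! ### The minors `γ_{ijk}` and the invariants `f₁, f₂, f₃` -/

section Gens

variable {F : Type*} [Field F] (p : ℕ) (M : Matrix (Fin 2) (Fin 3) F)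

/-- The `n`-th row (`n = 1, …, 8`) of the matrix `Γ` evaluated at `M`: row `2k + 1` consists of the
`p ^ k`-th powers of the first row of `M`, row `2k + 2` of those of the second row. -/
def gammaRow (n : ℕ) : Fin 3 → F :=
  fun j => M (if n % 2 = 1 then 0 else 1) j ^ p ^ ((n - 1) / 2)

/-- The minor `γ_{ijk}` of `Γ` evaluated at `M` (rows numbered from `1`). -/
def gam (i j k : ℕ) : F :=
  Matrix.det (Matrix.of ![gammaRow p M i, gammaRow p M j, gammaRow p M k])

/-- `δ = y² - xz`. -/
def delta : MvPolynomial (Fin 3) F := X 1 ^ 2 - X 0 * X 2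

/-- `f₁` evaluated at `M`. -/
def f1 : MvPolynomial (Fin 3) F :=
  -(C (gam p M 1 2 3) * delta ^ p) - C (gam p M 1 2 4) * X 0 ^ p * X 1 ^ p
    - C (gam p M 1 3 4) * delta * X 0 ^ (2 * p - 2) - C (gam p M 2 3 4) * X 1 * X 0 ^ (2 * p - 1)

/-- `f₂` evaluated at `M`. -/
def f2 : MvPolynomial (Fin 3) F :=
  C (gam p M 1 2 3) * X 1 ^ p ^ 2 - C (gam p M 1 2 5) * X 1 ^ p * X 0 ^ (p ^ 2 - p)
    - C (gam p M 1 3 5) * delta * X 0 ^ (p ^ 2 - 2) - C (gam p M 2 3 5) * X 1 * X 0 ^ (p ^ 2 - 1)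

/-- The combination of `f₁` and `f₂` that is `-2 x ^ (p² - 2)` times `f₃`. -/
def f3Numerator : MvPolynomial (Fin 3) F :=
  f1 p M ^ p + C (gam p M 1 2 3 ^ (p - 2)) * f2 p M ^ 2
    + C (2 * (-gam p M 1 2 3) ^ ((p - 3) / 2) * gam p M 1 2 5) * X 0 ^ (p ^ 2 - p)
      * f1 p M ^ ((p + 1) / 2)

/-- `f₃` evaluated at `M`: the quotient of `f3Numerator` by `-2 x ^ (p² - 2)`. -/
def f3 : MvPolynomial (Fin 3) F :=
  C ((-2)⁻¹) * (f3Numerator p M).divMonomial (Finsupp.single 0 (p ^ 2 - 2))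

/-- The quotient `f₃ / x`. -/
def f3DivX : MvPolynomial (Fin 3) F :=
  (f3 p M).divMonomial (Finsupp.single 0 1)

variable [Fact p.Prime] [CharP F p]

/-- The family `x, f₁, f₂, f₃, N_G(z)`. -/
def gensGeneric : Fin 5 → MvPolynomial (Fin 3) F :=
  ![X 0, f1 p M, f2 p M, f3 p M, orbitProd p M (X 2)]

/-- The family `x, f₁, N_G(y), f₃ / x, N_G(z)`. -/
def gensSpecial : Fin 5 → MvPolynomial (Fin 3) F :=
  ![X 0, f1 p M, orbitProd p M (X 1), f3DivX p M, orbitProd p M (X 2)]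

end Gens

end ElemAbelianInv

end

/-! Write `A` for the ring of invariants, and `c₀(g)`, `c₁(g)` for the two parameters of `g` (`shift
p M 0` and `shift p M 1`). Put `g₁ = f1`, `g₂ = f2`, and `g₃ = f3`, `q = 2` if `γ₁₃₅ ≠ 0`, but `g₃ =
f3 / x`, `q = 1` if `γ₁₃₅ = 0`. Their lead monomials are `y^(2p)`, `y^(p²)`, `y^(p²+q)`; when `γ₁₃₅
= 0` this needs `γ₂₃₅ ≠ 0` (`gam_235_ne_zero`).

Localization (`exists_pow_mul_mem_of_mem_invariants`). Over `B = F[x, f1, f2]` the definitions of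
`f1` and `f2` reduce `δ^p` and `y^(p²)`, so `B[y, δ]` is spanned by `y^i δ^j` with `i < p²`, `j <
p`, and it contains every polynomial up to a power of `x`. As `y` and `δ` separate the `p³` elements
of the group, these `p³` monomials become linearly independent as functions on the group. So an
invariant in `B[y, δ]` is its coefficient at `1`: up to powers of `x`, `A` is `B`.

A fifth lead monomial (`IsSeed.exists_zLead`). In `g₃^p` the power `z^(p³)` occurs only in `x^(qp)
z^(p³)`. Products of `g₁, g₂, g₃` are subtracted from it and powers of `x` divided out. Before
`x^(qp)` is reached, the invariant quotient has `z`-degree below `p³` modulo `x`, and invariance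
forces it to be a multiple of a power of `y` there (`modX_eq_C_of_mem_invariants`), which a product
of `g₁, g₂, g₃` cancels (`exists_weight_eq`). At `x^(qp)` an invariant `v` with lead monomial
`z^(p³)` appears.

Lead monomials of `A` (`IsSeed.exists_degree_eq`). The products of `x, g₁, g₂, g₃, v` with exponent
of `g₂` below `2` and of `g₃` below `p` have distinct lead monomials. By `(*)` and the formula for
`g₃^p` their span is an algebra; it is also saturated with respect to `x`, so by localization it
contains `A`. Only lead monomials matter from here on, so `v` may be replaced by `N_G(z)` and `f2`
by `N_G(y)`.

Relations (`IsLeadFamily.ker_eq`). Both relations are binomials plus terms divisible by `t₀`. For a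
suitable order on `F[t₀, …, t₄]` their lead monomials are `t₂²` and `t₃^p`. Remainders on division
map to combinations of products with distinct lead monomials, so the two relations generate the
kernel. Coprime lead monomials give regularity, and the absence of linear terms gives minimality. -/

noncomputable section

namespace ElemAbelianInv

/-! ### Algebras generated by two elements with bounded exponents -/

section Closure

variable {B S : Type*} [CommRing B] [CommRing S] [Algebra B S]

/-- The span of the monomials `Y ^ i * D ^ j` with `i < n` and `j < m`. -/
def boxSpan (B : Type*) {S : Type*} [CommRing B] [CommRing S] [Algebra B S] (Y D : S) (n m : ℕ) :
    Submodule B S :=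
  Submodule.span B (Set.range fun ij : Fin n × Fin m => Y ^ (ij.1 : ℕ) * D ^ (ij.2 : ℕ))

theorem pow_mul_pow_mem_boxSpan (Y D : S) {n m i j : ℕ} (hi : i < n) (hj : j < m) :
    Y ^ i * D ^ j ∈ boxSpan B Y D n m :=
  Submodule.subset_span ⟨(⟨i, hi⟩, ⟨j, hj⟩), rfl⟩

/-- The box is stable under multiplication by `Y` and by `D`. The rewriting is not circular, because
`Y ^ n` reduces to lower powers of `Y` and to `D` without any mixed term: `Y ^ n * D ^ j` produces
at worst `D ^ (j + 1)`, and `j + 1 ≤ m`. The lemma serves for `(y, δ)` with `(n, m) = (p², p)` and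
for `(g₂, g₃)` with `(n, m) = (2, p)`. -/
theorem adjoin_pair_le_boxSpan (Y D : S) {n m : ℕ} (hn : 0 < n) (hm : 0 < m)
    (hY : Y ^ n ∈ Submodule.span B (insert D ((fun i => Y ^ i) '' Set.Iio n)))
    (hD : D ^ m ∈ boxSpan B Y D n m) {P : S} (hP : P ∈ Algebra.adjoin B {Y, D}) :
    P ∈ boxSpan B Y D n m := by
  set N := boxSpan B Y D n m with hN
  have hDj : ∀ j ≤ m, D ^ j ∈ N := by
    intro j hj
    rcases hj.lt_or_eq with h | rfl
    · simpa using pow_mul_pow_mem_boxSpan (B := B) Y D hn h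
    · exact hD
  have hYn : ∀ Z ∈ Submodule.span B (insert D ((fun i => Y ^ i) '' Set.Iio n)), ∀ j < m,
      Z * D ^ j ∈ N := by
    intro Z hZ j hj
    induction hZ using Submodule.span_induction with
    | mem u hu =>
      rcases hu with rfl | ⟨i, hi, rfl⟩
      · rw [← pow_succ']
        exact hDj _ hj
      · exact pow_mul_pow_mem_boxSpan Y D hi hj
    | zero => simp
    | add u v _ _ hu hv => rw [add_mul]; exact N.add_mem hu hv
    | smul a u _ hu => rw [smul_mul_assoc]; exact N.smul_mem a hu
  have hYN : ∀ Q ∈ N, Y * Q ∈ N := by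
    intro Q hQ
    induction hQ using Submodule.span_induction with
    | mem u hu =>
      obtain ⟨⟨i, j⟩, rfl⟩ := hu
      rw [← mul_assoc, ← pow_succ']
      rcases (Nat.succ_le_of_lt i.2).lt_or_eq with h | h
      · exact pow_mul_pow_mem_boxSpan Y D h j.2
      · have := hYn _ hY j j.2
        rw [← h] at this
        exact this
    | zero => simp
    | add u v _ _ hu hv => rw [mul_add]; exact N.add_mem hu hv
    | smul a u _ hu => rw [mul_smul_comm]; exact N.smul_mem a hu
  -- Stability under `Y` is known by now, and it settles the overflow case of multiplication by `D`.
  have hYi : ∀ i : ℕ, Y ^ i * D ^ m ∈ N := by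
    intro i
    induction i with
    | zero => simpa using hD
    | succ i ih => rw [pow_succ', mul_assoc]; exact hYN _ ih
  have hDN : ∀ Q ∈ N, D * Q ∈ N := by
    intro Q hQ
    induction hQ using Submodule.span_induction with
    | mem u hu =>
      obtain ⟨⟨i, j⟩, rfl⟩ := hu
      have e : D * (Y ^ (i : ℕ) * D ^ (j : ℕ)) = Y ^ (i : ℕ) * D ^ ((j : ℕ) + 1) := by ring
      simp only [e]
      rcases (Nat.succ_le_of_lt j.2).lt_or_eq with h | h
      · exact pow_mul_pow_mem_boxSpan Y D i.2 h
      · have := hYi i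
        rw [← h] at this
        exact this
    | zero => simp
    | add u v _ _ hu hv => rw [mul_add]; exact N.add_mem hu hv
    | smul a u _ hu => rw [mul_smul_comm]; exact N.smul_mem a hu
  have key : ∀ Q ∈ N, P * Q ∈ N := by
    induction hP using Algebra.adjoin_induction with
    | mem u hu =>
      rcases hu with rfl | rfl
      · exact hYN
      · exact hDN
    | algebraMap r => intro Q hQ; rw [← Algebra.smul_def]; exact N.smul_mem r hQ
    | add u v _ _ hu hv => intro Q hQ; rw [add_mul]; exact N.add_mem (hu Q hQ) (hv Q hQ)
    | mul u v _ _ hu hv => intro Q hQ; rw [mul_assoc]; exact hu _ (hv _ hQ)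
  have h1 : (1 : S) ∈ N := by simpa using hDj 0 (Nat.zero_le _)
  simpa using key 1 h1

end Closure

/-! ### Functions on a finite set generated by two separating functions -/

section Functions

variable {K G : Type*} [Field K] [Fintype G]

/-- Lagrange interpolation: an affine function of `a` or of `d` is `1` at `g` and `0` at a given
`g'`, and the product over all `g' ≠ g` is the indicator of `g`. -/
theorem adjoin_eq_top_of_separates (a d : G → K)
    (hsep : Function.Injective fun g => (a g, d g)) :
    Algebra.adjoin K {a, d} = (⊤ : Subalgebra K (G → K)) := by
  classical
  set W := Algebra.adjoin K ({a, d} : Set (G → K)) with hW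
  have ha : a ∈ W := Algebra.subset_adjoin (by simp)
  have hd : d ∈ W := Algebra.subset_adjoin (by simp)
  have two : ∀ g g' : G, g ≠ g' → ∃ e ∈ W, e g = 1 ∧ e g' = 0 := by
    intro g g' hne
    have aux : ∀ u ∈ W, u g ≠ u g' → ∃ e ∈ W, e g = 1 ∧ e g' = 0 := by
      intro u hu hne
      refine ⟨(u g - u g')⁻¹ • (u - algebraMap K (G → K) (u g')),
        W.smul_mem (W.sub_mem hu (W.algebraMap_mem _)) _, ?_, ?_⟩
      · simp [sub_ne_zero.mpr hne]
      · simp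
    by_cases h : a g = a g'
    · refine aux d hd fun h' => hne (hsep (by simp [h, h']))
    · exact aux a ha h
  have single : ∀ g : G, Pi.single g (1 : K) ∈ W := by
    intro g
    choose! e he using two g
    have he2 : ∀ h, h ≠ g → e h h = 0 := fun h hh => (he h hh.symm).2.2
    have : Pi.single g (1 : K) = ∏ g' ∈ Finset.univ.erase g, e g' := by
      ext h
      rw [Finset.prod_apply]
      by_cases hh : h = g
      · subst hh
        rw [Pi.single_eq_same, Finset.prod_eq_one]
        intro i hi
        exact (he i (Finset.ne_of_mem_erase hi).symm).2.1
      · rw [Pi.single_eq_of_ne hh]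
        exact (Finset.prod_eq_zero (f := fun c => e c h) (Finset.mem_erase.2 ⟨hh, Finset.mem_univ h⟩)
          (he2 h hh)).symm
    rw [this]
    exact W.prod_mem fun i hi => (he i (Finset.ne_of_mem_erase hi).symm).1
  rw [eq_top_iff]
  intro u _
  have : u = ∑ g, u g • Pi.single g (1 : K) := by
    ext h
    simp [Finset.sum_apply, Pi.single_apply]
  rw [this]
  exact W.sum_mem fun g _ => W.smul_mem (single g) _

/-- The box spans all functions on `G` and has as many members as the dimension of that space, so it
is a basis. -/
theorem linearIndependent_pow_mul_pow (a d : G → K)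
    (hsep : Function.Injective fun g => (a g, d g)) {n m : ℕ} (hn : 0 < n) (hm : 0 < m)
    (hcard : Fintype.card G = n * m)
    (ha : a ^ n ∈ Submodule.span K (insert d ((fun i => a ^ i) '' Set.Iio n)))
    (hd : d ^ m ∈ boxSpan K a d n m) :
    LinearIndependent K fun ij : Fin n × Fin m => a ^ (ij.1 : ℕ) * d ^ (ij.2 : ℕ) := by
  apply linearIndependent_of_top_le_span_of_card_eq_finrank
  · intro u _
    apply adjoin_pair_le_boxSpan a d hn hm ha hd
    rw [adjoin_eq_top_of_separates a d hsep]
    trivial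
  · simp [hcard]

end Functions

/-! ### Families of polynomials with distinct lead monomials -/

section LeadMonomials

open MvPolynomial

variable {σ F : Type*} [Field F] (m : MonomialOrder σ)

/-- With distinct lead exponents the largest one cannot be cancelled. -/
theorem degree_sum_smul {ι : Type*} (f : ι → MvPolynomial σ F) (hf : ∀ i, f i ≠ 0)
    (c : ι → F) (s : Finset ι) (hs : s.Nonempty) (hc : ∀ i ∈ s, c i ≠ 0)
    (hinj : Set.InjOn (fun i => m.degree (f i)) s) :
    ∑ i ∈ s, c i • f i ≠ 0 ∧ ∃ i ∈ s, m.degree (∑ i ∈ s, c i • f i) = m.degree (f i) := by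
  classical
  obtain ⟨i, hi, hmax⟩ := Finset.exists_max_image s (fun i => m.toSyn (m.degree (f i))) hs
  have hlt : ∀ j ∈ s, j ≠ i → m.toSyn (m.degree (f j)) < m.toSyn (m.degree (f i)) :=
    fun j hj hji => lt_of_le_of_ne (hmax j hj) fun h => hji (hinj hj hi (m.toSyn.injective h))
  have hco : coeff (m.degree (f i)) (∑ i ∈ s, c i • f i) ≠ 0 := by
    rw [coeff_sum, Finset.sum_eq_single_of_mem i hi]
    · rw [coeff_smul, smul_eq_mul]
      exact mul_ne_zero (hc i hi) (m.leadingCoeff_ne_zero_iff.2 (hf i))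
    · intro j hj hji
      rw [coeff_smul, m.coeff_eq_zero_of_lt (hlt j hj hji), smul_zero]
  refine ⟨fun h => hco (by rw [h, coeff_zero]), i, hi, ?_⟩
  apply m.toSyn.injective
  apply le_antisymm
  · refine m.degree_sum_le.trans (Finset.sup_le fun j hj => ?_)
    exact (m.degree_smul_le).trans (hmax j hj)
  · exact m.le_degree (mem_support_iff.2 hco)

theorem exists_degree_eq_of_mem_span {ι : Type*} (f : ι → MvPolynomial σ F) (hf : ∀ i, f i ≠ 0)
    (hinj : Function.Injective fun i => m.degree (f i)) {h : MvPolynomial σ F}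
    (hh : h ∈ Submodule.span F (Set.range f)) (h0 : h ≠ 0) :
    ∃ i, m.degree h = m.degree (f i) := by
  obtain ⟨c, rfl⟩ := (Finsupp.mem_span_range_iff_exists_finsupp).1 hh
  obtain ⟨-, i, -, hi⟩ := degree_sum_smul m f hf c c.support
    (Finsupp.support_nonempty_iff.2 (by rintro rfl; simp at h0))
    (fun i hi => Finsupp.mem_support_iff.1 hi) hinj.injOn
  exact ⟨i, hi⟩

/-- Subtracting the multiple of `g` that cancels the lead term of `f` lowers the degree. -/
theorem degree_sub_lt_of_degree_eq {f g : MvPolynomial σ F} (hg : g ≠ 0)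
    (hfg : m.degree f = m.degree g)
    (h0 : f - C (m.leadingCoeff f / m.leadingCoeff g) * g ≠ 0) :
    m.toSyn (m.degree (f - C (m.leadingCoeff f / m.leadingCoeff g) * g))
      < m.toSyn (m.degree f) := by
  have hle : m.toSyn (m.degree (f - C (m.leadingCoeff f / m.leadingCoeff g) * g))
      ≤ m.toSyn (m.degree f) := by
    refine m.degree_sub_le.trans (sup_le le_rfl ?_)
    rw [hfg, ← smul_eq_C_mul]
    exact m.degree_smul_le
  refine lt_of_le_of_ne hle fun h => ?_
  have h1 := m.toSyn.injective h
  have h2 := m.coeff_degree_ne_zero_iff.2 h0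
  apply h2
  rw [h1, coeff_sub, coeff_C_mul]
  have h3 : coeff (m.degree f) g = m.leadingCoeff g := by rw [hfg]; rfl
  rw [h3, div_mul_cancel₀ _ (m.leadingCoeff_ne_zero_iff.2 hg)]
  exact sub_self _

theorem leadingTerm_C_mul_eq {f g : MvPolynomial σ F} (hf : f ≠ 0) (hg : g ≠ 0)
    (hfg : m.degree f = m.degree g) :
    m.leadingTerm (C (m.leadingCoeff f / m.leadingCoeff g) * g) = m.leadingTerm f := by
  have hf' := m.leadingCoeff_ne_zero_iff.2 hf
  have hg' := m.leadingCoeff_ne_zero_iff.2 hg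
  rw [m.leadingTerm_mul, m.leadingTerm_C]
  simp only [MonomialOrder.leadingTerm, C_mul_monomial, hfg]
  rw [div_mul_cancel₀ _ hg']

theorem le_span_of_degree {ι : Type*} (A : Submodule F (MvPolynomial σ F))
    (f : ι → MvPolynomial σ F) (hf : ∀ i, f i ≠ 0) (hfA : ∀ i, f i ∈ A)
    (hA : ∀ h ∈ A, h ≠ 0 → ∃ i, m.degree h = m.degree (f i)) :
    A ≤ Submodule.span F (Set.range f) := by
  intro h hh
  induction hd : m.toSyn (m.degree h) using WellFoundedLT.induction generalizing h with
  | ind d ih =>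
    by_cases h0 : h = 0
    · simp [h0]
    obtain ⟨i, hi⟩ := hA h hh h0
    set c := m.leadingCoeff h / m.leadingCoeff (f i) with hc
    have hsub : h - C c * f i ∈ Submodule.span F (Set.range f) := by
      by_cases h1 : h - C c * f i = 0
      · simp [h1]
      refine ih _ ?_ (A.sub_mem hh ?_) rfl
      · rw [← hd]
        exact degree_sub_lt_of_degree_eq m (hf i) hi h1
      · rw [← smul_eq_C_mul]
        exact A.smul_mem _ (hfA i)
    have : h = (h - C c * f i) + c • f i := by rw [smul_eq_C_mul]; ring
    rw [this]
    exact add_mem hsub (Submodule.smul_mem _ _ (Submodule.subset_span ⟨i, rfl⟩))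

/-- Saturation of the span with respect to a variable. The lead monomial of `X x * h` is that of
some `f i`, it contains `x`, so `f i = X x * f j` and `f j` cancels the lead term of `h`; induct on
the lead monomial. -/
theorem mem_span_of_X_mul_mem {ι : Type*} (f : ι → MvPolynomial σ F) (hf : ∀ i, f i ≠ 0)
    (hinj : Function.Injective fun i => m.degree (f i)) (x : σ)
    (hx : ∀ i, m.degree (f i) x ≠ 0 → ∃ j, f i = X x * f j) (h : MvPolynomial σ F)
    (hh : X x * h ∈ Submodule.span F (Set.range f)) : h ∈ Submodule.span F (Set.range f) := by
  induction hd : m.toSyn (m.degree h) using WellFoundedLT.induction generalizing h with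
  | ind d ih =>
    by_cases h0 : h = 0
    · simp [h0]
    have hX : (X x : MvPolynomial σ F) ≠ 0 := X_ne_zero x
    obtain ⟨i, hi⟩ := exists_degree_eq_of_mem_span m f hf hinj hh (mul_ne_zero hX h0)
    obtain ⟨j, hj⟩ := hx i (by
      rw [← hi, m.degree_mul hX h0, m.degree_X]
      simp)
    have hdeg : m.degree h = m.degree (f j) := by
      rw [hj, m.degree_mul hX h0, m.degree_mul hX (hf j)] at hi
      exact add_left_cancel hi
    set c := m.leadingCoeff h / m.leadingCoeff (f j) with hc
    have hsub : h - C c * f j ∈ Submodule.span F (Set.range f) := by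
      by_cases h1 : h - C c * f j = 0
      · simp [h1]
      refine ih _ ?_ _ ?_ rfl
      · rw [← hd]
        exact degree_sub_lt_of_degree_eq m (hf j) hdeg h1
      · have : X x * (h - C c * f j) = X x * h - c • f i := by
          rw [hj, smul_eq_C_mul]; ring
        rw [this]
        exact sub_mem hh (Submodule.smul_mem _ _ (Submodule.subset_span ⟨i, rfl⟩))
    have : h = (h - C c * f j) + c • f j := by rw [smul_eq_C_mul]; ring
    rw [this]
    exact add_mem hsub (Submodule.smul_mem _ _ (Submodule.subset_span ⟨j, rfl⟩))

end LeadMonomials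

/-! ### Subduction and SAGBI bases -/

section Subduction

open MvPolynomial

variable {σ F : Type*} [Field F] {m : MonomialOrder σ} {n : ℕ} {g : Fin n → MvPolynomial σ F}

theorem gpow_ne_zero (hg : ∀ i, g i ≠ 0) (E : Fin n →₀ ℕ) : gpow g E ≠ 0 :=
  Finset.prod_ne_zero_iff.2 fun i _ => pow_ne_zero _ (hg i)

theorem degree_gpow (hg : ∀ i, g i ≠ 0) (E : Fin n →₀ ℕ) :
    m.degree (gpow g E) = ∑ i, E i • m.degree (g i) := by
  rw [gpow, m.degree_prod fun i _ => pow_ne_zero _ (hg i)]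
  simp [m.degree_pow]

theorem aeval_monomial_eq_gpow (E : Fin n →₀ ℕ) (c : F) :
    aeval g (monomial E c) = C c * gpow g E := by
  rw [aeval_monomial, gpow, Finsupp.prod_fintype _ _ (by simp)]
  rfl

theorem gpow_mem {A : Subalgebra F (MvPolynomial σ F)} (hg : ∀ i, g i ∈ A) (E : Fin n →₀ ℕ) :
    gpow g E ∈ A :=
  A.prod_mem fun i _ => A.pow_mem (hg i) _

theorem SubductsToZero.aeval_eq {h : MvPolynomial σ F} {Q : MvPolynomial (Fin n) F}
    (hQ : SubductsToZero m g h Q) : aeval g Q = h := by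
  induction hQ with
  | zero => simp
  | step h E c Q hh hlt hQ ih => rw [map_add, ih, aeval_monomial_eq_gpow]; ring

theorem IsSubductionRelation.aeval_eq_zero {T R : MvPolynomial (Fin n) F}
    (hR : IsSubductionRelation m g T R) : aeval g R = 0 := by
  obtain ⟨Q, hQ, rfl⟩ := hR
  rw [map_sub, hQ.aeval_eq, sub_self]

/-- Lead monomials never rise during a subduction. This bounds the monomials that can occur in a
relation constructed by subducting. -/
theorem SubductsToZero.degree_le (hg : ∀ i, g i ≠ 0) {h : MvPolynomial σ F}
    {Q : MvPolynomial (Fin n) F} (hQ : SubductsToZero m g h Q) {E : Fin n →₀ ℕ}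
    (hE : E ∈ Q.support) : m.toSyn (m.degree (gpow g E)) ≤ m.toSyn (m.degree h) := by
  classical
  induction hQ with
  | zero => simp at hE
  | step h E' c Q hh hlt hQ ih =>
    have hc : c ≠ 0 := by
      rintro rfl
      rw [C_0, zero_mul, m.leadingTerm_zero, eq_comm, m.leadingTerm_eq_zero_iff] at hlt
      exact hh hlt
    have hdeg : m.degree (gpow g E') = m.degree h := by
      have := congrArg m.degree hlt
      rwa [m.degree_leadingTerm, m.degree_leadingTerm,
        m.degree_mul (C_ne_zero.2 hc) (gpow_ne_zero hg E'), m.degree_C, zero_add] at this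
    rcases Finset.mem_union.1 (support_add hE) with h1 | h1
    · have := Finset.mem_singleton.1 (support_monomial_subset h1)
      rw [this, hdeg]
    · refine (ih h1).trans (m.degree_sub_le.trans (sup_le le_rfl ?_))
      rw [← smul_eq_C_mul, ← hdeg]
      exact m.degree_smul_le

theorem exists_subductsToZero (hg : ∀ i, g i ≠ 0) (A : Subalgebra F (MvPolynomial σ F))
    (hgA : ∀ i, g i ∈ A)
    (hA : ∀ h ∈ A, h ≠ 0 → ∃ E, m.degree h = m.degree (gpow g E)) {h : MvPolynomial σ F}
    (hh : h ∈ A) : ∃ Q, SubductsToZero m g h Q := by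
  induction hd : m.toSyn (m.degree h) using WellFoundedLT.induction generalizing h with
  | ind d ih =>
    by_cases h0 : h = 0
    · exact ⟨0, h0 ▸ SubductsToZero.zero⟩
    obtain ⟨E, hE⟩ := hA h hh h0
    have hE0 := gpow_ne_zero hg E
    set c := m.leadingCoeff h / m.leadingCoeff (gpow g E) with hc
    have hlt : m.leadingTerm (C c * gpow g E) = m.leadingTerm h :=
      leadingTerm_C_mul_eq m h0 hE0 hE
    obtain ⟨Q, hQ⟩ : ∃ Q, SubductsToZero m g (h - C c * gpow g E) Q := by
      by_cases h1 : h - C c * gpow g E = 0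
      · exact ⟨0, h1 ▸ SubductsToZero.zero⟩
      refine ih _ ?_ (A.sub_mem hh (A.mul_mem (A.algebraMap_mem c) (gpow_mem hgA E))) rfl
      rw [← hd]
      exact degree_sub_lt_of_degree_eq m hE0 hE h1
    exact ⟨_, .step h E c Q h0 hlt hQ⟩

theorem isSagbiBasis_of_degree (hg : ∀ i, g i ≠ 0) (A : Subalgebra F (MvPolynomial σ F))
    (hgA : ∀ i, g i ∈ A)
    (hA : ∀ h ∈ A, h ≠ 0 → ∃ E, m.degree h = m.degree (gpow g E)) :
    IsSagbiBasis m (Set.range g) A := by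
  have hsub : Set.range g ⊆ A := by rintro _ ⟨i, rfl⟩; exact hgA i
  refine ⟨hsub, le_antisymm (Algebra.adjoin_mono ?_) (Algebra.adjoin_le ?_)⟩
  · rintro _ ⟨f, hf, h0, rfl⟩
    exact ⟨f, hsub hf, h0, rfl⟩
  · rintro _ ⟨f, hf, h0, rfl⟩
    obtain ⟨E, hE⟩ := hA f hf h0
    have : monomial (m.degree f) (1 : F) = ∏ i, (monomial (m.degree (g i)) (1 : F)) ^ E i := by
      rw [hE, degree_gpow hg]
      simp_rw [monomial_pow, one_pow]
      rw [monomial_sum_one]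
    rw [this]
    refine Subalgebra.prod_mem _ fun i _ => Subalgebra.pow_mem _ (Algebra.subset_adjoin ?_) _
    exact ⟨g i, ⟨i, rfl⟩, hg i, rfl⟩

theorem adjoin_range_eq_of_degree (hg : ∀ i, g i ≠ 0) (A : Subalgebra F (MvPolynomial σ F))
    (hgA : ∀ i, g i ∈ A)
    (hA : ∀ h ∈ A, h ≠ 0 → ∃ E, m.degree h = m.degree (gpow g E)) :
    Algebra.adjoin F (Set.range g) = A := by
  apply le_antisymm
  · apply Algebra.adjoin_le
    rintro _ ⟨i, rfl⟩
    exact hgA i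
  · intro f hf
    have h1 := le_span_of_degree m (Subalgebra.toSubmodule A) (gpow g) (gpow_ne_zero hg)
      (gpow_mem hgA) hA hf
    have h2 : Submodule.span F (Set.range (gpow g)) ≤
        Subalgebra.toSubmodule (Algebra.adjoin F (Set.range g)) := by
      rw [Submodule.span_le]
      rintro _ ⟨E, rfl⟩
      exact gpow_mem (fun i => Algebra.subset_adjoin (Set.mem_range_self i)) E
    exact h2 h1

end Subduction

open MvPolynomial

/-! ### A monomial order on the relations that selects `t₂²` and `t₃^p` as lead monomials -/

section GenOrder

/-- The weighted degree of an exponent vector of `t₁, …, t₄`. -/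
def tailWeight (p q : ℕ) (E : Fin 5 →₀ ℕ) : ℕ :=
  2 * p * E 1 + p ^ 2 * E 2 + (p ^ 2 + q) * E 3 + p ^ 3 * E 4

theorem tailWeight_add (p q : ℕ) (D E : Fin 5 →₀ ℕ) :
    tailWeight p q (D + E) = tailWeight p q D + tailWeight p q E := by
  simp only [tailWeight, Finsupp.add_apply]
  ring

theorem tailWeight_mono (p q : ℕ) {D E : Fin 5 →₀ ℕ} (h : D ≤ E) :
    tailWeight p q D ≤ tailWeight p q E := by
  obtain ⟨D', rfl⟩ := le_iff_exists_add.1 h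
  rw [tailWeight_add]
  exact Nat.le_add_right _ _

/-- Exponent vectors of monomials in five variables, to be ordered by weighted degree first. -/
def GenExp (_p _q : ℕ) : Type := Fin 5 →₀ ℕ

variable (p q : ℕ)

instance : AddCommMonoid (GenExp p q) := inferInstanceAs (AddCommMonoid (Fin 5 →₀ ℕ))

/-- The identity `(Fin 5 →₀ ℕ) ≃+ GenExp p q`. -/
def toGenExp : (Fin 5 →₀ ℕ) ≃+ GenExp p q := AddEquiv.refl _

/-- The key by which exponent vectors in five variables are compared. -/
def genKey (a : GenExp p q) : ℕ ×ₗ ℕ ×ₗ ℕ ×ₗ ℕ ×ₗ ℕ ×ₗ ℕ :=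
  let b := (toGenExp p q).symm a
  toLex (b 0 + tailWeight p q b, toLex (tailWeight p q b, toLex (b 3, toLex (b 2,
    toLex (b 1, b 4)))))

theorem genKey_le_iff (a b : Fin 5 →₀ ℕ) :
    genKey p q (toGenExp p q a) ≤ genKey p q (toGenExp p q b) ↔
      (a 0 + tailWeight p q a < b 0 + tailWeight p q b ∨
      (a 0 + tailWeight p q a = b 0 + tailWeight p q b ∧
        (tailWeight p q a < tailWeight p q b ∨ (tailWeight p q a = tailWeight p q b ∧
        (a 3 < b 3 ∨ (a 3 = b 3 ∧ (a 2 < b 2 ∨ (a 2 = b 2 ∧ (a 1 < b 1 ∨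
          (a 1 = b 1 ∧ a 4 ≤ b 4)))))))))) := by
  simp only [genKey, Prod.Lex.le_iff, ofLex_toLex, AddEquiv.symm_apply_apply]

theorem genKey_injective : Function.Injective (genKey p q) := by
  intro a b h
  obtain ⟨a, rfl⟩ := (toGenExp p q).surjective a
  obtain ⟨b, rfl⟩ := (toGenExp p q).surjective b
  have h1 := (genKey_le_iff p q a b).1 h.le
  have h2 := (genKey_le_iff p q b a).1 h.ge
  congr 1
  ext i
  fin_cases i <;> simp <;> omega

instance : LinearOrder (GenExp p q) := LinearOrder.lift' (genKey p q) (genKey_injective p q)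

instance : IsOrderedAddMonoid (GenExp p q) where
  add_le_add_left a b h c := by
    obtain ⟨a, rfl⟩ := (toGenExp p q).surjective a
    obtain ⟨b, rfl⟩ := (toGenExp p q).surjective b
    obtain ⟨c, rfl⟩ := (toGenExp p q).surjective c
    rw [← map_add, ← map_add]
    change genKey p q _ ≤ genKey p q _ at h
    change genKey p q _ ≤ genKey p q _
    rw [genKey_le_iff] at h ⊢
    simp only [Finsupp.add_apply, tailWeight_add]
    omega

instance : WellFoundedLT (GenExp p q) :=
  ⟨InvImage.wf (genKey p q) wellFounded_lt⟩

/-- Compares weighted degrees, then prefers the smaller exponent of `t₀`, then the larger exponent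
of `t₃`, then the larger exponent of `t₂`. -/
def genOrder : MonomialOrder (Fin 5) where
  syn := GenExp p q
  toSyn := toGenExp p q
  toSyn_monotone a b h := by
    change genKey p q _ ≤ genKey p q _
    rw [genKey_le_iff]
    have h0 := h 0
    have h1 := h 1
    have h2 := h 2
    have h3 := h 3
    have h4 := h 4
    have := tailWeight_mono p q h
    omega

theorem genOrder_le_iff (a b : Fin 5 →₀ ℕ) :
    (genOrder p q).toSyn a ≤ (genOrder p q).toSyn b ↔
      (a 0 + tailWeight p q a < b 0 + tailWeight p q b ∨
      (a 0 + tailWeight p q a = b 0 + tailWeight p q b ∧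
        (tailWeight p q a < tailWeight p q b ∨ (tailWeight p q a = tailWeight p q b ∧
        (a 3 < b 3 ∨ (a 3 = b 3 ∧ (a 2 < b 2 ∨ (a 2 = b 2 ∧ (a 1 < b 1 ∨
          (a 1 = b 1 ∧ a 4 ≤ b 4)))))))))) :=
  genKey_le_iff p q a b

end GenOrder

theorem grevlex_le_iff (a b : Fin 3 →₀ ℕ) :
    grevlex.toSyn a ≤ grevlex.toSyn b ↔
      (a 0 + a 1 + a 2 < b 0 + b 1 + b 2 ∨
        (a 0 + a 1 + a 2 = b 0 + b 1 + b 2 ∧ (a 1 + a 2 < b 1 + b 2 ∨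
          (a 1 + a 2 = b 1 + b 2 ∧ a 2 ≤ b 2)))) :=
  grevlexKey_le_iff a b

theorem degree_eq_of_forall_le {σ F : Type*} [Field F] (m : MonomialOrder σ)
    {f : MvPolynomial σ F} {d : σ →₀ ℕ} (hd : coeff d f ≠ 0)
    (h : ∀ e ∈ f.support, m.toSyn e ≤ m.toSyn d) : m.degree f = d := by
  apply m.toSyn.injective
  exact le_antisymm (m.degree_le_iff.2 h) (m.le_degree (mem_support_iff.2 hd))

/-! ### Regular sequences from coprime lead monomials -/

section Regular

variable {σ F : Type*} [Field F] (m : MonomialOrder σ)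

/-- Two polynomials with coprime lead monomials `X i ^ a`, `X j ^ b` satisfy: multiples of both are
multiples of the product. -/
theorem dvd_of_mul_eq_mul {r s : MvPolynomial σ F} {i j : σ} (hij : i ≠ j) {a b : ℕ} (ha : a ≠ 0)
    (hr : m.degree r = Finsupp.single i a) (hs : m.degree s = Finsupp.single j b)
    (hs0 : s ≠ 0) {u v : MvPolynomial σ F} (h : u * s = r * v) : r ∣ u := by
  have hr0 : r ≠ 0 := m.ne_zero_of_degree_ne_zero (by rw [hr]; simpa using ha)
  obtain ⟨k, t, hk, -, ht⟩ := m.div_single (b := r)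
    (isUnit_iff_ne_zero.2 (m.leadingCoeff_ne_zero_iff.2 hr0)) u
  suffices t = 0 by exact ⟨k, by rw [hk, this, add_zero, mul_comm]⟩
  by_contra ht0
  have h1 : t * s = r * (v - k * s) := by rw [mul_sub, ← h, hk]; ring
  have hne : v - k * s ≠ 0 := by
    intro h2
    rw [h2, mul_zero] at h1
    exact (mul_ne_zero ht0 hs0) h1
  -- The lead monomial of `s` is free of `X i`, so `X i ^ a` has to divide that of `t`, against the
  -- property of a remainder.
  have h2 := congrArg m.degree h1
  rw [m.degree_mul ht0 hs0, m.degree_mul hr0 hne, hr, hs] at h2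
  apply ht _ (m.degree_mem_support ht0)
  rw [hr, Finsupp.single_le_iff]
  have h3 := DFunLike.congr_fun h2 i
  rw [Finsupp.add_apply, Finsupp.add_apply, Finsupp.single_eq_same,
    Finsupp.single_eq_of_ne hij] at h3
  omega

/-- By `dvd_of_mul_eq_mul`, `s` is a nonzerodivisor modulo `r`; the vanishing constant terms make
the ideal proper. -/
theorem isRegular_pair {r s : MvPolynomial σ F} {i j : σ} (hij : i ≠ j) {a b : ℕ} (ha : a ≠ 0)
    (hb : b ≠ 0) (hr : m.degree r = Finsupp.single i a) (hs : m.degree s = Finsupp.single j b)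
    (hr0 : coeff 0 r = 0) (hs0 : coeff 0 s = 0) :
    RingTheory.Sequence.IsRegular (MvPolynomial σ F) [r, s] := by
  have hrne : r ≠ 0 := m.ne_zero_of_degree_ne_zero (by rw [hr]; simpa using ha)
  have hsne : s ≠ 0 := m.ne_zero_of_degree_ne_zero (by rw [hs]; simpa using hb)
  refine ⟨?_, ?_⟩
  · rw [RingTheory.Sequence.isWeaklyRegular_cons_iff, RingTheory.Sequence.isWeaklyRegular_singleton_iff]
    constructor
    · intro u v huv
      exact mul_left_cancel₀ hrne huv
    · rw [isSMulRegular_iff_right_eq_zero_of_smul]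
      intro u hu
      obtain ⟨u, rfl⟩ := Submodule.Quotient.mk_surjective _ u
      rw [← Submodule.Quotient.mk_smul, Submodule.Quotient.mk_eq_zero,
        Submodule.mem_smul_pointwise_iff_exists] at hu
      obtain ⟨v, -, hv⟩ := hu
      rw [Submodule.Quotient.mk_eq_zero, Submodule.mem_smul_pointwise_iff_exists]
      obtain ⟨w, hw⟩ := dvd_of_mul_eq_mul m hij ha hr hs hsne (u := u) (v := v) (by
        rw [mul_comm]; exact hv.symm)
      exact ⟨w, trivial, hw.symm⟩
  · intro htop
    have h1 : (1 : MvPolynomial σ F) ∈ Ideal.ofList [r, s] • (⊤ : Submodule (MvPolynomial σ F) _) := by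
      rw [← htop]; trivial
    have h2 : Ideal.ofList [r, s] • (⊤ : Submodule (MvPolynomial σ F) (MvPolynomial σ F))
        ≤ RingHom.ker (constantCoeff (R := F) (σ := σ)) := by
      rw [Ideal.smul_top_eq_map]
      simp only [Ideal.ofList_cons, Ideal.ofList_nil]
      simp [Ideal.span_le, constantCoeff_eq, hr0, hs0, Ideal.map_sup, Ideal.map_span]
    have := h2 h1
    simp at this

end Regular

/-! ### From lead monomials to generators, relations and complete intersections -/

section Family

variable {F : Type*} [Field F]

/-- The weights of the five generators. -/
def genWeight (p q : ℕ) : Fin 5 → ℕ := ![1, 2 * p, p ^ 2, p ^ 2 + q, p ^ 3]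

/-- The lead exponents of the five generators. -/
def leadExp (p q : ℕ) : Fin 5 → Fin 3 →₀ ℕ :=
  ![Finsupp.single 0 1, Finsupp.single 1 (2 * p), Finsupp.single 1 (p ^ 2),
    Finsupp.single 1 (p ^ 2 + q), Finsupp.single 2 (p ^ 3)]

/-- Homogeneous elements of `A` with lead monomials `x, y^(2p), y^(p²), y^(p²+q), z^(p³)`, by
which all lead monomials of `A` are generated. -/
structure IsLeadFamily (p q : ℕ) (A : Subalgebra F (MvPolynomial (Fin 3) F))
    (g : Fin 5 → MvPolynomial (Fin 3) F) : Prop where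
  mem : ∀ i, g i ∈ A
  ne_zero : ∀ i, g i ≠ 0
  homog : ∀ i, (g i).IsHomogeneous (genWeight p q i)
  deg : ∀ i, grevlex.degree (g i) = leadExp p q i
  lead : ∀ h ∈ A, h ≠ 0 → ∃ E, grevlex.degree h = grevlex.degree (gpow g E)

variable {p q : ℕ} {A : Subalgebra F (MvPolynomial (Fin 3) F)}
  {g : Fin 5 → MvPolynomial (Fin 3) F}

theorem degree_gpow_of_leadExp (hne : ∀ i, g i ≠ 0)
    (hdeg : ∀ i, grevlex.degree (g i) = leadExp p q i) (E : Fin 5 →₀ ℕ) :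
    grevlex.degree (gpow g E) = Finsupp.single 0 (E 0) +
      Finsupp.single 1 (2 * p * E 1 + p ^ 2 * E 2 + (p ^ 2 + q) * E 3) +
      Finsupp.single 2 (p ^ 3 * E 4) := by
  rw [degree_gpow hne]
  simp only [hdeg, leadExp, Fin.sum_univ_five]
  ext i
  fin_cases i <;> simp <;> ring

/-- Modulo `p` only `q * c` survives and `q` is prime to `p`, which fixes `c`. After division by
`p`, the parity of `2 * a + p * b` fixes `b`, as `p` is odd. -/
theorem weight_injective (hp : p.Prime) (hp2 : p ≠ 2) (hq : q = 1 ∨ q = 2)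
    {a b c a' b' c' : ℕ} (hb : b < 2) (hb' : b' < 2) (hc : c < p) (hc' : c' < p)
    (h : 2 * p * a + p ^ 2 * b + (p ^ 2 + q) * c = 2 * p * a' + p ^ 2 * b' + (p ^ 2 + q) * c') :
    a = a' ∧ b = b' ∧ c = c' := by
  have hcop : Nat.Coprime p q := by
    rcases hq with rfl | rfl
    · simp
    · exact (Nat.coprime_primes hp Nat.prime_two).2 hp2
  have h1 : q * c ≡ q * c' [MOD p] := by
    have e1 : 2 * p * a + p ^ 2 * b + (p ^ 2 + q) * c = q * c + p * (2 * a + p * b + p * c) := by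
      ring
    have e2 : 2 * p * a' + p ^ 2 * b' + (p ^ 2 + q) * c'
        = q * c' + p * (2 * a' + p * b' + p * c') := by ring
    rw [e1, e2] at h
    have := congrArg (· % p) h
    simpa [Nat.ModEq] using this
  have hcc : c = c' := by
    have := Nat.ModEq.cancel_left_of_coprime (by simpa using hcop) h1
    rwa [Nat.ModEq, Nat.mod_eq_of_lt hc, Nat.mod_eq_of_lt hc'] at this
  subst hcc
  have h2 : 2 * a + p * b = 2 * a' + p * b' := by
    apply Nat.eq_of_mul_eq_mul_left hp.pos
    have : 2 * p * a + p ^ 2 * b = 2 * p * a' + p ^ 2 * b' := by omega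
    calc p * (2 * a + p * b) = 2 * p * a + p ^ 2 * b := by ring
      _ = 2 * p * a' + p ^ 2 * b' := this
      _ = _ := by ring
  have hodd : p % 2 = 1 := hp.eq_two_or_odd.resolve_left hp2
  refine ⟨?_, ?_, rfl⟩ <;> interval_cases b <;> interval_cases b' <;> omega

theorem sum_exponents_eq_of_isHomogeneous {f : MvPolynomial (Fin 3) F} {d : ℕ} (hf : f.IsHomogeneous d)
    {e : Fin 3 →₀ ℕ} (he : e ∈ f.support) : e 0 + e 1 + e 2 = d := by
  have := hf.degree_eq_sum_deg_support he
  rw [this, ← Finsupp.degree_apply, Finsupp.degree_eq_sum, Fin.sum_univ_three]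

theorem isHomogeneous_gpow (hg : ∀ i, (g i).IsHomogeneous (genWeight p q i)) (E : Fin 5 →₀ ℕ) :
    (gpow g E).IsHomogeneous (E 0 + tailWeight p q E) := by
  have h : (gpow g E).IsHomogeneous (∑ i, genWeight p q i * E i) :=
    IsHomogeneous.prod _ _ _ fun i _ => (hg i).pow (E i)
  convert h using 1
  simp [Fin.sum_univ_five, genWeight, tailWeight]
  ring

/-- For homogeneous generators, equal lead monomials mean equal degrees, so a subduction never
leaves the degree of `h`. -/
theorem SubductsToZero.weight_eq (hne : ∀ i, g i ≠ 0)
    (hg : ∀ i, (g i).IsHomogeneous (genWeight p q i)) {h : MvPolynomial (Fin 3) F}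
    {Q : MvPolynomial (Fin 5) F} (hQ : SubductsToZero grevlex g h Q) {W : ℕ}
    (hh : h.IsHomogeneous W) {E : Fin 5 →₀ ℕ} (hE : E ∈ Q.support) :
    E 0 + tailWeight p q E = W := by
  classical
  induction hQ with
  | zero => simp at hE
  | step h E' c Q h0 hlt hQ ih =>
    have hc : c ≠ 0 := by
      rintro rfl
      rw [C_0, zero_mul, MonomialOrder.leadingTerm_zero, eq_comm,
        MonomialOrder.leadingTerm_eq_zero_iff] at hlt
      exact h0 hlt
    have hdeg : grevlex.degree (gpow g E') = grevlex.degree h := by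
      have := congrArg grevlex.degree hlt
      rwa [MonomialOrder.degree_leadingTerm, MonomialOrder.degree_leadingTerm,
        MonomialOrder.degree_mul (C_ne_zero.2 hc) (gpow_ne_zero hne E'), MonomialOrder.degree_C,
        zero_add] at this
    have hW : E' 0 + tailWeight p q E' = W := by
      rw [← sum_exponents_eq_of_isHomogeneous hh (grevlex.degree_mem_support h0), ← hdeg]
      exact (sum_exponents_eq_of_isHomogeneous (isHomogeneous_gpow hg E')
        (grevlex.degree_mem_support (gpow_ne_zero hne E'))).symm
    rcases Finset.mem_union.1 (support_add hE) with h1 | h1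
    · rwa [Finset.mem_singleton.1 (support_monomial_subset h1)]
    · refine ih (hh.sub ?_) h1
      have := (isHomogeneous_C (Fin 3) c).mul (isHomogeneous_gpow hg E')
      rwa [zero_add, hW] at this

/-- `R` is a binomial `a t ^ I + b t ^ J` of weight `W`, modified by terms of weight `W` that are
divisible by `t₀`. -/
def IsLiftedBinomial (p q W : ℕ) (I J : Fin 5 →₀ ℕ) (a b : F) (R : MvPolynomial (Fin 5) F) : Prop :=
  ∃ Q : MvPolynomial (Fin 5) F, R = monomial I a + monomial J b - Q ∧
    ∀ E ∈ Q.support, E 0 ≠ 0 ∧ E 0 + tailWeight p q E = W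

/-- Both products have lead monomial `y^W` and these lead terms cancel, so every product used in the
subduction has degree `W` and lead monomial below `y^W`. Since `x < y < z`, such a monomial contains
`x`, and only the generator `g 0` has `x` in its lead monomial. -/
theorem IsLeadFamily.isLiftedBinomial (hg : IsLeadFamily p q A g) {W : ℕ} {I J : Fin 5 →₀ ℕ}
    {a b : F} (hI : tailWeight p q I = W) (hJ : tailWeight p q J = W) (hI0 : I 0 = 0)
    (hJ0 : J 0 = 0) (hI4 : I 4 = 0) (hJ4 : J 4 = 0) (hW : 0 < W)
    (hab : a * grevlex.leadingCoeff (gpow g I) + b * grevlex.leadingCoeff (gpow g J) = 0)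
    {R : MvPolynomial (Fin 5) F}
    (hR : IsSubductionRelation grevlex g (monomial I a + monomial J b) R) :
    IsLiftedBinomial p q W I J a b R := by
  obtain ⟨Q, hQ, rfl⟩ := hR
  refine ⟨Q, rfl, fun E hE => ?_⟩
  rw [map_add, aeval_monomial_eq_gpow, aeval_monomial_eq_gpow] at hQ
  have hd : ∀ K : Fin 5 →₀ ℕ, tailWeight p q K = W → K 4 = 0 → K 0 = 0 →
      grevlex.degree (gpow g K) = Finsupp.single 1 W := by
    intro K hK h4 h0
    rw [degree_gpow_of_leadExp hg.ne_zero hg.deg, ← hK]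
    simp [h4, h0, tailWeight]
  have hh : ∀ K : Fin 5 →₀ ℕ, tailWeight p q K = W → K 0 = 0 → ∀ c : F,
      (C c * gpow g K).IsHomogeneous W := by
    intro K hK h0 c
    have := (isHomogeneous_C (Fin 3) c).mul (isHomogeneous_gpow hg.homog K)
    rwa [zero_add, hK, h0, zero_add] at this
  have hwE := hQ.weight_eq hg.ne_zero hg.homog ((hh I hI hI0 a).add (hh J hJ hJ0 b)) hE
  refine ⟨fun hE0 => ?_, hwE⟩
  have hle := hQ.degree_le hg.ne_zero hE
  set h := C a * gpow g I + C b * gpow g J with hdef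
  have hlt : grevlex.toSyn (grevlex.degree h) < grevlex.toSyn (Finsupp.single 1 W) := by
    rw [grevlex.degree_lt_iff (by rw [map_zero]; exact (grevlex.toSyn_lt_iff_ne_zero).2 (by simpa using hW.ne'))]
    intro e he
    have hle' : grevlex.toSyn e ≤ grevlex.toSyn (Finsupp.single 1 W) := by
      refine (grevlex.le_degree he).trans (grevlex.degree_add_le.trans (sup_le ?_ ?_))
      · rw [← hd I hI hI4 hI0, ← smul_eq_C_mul]
        exact grevlex.degree_smul_le
      · rw [← hd J hJ hJ4 hJ0, ← smul_eq_C_mul]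
        exact grevlex.degree_smul_le
    refine lt_of_le_of_ne hle' fun heq => ?_
    rw [grevlex.toSyn.injective heq] at he
    apply mem_support_iff.1 he
    rw [hdef, coeff_add, coeff_C_mul, coeff_C_mul]
    have e1 : coeff (Finsupp.single 1 W) (gpow g I) = grevlex.leadingCoeff (gpow g I) := by
      rw [← hd I hI hI4 hI0]; rfl
    have e2 : coeff (Finsupp.single 1 W) (gpow g J) = grevlex.leadingCoeff (gpow g J) := by
      rw [← hd J hJ hJ4 hJ0]; rfl
    rw [e1, e2, hab]
  -- With `E 0 = 0` the lead monomial would be `y^i z^j` with `i + j = W`, which is not below `y^W`.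
  have hlt2 := lt_of_le_of_lt hle hlt
  rw [degree_gpow_of_leadExp hg.ne_zero hg.deg, grevlex_lt_iff] at hlt2
  simp [hE0] at hlt2
  simp [hE0, tailWeight] at hwE
  omega

theorem IsLiftedBinomial.degree_eq {W : ℕ} {I J : Fin 5 →₀ ℕ} {a b : F}
    {R : MvPolynomial (Fin 5) F} (hR : IsLiftedBinomial p q W I J a b R) (ha : a ≠ 0)
    (hI : tailWeight p q I = W) (hI0 : I 0 = 0) (hIJ : I ≠ J)
    (hJI : (genOrder p q).toSyn J ≤ (genOrder p q).toSyn I) :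
    (genOrder p q).degree R = I := by
  classical
  obtain ⟨Q, rfl, hQ⟩ := hR
  apply degree_eq_of_forall_le
  · have : coeff I Q = 0 := by
      by_contra h
      exact (hQ I (mem_support_iff.2 h)).1 hI0
    rw [coeff_sub, coeff_add, this, coeff_monomial, coeff_monomial, if_pos rfl,
      if_neg hIJ.symm]
    simpa using ha
  · intro e he
    rcases Finset.mem_union.1 (support_sub _ _ _ he) with h | h
    · rcases Finset.mem_union.1 (support_add h) with h | h
      · rw [Finset.mem_singleton.1 (support_monomial_subset h)]
      · rw [Finset.mem_singleton.1 (support_monomial_subset h)]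
        exact hJI
    · obtain ⟨h1, h2⟩ := hQ e h
      rw [genOrder_le_iff]
      omega

/-- Among the correction terms, all divisible by `t₀`, the only candidate of degree at most one is
`t₀` itself; its weight is `1`, not `W`. -/
theorem IsLiftedBinomial.coeff_eq_zero {W : ℕ} {I J : Fin 5 →₀ ℕ} {a b : F}
    {R : MvPolynomial (Fin 5) F} (hR : IsLiftedBinomial p q W I J a b R) (hW : 1 < W)
    {e : Fin 5 →₀ ℕ} (he : e.degree ≤ 1) (hI : 1 < I.degree) (hJ : 1 < J.degree) :
    coeff e R = 0 := by
  classical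
  obtain ⟨Q, rfl, hQ⟩ := hR
  have hQe : coeff e Q = 0 := by
    by_contra h
    obtain ⟨h1, h2⟩ := hQ e (mem_support_iff.2 h)
    rw [Finsupp.degree_eq_sum, Fin.sum_univ_five] at he
    have h11 : e 1 = 0 := by omega
    have h12 : e 2 = 0 := by omega
    have h13 : e 3 = 0 := by omega
    have h14 : e 4 = 0 := by omega
    simp [tailWeight, h11, h12, h13, h14] at h2
    omega
  rw [coeff_sub, coeff_add, hQe, coeff_monomial, coeff_monomial, if_neg, if_neg]
  · simp
  · rintro rfl; omega
  · rintro rfl; omega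

theorem coeff_single_eq_zero_of_mem {n : ℕ} {I : Ideal (MvPolynomial (Fin n) F)}
    {s : Set (MvPolynomial (Fin n) F)} (hI : I = Ideal.span s)
    (hs : ∀ r ∈ s, ∀ e : Fin n →₀ ℕ, e.degree ≤ 1 → coeff e r = 0) {f : MvPolynomial (Fin n) F}
    (hf : f ∈ I) (e : Fin n →₀ ℕ) (he : e.degree ≤ 1) : coeff e f = 0 := by
  classical
  rw [hI] at hf
  induction hf using Submodule.span_induction generalizing e with
  | mem r hr => exact hs r hr e he
  | zero => simp
  | add u v _ _ hu hv => rw [coeff_add, hu e he, hv e he, add_zero]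
  | smul a u _ hu =>
    rw [smul_eq_mul, coeff_mul]
    refine Finset.sum_eq_zero fun ab hab => ?_
    rw [hu ab.2, mul_zero]
    rw [Finset.HasAntidiagonal.mem_antidiagonal] at hab
    rw [← hab, map_add] at he
    omega

/-- If `g i` were a polynomial `P` in the others, `X i - P` would be a relation with linear term `X
i`. -/
theorem notMem_adjoin_of_coeff {n : ℕ} {σ : Type*} {g : Fin n → MvPolynomial σ F}
    (h : ∀ f ∈ RingHom.ker (aeval g : MvPolynomial (Fin n) F →ₐ[F] MvPolynomial σ F),
      ∀ e : Fin n →₀ ℕ, e.degree ≤ 1 → coeff e f = 0) (i : Fin n) :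
    g i ∉ Algebra.adjoin F (g '' {i}ᶜ) := by
  classical
  intro hi
  have h1 : Algebra.adjoin F (g '' {i}ᶜ)
      = (Algebra.adjoin F (X '' {i}ᶜ : Set (MvPolynomial (Fin n) F))).map (aeval g) := by
    rw [AlgHom.map_adjoin, Set.image_image]
    simp
  rw [h1] at hi
  obtain ⟨P, hP, hPi⟩ := hi
  have hker : X i - P ∈ RingHom.ker (aeval g : MvPolynomial (Fin n) F →ₐ[F] MvPolynomial σ F) := by
    rw [RingHom.mem_ker, map_sub, aeval_X]
    exact sub_eq_zero.2 hPi.symm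
  have h2 := h _ hker (Finsupp.single i 1) (by simp)
  have h3 : coeff (Finsupp.single i 1) P = 0 := by
    by_contra hne
    have hs : P ∈ supported F ({i}ᶜ : Set (Fin n)) := hP
    rw [mem_supported] at hs
    have : i ∈ P.vars := (mem_vars_iff_mem_support i).2 ⟨_, mem_support_iff.2 hne, by simp⟩
    exact hs this rfl
  rw [coeff_sub, h3, coeff_X, if_pos rfl] at h2
  simp at h2

/-- Divide a relation by `r` and `s`. In the remainder `t₂` has exponent below `2` and `t₃` below
`p`, so its monomials map to products with distinct lead monomials (`weight_injective`), and it
vanishes on `g` only if it is zero. -/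
theorem IsLeadFamily.ker_eq (hp : p.Prime) (hp2 : p ≠ 2) (hq : q = 1 ∨ q = 2)
    (hg : IsLeadFamily p q A g) {r s : MvPolynomial (Fin 5) F}
    (hr : (genOrder p q).degree r = Finsupp.single 2 2)
    (hs : (genOrder p q).degree s = Finsupp.single 3 p) (hr0 : aeval g r = 0)
    (hs0 : aeval g s = 0) :
    RingHom.ker (aeval g : MvPolynomial (Fin 5) F →ₐ[F] MvPolynomial (Fin 3) F)
      = Ideal.span {r, s} := by
  classical
  have hrne : r ≠ 0 := (genOrder p q).ne_zero_of_degree_ne_zero (by rw [hr]; simp)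
  have hsne : s ≠ 0 := (genOrder p q).ne_zero_of_degree_ne_zero (by rw [hs]; simpa using hp.ne_zero)
  have hle : Ideal.span {r, s}
      ≤ RingHom.ker (aeval g : MvPolynomial (Fin 5) F →ₐ[F] MvPolynomial (Fin 3) F) := by
    rw [Ideal.span_le]
    rintro _ (rfl | rfl)
    · exact hr0
    · exact hs0
  refine le_antisymm ?_ hle
  intro f hf
  obtain ⟨k, t, hk, -, ht⟩ := (genOrder p q).div_set (B := {r, s}) (by
    rintro _ (rfl | rfl)
    · exact isUnit_iff_ne_zero.2 (MonomialOrder.leadingCoeff_ne_zero_iff.2 hrne)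
    · exact isUnit_iff_ne_zero.2 (MonomialOrder.leadingCoeff_ne_zero_iff.2 hsne)) f
  have hmem : Finsupp.linearCombination _
      (fun b : ({r, s} : Set (MvPolynomial (Fin 5) F)) => (b : MvPolynomial (Fin 5) F)) k
        ∈ Ideal.span {r, s} := by
    rw [Finsupp.linearCombination_apply, Finsupp.sum]
    exact Ideal.sum_mem _ fun b _ => Ideal.mul_mem_left _ _ (Ideal.subset_span b.2)
  suffices t = 0 by rw [hk, this, add_zero]; exact hmem
  by_contra ht0
  have htk : aeval g t = 0 := by
    have : t = f - Finsupp.linearCombination _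
      (fun b : ({r, s} : Set (MvPolynomial (Fin 5) F)) => (b : MvPolynomial (Fin 5) F)) k := by
      rw [hk]; ring
    rw [this, map_sub, hle hmem, sub_zero]
    exact hf
  have hnorm : ∀ E ∈ t.support, E 2 < 2 ∧ E 3 < p := by
    intro E hE
    have h1 := ht E hE r (by simp)
    have h2 := ht E hE s (by simp)
    rw [hr, Finsupp.single_le_iff] at h1
    rw [hs, Finsupp.single_le_iff] at h2
    omega
  have hsum : aeval g t = ∑ E ∈ t.support, coeff E t • gpow g E := by
    conv_lhs => rw [t.as_sum, map_sum]
    refine Finset.sum_congr rfl fun E _ => ?_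
    rw [aeval_monomial_eq_gpow, smul_eq_C_mul]
  have := (degree_sum_smul grevlex (gpow g) (gpow_ne_zero hg.ne_zero) (fun E => coeff E t) t.support
    (by rwa [Finset.nonempty_iff_ne_empty, Ne, support_eq_empty])
    (fun E hE => mem_support_iff.1 hE) ?_).1
  · exact this (hsum ▸ htk)
  · intro E hE E' hE' heq
    simp only [degree_gpow_of_leadExp hg.ne_zero hg.deg] at heq
    have h0 := DFunLike.congr_fun heq 0
    have h1 := DFunLike.congr_fun heq 1
    have h2 := DFunLike.congr_fun heq 2
    simp at h0 h1 h2
    obtain ⟨ha, hb, hc⟩ := weight_injective hp hp2 hq (hnorm E hE).1 (hnorm E' hE').1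
      (hnorm E hE).2 (hnorm E' hE').2 h1
    have h4 : E 4 = E' 4 := h2.resolve_right hp.ne_zero
    ext i
    fin_cases i <;> simp_all

/-- Both orders of the relations are recorded: the case `γ₁₃₅ ≠ 0` lists `(*)` first, the case `γ₁₃₅
= 0` lists the relation for `t₃^p` first. -/
theorem IsLeadFamily.isCompleteIntersectionOn (hp : p.Prime) (hp2 : p ≠ 2) (hq : q = 1 ∨ q = 2)
    (hg : IsLeadFamily p q A g) {J : Fin 5 →₀ ℕ} {a b c d : F} {r s : MvPolynomial (Fin 5) F}
    (hr : IsLiftedBinomial p q (2 * p ^ 2) (Finsupp.single 2 2) (Finsupp.single 1 p) a b r)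
    (hs : IsLiftedBinomial p q (p * (p ^ 2 + q)) (Finsupp.single 3 p) J c d s)
    (ha : a ≠ 0) (hc : c ≠ 0) (hJ : tailWeight p q J = p * (p ^ 2 + q)) (hJ0 : J 0 = 0)
    (hJ3 : J 3 = 0) (hJ1 : 1 < J.degree) (hr0 : aeval g r = 0) (hs0 : aeval g s = 0) :
    IsCompleteIntersectionOn A g [r, s] ∧ IsCompleteIntersectionOn A g [s, r] := by
  have hp0 := hp.pos
  have hp1 := hp.one_lt
  have hI3 : tailWeight p q (Finsupp.single 3 p) = p * (p ^ 2 + q) := by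
    simp [tailWeight]
    ring
  have hI2 : tailWeight p q (Finsupp.single 2 2) = 2 * p ^ 2 := by
    simp [tailWeight]
    ring
  have hdr : (genOrder p q).degree r = Finsupp.single 2 2 := by
    refine hr.degree_eq ha hI2 (by simp) (fun h => ?_) ?_
    · simpa using DFunLike.congr_fun h 2
    -- `t₁^p` and `t₂²` have the same weight `2p²`; the tie goes to the larger exponent of `t₂`.
    · rw [genOrder_le_iff, hI2]
      have : 2 * p * p = 2 * p ^ 2 := by ring
      simp [tailWeight, this]
  have hds : (genOrder p q).degree s = Finsupp.single 3 p := by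
    refine hs.degree_eq hc hI3 (by simp) (fun h => ?_) ?_
    · have := DFunLike.congr_fun h 3
      simp [hJ3] at this
      omega
    · rw [genOrder_le_iff, hI3, hJ]
      simp [hJ0, hJ3, hp0]
  have hcr : ∀ e : Fin 5 →₀ ℕ, e.degree ≤ 1 → coeff e r = 0 := fun e he =>
    hr.coeff_eq_zero (by nlinarith) he (by simp) (by simpa using hp1)
  have hcs : ∀ e : Fin 5 →₀ ℕ, e.degree ≤ 1 → coeff e s = 0 := fun e he =>
    hs.coeff_eq_zero (by nlinarith) he (by simpa using hp1) hJ1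
  have hker := hg.ker_eq hp hp2 hq hdr hds hr0 hs0
  have hadj := adjoin_range_eq_of_degree hg.ne_zero A hg.mem hg.lead
  have hmin := notMem_adjoin_of_coeff (g := g) fun f hf e he =>
    coeff_single_eq_zero_of_mem hker (by rintro _ (rfl | rfl); exacts [hcr, hcs]) hf e he
  have h23 : (2 : Fin 5) ≠ 3 := by decide
  refine ⟨⟨hadj, hmin, ?_, isRegular_pair _ h23 two_ne_zero hp0.ne' hdr hds (hcr 0 (by simp))
    (hcs 0 (by simp))⟩, ⟨hadj, hmin, ?_, isRegular_pair _ h23.symm hp0.ne' two_ne_zero hds hdr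
    (hcs 0 (by simp)) (hcr 0 (by simp))⟩⟩
  · rw [hker]
    simp [Ideal.span_insert]
  · rw [hker]
    simp [Ideal.span_insert, sup_comm]

theorem IsLeadFamily.exists_isSubductionRelation (hg : IsLeadFamily p q A g)
    (T : MvPolynomial (Fin 5) F) : ∃ R, IsSubductionRelation grevlex g T R := by
  have hT : aeval g T ∈ A := by
    rw [← adjoin_range_eq_of_degree hg.ne_zero A hg.mem hg.lead,
      Algebra.adjoin_range_eq_range_aeval]
    exact ⟨T, rfl⟩
  obtain ⟨Q, hQ⟩ := exists_subductsToZero hg.ne_zero A hg.mem hg.lead hT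
  exact ⟨T - Q, Q, hQ, rfl⟩

end Family

/-! ### The parameters of the group elements, the minors, and invariance of `f1` and `f2` -/

section Shifts

variable {F : Type*} [Field F] (p : ℕ) [Fact p.Prime] [CharP F p] (M : Matrix (Fin 2) (Fin 3) F)

/-- The `i`-th parameter of `rep p M g = σ(c₀, c₁)`. -/
def shift (i : Fin 2) (g : Multiplicative (Fin 3 → ZMod p)) : F :=
  ∑ j, ZMod.castHom dvd_rfl F (g.toAdd j) * M i j

theorem shift_mul (i : Fin 2) (g h : Multiplicative (Fin 3 → ZMod p)) :
    shift p M i (g * h) = shift p M i g + shift p M i h := by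
  simp [shift, add_mul, Finset.sum_add_distrib]

theorem shift_inv (i : Fin 2) (g : Multiplicative (Fin 3 → ZMod p)) :
    shift p M i g⁻¹ = -shift p M i g := by
  simp [shift]

/-- Frobenius fixes the coordinates of `g`, which lie in the prime field, so only the entries of `M`
are raised to the power. Hence `p`-power rows of `Γ` evaluate to `p`-powers of the parameters. -/
theorem shift_pow (i : Fin 2) (g : Multiplicative (Fin 3 → ZMod p)) (k : ℕ) :
    shift p M i g ^ p ^ k = ∑ j, ZMod.castHom dvd_rfl F (g.toAdd j) * M i j ^ p ^ k := by
  rw [shift, sum_pow_char_pow]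
  refine Finset.sum_congr rfl fun j _ => ?_
  rw [mul_pow, ← map_pow, ZMod.pow_card_pow]

theorem act_x (g : Multiplicative (Fin 3 → ZMod p)) : act (rep p M g) (X 0) = X 0 :=
  act_sigma_x _ _

theorem act_y (g : Multiplicative (Fin 3 → ZMod p)) :
    act (rep p M g) (X 1) = X 1 + C (shift p M 0 g) * X 0 :=
  act_sigma_y _ _

theorem act_z (g : Multiplicative (Fin 3 → ZMod p)) :
    act (rep p M g) (X 2) = X 2 + C (2 * shift p M 0 g) * X 1
      + C (shift p M 0 g ^ 2 + shift p M 1 g) * X 0 :=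
  act_sigma_z _ _

theorem act_C (A : Matrix (Fin 3) (Fin 3) F) (c : F) : act A (C c) = C c :=
  (act A).commutes c

theorem act_delta (g : Multiplicative (Fin 3 → ZMod p)) :
    act (rep p M g) delta = delta - C (shift p M 1 g) * X 0 ^ 2 := by
  simp only [delta, map_sub, map_mul, map_pow, act_x, act_y, act_z, C_add]
  have : (C 2 : MvPolynomial (Fin 3) F) = 2 := map_ofNat C 2
  rw [this]
  ring

/-- Cramer's dependency among four vectors of a three-dimensional space. Applied to rows of `Γ` and
contracted with the coordinates of `g`, it yields the two shift relations. -/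
theorem det_relation (u v w t : Fin 3 → F) (j : Fin 3) :
    Matrix.det (Matrix.of ![u, v, w]) * t j - Matrix.det (Matrix.of ![u, v, t]) * w j
      + Matrix.det (Matrix.of ![u, w, t]) * v j - Matrix.det (Matrix.of ![v, w, t]) * u j = 0 := by
  simp only [Matrix.det_fin_three]
  fin_cases j <;> simp <;> ring

theorem shift_relation_one (g : Multiplicative (Fin 3 → ZMod p)) :
    gam p M 1 2 3 * shift p M 1 g ^ p - gam p M 1 2 4 * shift p M 0 g ^ p
      + gam p M 1 3 4 * shift p M 1 g - gam p M 2 3 4 * shift p M 0 g = 0 := by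
  have h1 := shift_pow p M 1 g 1
  have h0 := shift_pow p M 0 g 1
  rw [pow_one] at h0 h1
  rw [h0, h1]
  simp only [shift, Finset.mul_sum]
  rw [← Finset.sum_sub_distrib, ← Finset.sum_add_distrib, ← Finset.sum_sub_distrib]
  refine Finset.sum_eq_zero fun j _ => ?_
  have := det_relation (gammaRow p M 1) (gammaRow p M 2) (gammaRow p M 3) (gammaRow p M 4) j
  rw [← gam, ← gam, ← gam, ← gam] at this
  simp [gammaRow] at this
  linear_combination (ZMod.castHom dvd_rfl F (g.toAdd j)) * this

theorem shift_relation_two (g : Multiplicative (Fin 3 → ZMod p)) :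
    gam p M 1 2 3 * shift p M 0 g ^ p ^ 2 - gam p M 1 2 5 * shift p M 0 g ^ p
      + gam p M 1 3 5 * shift p M 1 g - gam p M 2 3 5 * shift p M 0 g = 0 := by
  have h2 := shift_pow p M 0 g 2
  have h0 := shift_pow p M 0 g 1
  rw [pow_one] at h0
  rw [h0, h2]
  simp only [shift, Finset.mul_sum]
  rw [← Finset.sum_sub_distrib, ← Finset.sum_add_distrib, ← Finset.sum_sub_distrib]
  refine Finset.sum_eq_zero fun j _ => ?_
  have := det_relation (gammaRow p M 1) (gammaRow p M 2) (gammaRow p M 3) (gammaRow p M 5) j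
  rw [← gam, ← gam, ← gam, ← gam] at this
  simp [gammaRow] at this
  linear_combination (ZMod.castHom dvd_rfl F (g.toAdd j)) * this

theorem one_lt_prime : 1 < p := (Fact.out : p.Prime).one_lt

theorem x_mem_invariants : X 0 ∈ invariants p M :=
  (mem_invariants p M _).2 fun g => act_x p M g

/-- Here `y` changes by `c₀ x` and `δ` by `-c₁ x²`, and `p`-th powers are additive. The total change
is `x^(2p)` times the left side of `shift_relation_one`; `f2` behaves likewise with `x^(p²)` and
`shift_relation_two`. -/
theorem f1_mem_invariants : f1 p M ∈ invariants p M := by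
  refine (mem_invariants p M _).2 fun g => ?_
  have hp := one_lt_prime p
  have hr := congrArg (C : F → MvPolynomial (Fin 3) F) (shift_relation_one p M g)
  simp only [f1, map_sub, map_neg, map_add, map_mul, map_pow, act_C, act_delta, act_x, act_y,
    C_0] at hr ⊢
  rw [sub_pow_char, add_pow_char, mul_pow, mul_pow, ← pow_mul]
  obtain ⟨k, rfl⟩ := Nat.exists_eq_add_of_le' hp
  have e1 : 2 * (k + 2) - 2 = 2 * k + 2 := by omega
  have e2 : 2 * (k + 2) - 1 = 2 * k + 3 := by omega
  rw [e1, e2]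
  linear_combination (X 0 ^ (2 * k + 4)) * hr

theorem f2_mem_invariants : f2 p M ∈ invariants p M := by
  refine (mem_invariants p M _).2 fun g => ?_
  have hp := one_lt_prime p
  have hr := congrArg (C : F → MvPolynomial (Fin 3) F) (shift_relation_two p M g)
  simp only [f2, map_sub, map_add, map_mul, map_pow, act_C, act_delta, act_x, act_y,
    C_0] at hr ⊢
  rw [add_pow_char_pow, add_pow_char, mul_pow, mul_pow]
  have e : p + (p ^ 2 - p) = p ^ 2 := Nat.add_sub_cancel' (by nlinarith)
  have e1 : 2 + (p ^ 2 - 2) = p ^ 2 := Nat.add_sub_cancel' (by nlinarith)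
  have e2 : 1 + (p ^ 2 - 1) = p ^ 2 := Nat.add_sub_cancel' (by nlinarith)
  have x1 : (X 0 : MvPolynomial (Fin 3) F) ^ p * X 0 ^ (p ^ 2 - p) = X 0 ^ p ^ 2 := by
    rw [← pow_add, e]
  have x2 : (X 0 : MvPolynomial (Fin 3) F) ^ 2 * X 0 ^ (p ^ 2 - 2) = X 0 ^ p ^ 2 := by
    rw [← pow_add, e1]
  have x3 : (X 0 : MvPolynomial (Fin 3) F) * X 0 ^ (p ^ 2 - 1) = X 0 ^ p ^ 2 := by
    rw [← pow_succ', add_comm, e2]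
  linear_combination (X 0 ^ (p ^ 2)) * hr
    - C (gam p M 1 2 5) * C (shift p M 0 g) ^ p * x1
    + C (gam p M 1 3 5) * C (shift p M 1 g) * x2
    - C (gam p M 2 3 5) * C (shift p M 0 g) * x3

theorem eq_zero_of_gam_ne_zero {i j k : ℕ} (h : gam p M i j k ≠ 0) {v : Fin 3 → F}
    (hi : ∑ t, v t * gammaRow p M i t = 0) (hj : ∑ t, v t * gammaRow p M j t = 0)
    (hk : ∑ t, v t * gammaRow p M k t = 0) : v = 0 := by
  apply Matrix.eq_zero_of_mulVec_eq_zero h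
  ext t
  simp only [Matrix.mulVec, dotProduct, Fin.sum_univ_three] at hi hj hk ⊢
  fin_cases t
  · simpa [mul_comm] using hi
  · simpa [mul_comm] using hj
  · simpa [mul_comm] using hk

/-- The vector of coefficients of `g`, with entries in `F`. -/
def coords (g : Multiplicative (Fin 3 → ZMod p)) : Fin 3 → F :=
  fun j => ZMod.castHom dvd_rfl F (g.toAdd j)

theorem coords_injective : Function.Injective (coords p : _ → Fin 3 → F) := by
  intro g h hgh
  apply Multiplicative.toAdd.injective
  funext j
  exact (ZMod.castHom dvd_rfl F).injective (congrFun hgh j)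

theorem sum_coords_gammaRow_odd (g : Multiplicative (Fin 3 → ZMod p)) (k : ℕ) :
    ∑ t, coords p g t * gammaRow p M (2 * k + 1) t = shift p M 0 g ^ p ^ k := by
  rw [shift_pow]
  refine Finset.sum_congr rfl fun t _ => ?_
  simp [coords, gammaRow, Nat.add_mod]

theorem sum_coords_gammaRow_two (g : Multiplicative (Fin 3 → ZMod p)) :
    ∑ t, coords p g t * gammaRow p M 2 t = shift p M 1 g := by
  refine Finset.sum_congr rfl fun t _ => ?_
  simp [coords, gammaRow]

theorem coords_one : coords p (1 : Multiplicative (Fin 3 → ZMod p)) = (0 : Fin 3 → F) := by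
  ext
  simp [coords]

variable {p M}

/-- Row 3 of `Γ` is the Frobenius image of row 1, so `c₀(g) = 0` kills rows 1 and 3, and `c₁(g) = 0`
kills row 2. -/
theorem eq_one_of_shift (h123 : gam p M 1 2 3 ≠ 0) {g : Multiplicative (Fin 3 → ZMod p)}
    (h0 : shift p M 0 g = 0) (h1 : shift p M 1 g = 0) : g = 1 := by
  apply coords_injective p (F := F)
  rw [coords_one]
  apply eq_zero_of_gam_ne_zero p M h123
  · simpa [h0] using sum_coords_gammaRow_odd p M g 0
  · simpa [h1] using sum_coords_gammaRow_two p M g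
  · simpa [h0, (Fact.out : p.Prime).ne_zero] using sum_coords_gammaRow_odd p M g 1

theorem shift_pair_injective (h123 : gam p M 1 2 3 ≠ 0) :
    Function.Injective fun g => (shift p M 0 g, shift p M 1 g) := by
  intro g h hgh
  simp only [Prod.mk.injEq] at hgh
  rw [← mul_inv_eq_one]
  apply eq_one_of_shift h123 <;> rw [shift_mul, shift_inv] <;> simp [hgh]

/-- Rows 1, 3, 5 are the successive Frobenius images of the first row of `M`, so `c₀` alone already
determines the group element. -/
theorem shift_zero_injective (h135 : gam p M 1 3 5 ≠ 0) :
    Function.Injective (shift p M 0) := by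
  intro g h hgh
  rw [← mul_inv_eq_one]
  have h0 : shift p M 0 (g * h⁻¹) = 0 := by rw [shift_mul, shift_inv, hgh, add_neg_cancel]
  apply coords_injective p (F := F)
  rw [coords_one]
  have hp := (Fact.out : p.Prime).ne_zero
  apply eq_zero_of_gam_ne_zero p M h135
  · simpa [h0] using sum_coords_gammaRow_odd p M (g * h⁻¹) 0
  · simpa [h0, hp] using sum_coords_gammaRow_odd p M (g * h⁻¹) 1
  · simpa [h0, hp] using sum_coords_gammaRow_odd p M (g * h⁻¹) 2

end Shifts

/-! ### Invariants up to powers of `x` -/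

section Localization

variable {F : Type*} [Field F] {p : ℕ} [Fact p.Prime] [CharP F p] {M : Matrix (Fin 2) (Fin 3) F}

theorem delta_pow_eq (h123 : gam p M 1 2 3 ≠ 0) :
    (delta : MvPolynomial (Fin 3) F) ^ p = C (-(gam p M 1 2 3)⁻¹) * f1 p M
      + C (-(gam p M 1 2 3)⁻¹ * gam p M 1 2 4) * X 0 ^ p * X 1 ^ p
      + C (-(gam p M 1 2 3)⁻¹ * gam p M 1 3 4) * X 0 ^ (2 * p - 2) * delta
      + C (-(gam p M 1 2 3)⁻¹ * gam p M 2 3 4) * X 0 ^ (2 * p - 1) * X 1 := by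
  have h : (C (gam p M 1 2 3)⁻¹ : MvPolynomial (Fin 3) F) * C (gam p M 1 2 3) = 1 := by
    rw [← C_mul, inv_mul_cancel₀ h123, C_1]
  simp only [f1, C_mul, C_neg]
  linear_combination (-delta ^ p) * h

theorem y_pow_eq (h123 : gam p M 1 2 3 ≠ 0) :
    (X 1 : MvPolynomial (Fin 3) F) ^ p ^ 2 = C ((gam p M 1 2 3)⁻¹) * f2 p M
      + C ((gam p M 1 2 3)⁻¹ * gam p M 1 2 5) * X 0 ^ (p ^ 2 - p) * X 1 ^ p
      + C ((gam p M 1 2 3)⁻¹ * gam p M 1 3 5) * X 0 ^ (p ^ 2 - 2) * delta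
      + C ((gam p M 1 2 3)⁻¹ * gam p M 2 3 5) * X 0 ^ (p ^ 2 - 1) * X 1 := by
  have h : (C (gam p M 1 2 3)⁻¹ : MvPolynomial (Fin 3) F) * C (gam p M 1 2 3) = 1 := by
    rw [← C_mul, inv_mul_cancel₀ h123, C_1]
  simp only [f2, C_mul]
  linear_combination (-X 1 ^ p ^ 2) * h

/-- The base ring is arbitrary because the same reductions are needed twice: over `F[x, f1, f2]` for
polynomials, and over the fraction field for functions on the group. -/
theorem boxSpan_conditions {B S : Type*} [CommRing B] [CommRing S] [Algebra B S] {Y D : S}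
    {p : ℕ} (hp : 1 < p) {b₀ b₁ b₂ b₃ c₀ c₁ c₂ c₃ : B}
    (hD : D ^ p = b₀ • 1 + b₁ • Y ^ p + b₂ • D + b₃ • Y)
    (hY : Y ^ p ^ 2 = c₀ • 1 + c₁ • Y ^ p + c₂ • D + c₃ • Y) :
    Y ^ p ^ 2 ∈ Submodule.span B (insert D ((fun i => Y ^ i) '' Set.Iio (p ^ 2))) ∧
      D ^ p ∈ boxSpan B Y D (p ^ 2) p := by
  have h0 : 0 < p ^ 2 := by positivity
  have h1 : 1 < p ^ 2 := by nlinarith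
  have h2 : p < p ^ 2 := by nlinarith
  constructor
  · rw [hY]
    refine add_mem (add_mem (add_mem ?_ ?_) ?_) ?_ <;>
      refine Submodule.smul_mem _ _ (Submodule.subset_span ?_)
    · exact .inr ⟨0, h0, pow_zero _⟩
    · exact .inr ⟨p, h2, rfl⟩
    · exact .inl rfl
    · exact .inr ⟨1, h1, pow_one _⟩
  · rw [hD]
    refine add_mem (add_mem (add_mem ?_ ?_) ?_) ?_ <;> refine Submodule.smul_mem _ _ ?_
    · simpa using pow_mul_pow_mem_boxSpan (B := B) Y D h0 (by omega : 0 < p)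
    · simpa using pow_mul_pow_mem_boxSpan (B := B) Y D h2 (by omega : 0 < p)
    · simpa using pow_mul_pow_mem_boxSpan (B := B) Y D h0 hp
    · simpa using pow_mul_pow_mem_boxSpan (B := B) Y D h1 (by omega : 0 < p)

/-- Up to a power of `x`, every polynomial is a polynomial in `x`, `y` and `δ`. -/
theorem exists_pow_mul_mem_adjoin_delta (A : Subalgebra F (MvPolynomial (Fin 3) F))
    (hx : X 0 ∈ A) (f : MvPolynomial (Fin 3) F) :
    ∃ N, X 0 ^ N * f ∈ Algebra.adjoin A {X 1, delta} := by
  set W := Algebra.adjoin A ({X 1, delta} : Set (MvPolynomial (Fin 3) F)) with hW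
  have hA : ∀ u ∈ A, u ∈ W := fun u hu => W.algebraMap_mem ⟨u, hu⟩
  induction f using MvPolynomial.induction_on with
  | C a => exact ⟨0, by simpa using hA _ (A.algebraMap_mem a)⟩
  | add u v hu hv =>
    obtain ⟨n, hn⟩ := hu
    obtain ⟨k, hk⟩ := hv
    refine ⟨n + k, ?_⟩
    have : X 0 ^ (n + k) * (u + v) = X 0 ^ k * (X 0 ^ n * u) + X 0 ^ n * (X 0 ^ k * v) := by ring
    rw [this]
    exact W.add_mem (W.mul_mem (hA _ (A.pow_mem hx _)) hn) (W.mul_mem (hA _ (A.pow_mem hx _)) hk)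
  | mul_X u i hu =>
    obtain ⟨n, hn⟩ := hu
    have hy : X 1 ∈ W := Algebra.subset_adjoin (by simp)
    have hd : delta ∈ W := Algebra.subset_adjoin (by simp)
    fin_cases i
    · refine ⟨n, ?_⟩
      rw [← mul_assoc]
      exact W.mul_mem hn (hA _ hx)
    · refine ⟨n, ?_⟩
      rw [← mul_assoc]
      exact W.mul_mem hn hy
    -- The variable `z` costs one power of `x`, since `xz = y² - δ`.
    · refine ⟨n + 1, ?_⟩
      have : X 0 ^ (n + 1) * (u * X 2) = X 0 ^ n * u * (X 1 ^ 2 - delta) := by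
        rw [delta]; ring
      change X 0 ^ (n + 1) * (u * X 2) ∈ W
      rw [this]
      exact W.mul_mem hn (W.sub_mem (W.pow_mem hy 2) hd)

theorem exists_pow_mul_mem_of_mem_invariants (h123 : gam p M 1 2 3 ≠ 0)
    {f : MvPolynomial (Fin 3) F} (hf : f ∈ invariants p M) :
    ∃ N, X 0 ^ N * f ∈ Algebra.adjoin F {X 0, f1 p M, f2 p M} := by
  classical
  set B := Algebra.adjoin F ({X 0, f1 p M, f2 p M} : Set (MvPolynomial (Fin 3) F)) with hB
  have hp := one_lt_prime p
  have hp2 : 0 < p ^ 2 := by positivity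
  have hx : X 0 ∈ B := Algebra.subset_adjoin (by simp)
  have h1 : f1 p M ∈ B := Algebra.subset_adjoin (by simp)
  have h2 : f2 p M ∈ B := Algebra.subset_adjoin (by simp)
  have hC : ∀ c, C c ∈ B := B.algebraMap_mem
  have hBinv : B ≤ invariants p M := by
    rw [hB, Algebra.adjoin_le_iff]
    rintro _ (rfl | rfl | rfl)
    exacts [x_mem_invariants p M, f1_mem_invariants p M, f2_mem_invariants p M]
  obtain ⟨N, hN⟩ := exists_pow_mul_mem_adjoin_delta B hx f
  refine ⟨N, ?_⟩
  set P := X 0 ^ N * f with hP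
  have hPinv : P ∈ invariants p M :=
    (invariants p M).mul_mem ((invariants p M).pow_mem (x_mem_invariants p M) N) hf
  have hcond := boxSpan_conditions (B := B) (Y := X 1) (D := delta) hp
    (b₀ := ⟨_, B.mul_mem (hC _) h1⟩) (b₁ := ⟨_, B.mul_mem (hC _) (B.pow_mem hx p)⟩)
    (b₂ := ⟨_, B.mul_mem (hC _) (B.pow_mem hx (2 * p - 2))⟩)
    (b₃ := ⟨_, B.mul_mem (hC _) (B.pow_mem hx (2 * p - 1))⟩)
    (c₀ := ⟨_, B.mul_mem (hC _) h2⟩) (c₁ := ⟨_, B.mul_mem (hC _) (B.pow_mem hx (p ^ 2 - p))⟩)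
    (c₂ := ⟨_, B.mul_mem (hC _) (B.pow_mem hx (p ^ 2 - 2))⟩)
    (c₃ := ⟨_, B.mul_mem (hC _) (B.pow_mem hx (p ^ 2 - 1))⟩)
    (by
      rw [delta_pow_eq h123]
      simp only [Subalgebra.smul_def, smul_eq_mul, mul_one]
      rfl)
    (by
      rw [y_pow_eq h123]
      simp only [Subalgebra.smul_def, smul_eq_mul, mul_one]
      rfl)
  have hbox := adjoin_pair_le_boxSpan (X 1) delta hp2 (by omega) hcond.1 hcond.2 hN
  rw [boxSpan, Submodule.mem_span_range_iff_exists_fun] at hbox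
  obtain ⟨a, ha⟩ := hbox
  let K := FractionRing (MvPolynomial (Fin 3) F)
  let ι : MvPolynomial (Fin 3) F →+* K := algebraMap _ _
  have hι : Function.Injective ι := IsFractionRing.injective _ _
  let G := Multiplicative (Fin 3 → ZMod p)
  -- `φ` sends a polynomial to its translates, as a function on the group. Invariants become
  -- constant functions, that is, scalars of `K`, so the reductions of `y^(p²)` and `δ^p` persist.
  let φ : MvPolynomial (Fin 3) F →+* (G → K) :=
    RingHom.pi fun g => ι.comp (act (rep p M g)).toRingHom
  have hφ : ∀ u g, φ u g = ι (act (rep p M g) u) := fun _ _ => rfl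
  have hφinv : ∀ u ∈ invariants p M, ∀ v, φ (u * v) = ι u • φ v := by
    intro u hu v
    ext g
    rw [map_mul, Pi.mul_apply, Pi.smul_apply, hφ, hφ, (mem_invariants p M u).1 hu g, smul_eq_mul]
  have hφB : ∀ u ∈ B, ∀ v, φ (u * v) = ι u • φ v := fun u hu => hφinv u (hBinv hu)
  have hsep : Function.Injective fun g => (φ (X 1) g, φ delta g) := by
    intro g h hgh
    simp only [Prod.mk.injEq, hφ, act_y, act_delta] at hgh
    apply shift_pair_injective h123
    have e0 := hι hgh.1
    have e1 := hι hgh.2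
    have hX : (X 0 : MvPolynomial (Fin 3) F) ≠ 0 := X_ne_zero 0
    ext
    · exact C_injective _ _ (mul_right_cancel₀ hX (add_left_cancel e0))
    · exact C_injective _ _ (mul_right_cancel₀ (pow_ne_zero 2 hX) (sub_right_injective e1))
  have hcondK := boxSpan_conditions (B := K) (Y := φ (X 1)) (D := φ delta) hp
    (by
      rw [← map_pow, delta_pow_eq h123, map_add, map_add, map_add,
        hφB _ (B.mul_mem (hC _) (B.pow_mem hx p)), hφB _ (B.mul_mem (hC _) (B.pow_mem hx (2 * p - 2))),
        hφB _ (B.mul_mem (hC _) (B.pow_mem hx (2 * p - 1))), ← mul_one (C _ * f1 p M),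
        hφB _ (B.mul_mem (hC _) h1), map_one, map_pow])
    (by
      rw [← map_pow, y_pow_eq h123, map_add, map_add, map_add,
        hφB _ (B.mul_mem (hC _) (B.pow_mem hx (p ^ 2 - p))),
        hφB _ (B.mul_mem (hC _) (B.pow_mem hx (p ^ 2 - 2))),
        hφB _ (B.mul_mem (hC _) (B.pow_mem hx (p ^ 2 - 1))), ← mul_one (C _ * f2 p M),
        hφB _ (B.mul_mem (hC _) h2), map_one, map_pow])
  have hcard : Fintype.card G = p ^ 2 * p := by
    simp [G, ZMod.card]
    ring
  have hli := linearIndependent_pow_mul_pow (φ (X 1)) (φ delta) hsep hp2 (by omega) hcard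
    hcondK.1 hcondK.2
  rw [Fintype.linearIndependent_iff] at hli
  let z : Fin (p ^ 2) × Fin p := (⟨0, hp2⟩, ⟨0, by omega⟩)
  -- Two expansions of `φ P` are compared: the one with coefficients `a ij`, and `ι P` times the
  -- monomial `1`, which has index `z`.
  have h0 := hli (fun ij => ι (a ij : MvPolynomial (Fin 3) F) - if ij = z then ι P else 0) (by
    simp only [sub_smul, Finset.sum_sub_distrib, ite_smul, zero_smul, Finset.sum_ite_eq',
      Finset.mem_univ, if_true]
    have e1 : ∑ ij : Fin (p ^ 2) × Fin p, ι (a ij : MvPolynomial (Fin 3) F) •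
        (φ (X 1) ^ (ij.1 : ℕ) * φ delta ^ (ij.2 : ℕ)) = φ P := by
      rw [← ha, map_sum]
      refine Finset.sum_congr rfl fun ij _ => ?_
      rw [Subalgebra.smul_def, smul_eq_mul, hφB _ (a ij).2, map_mul, map_pow, map_pow]
    rw [e1, ← mul_one P, hφinv P hPinv]
    simp [z]) z
  rw [if_pos rfl, sub_eq_zero] at h0
  rw [← hι h0]
  exact (a z).2

end Localization

/-- This supplies the product `g₁^a g₂^b g₃^c` with lead monomial `y^s`; the last inequality bounds
its `z`-degree. The congruence `q c ≡ s` modulo `p` fixes `c`. Then `n = (s - (p² + q)c) / p` is at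
least `p - 1`, an even number, so `n` is even or is odd and at least `p`, hence `n = 2a + pb`. Twice
the `z`-degree bound is at most `p³ + qp + (p² - q)c`, which is below `2p³` because `c ≤ p - 1`. -/
theorem exists_weight_eq {p q : ℕ} (hp : p.Prime) (hp2 : p ≠ 2) (hq : q = 1 ∨ q = 2) {s : ℕ}
    (hs : p ^ 3 ≤ s) (hs' : s ≤ p ^ 3 + q * p) :
    ∃ a b c, b < 2 ∧ c < p ∧ 2 * p * a + p ^ 2 * b + (p ^ 2 + q) * c = s ∧
      p * a + b + p ^ 2 * c < p ^ 3 := by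
  have hodd : p % 2 = 1 := hp.eq_two_or_odd.resolve_left hp2
  have hp3 : 3 ≤ p := by have := hp.two_le; omega
  obtain ⟨c, hc, hcs⟩ : ∃ c, c < p ∧ q * c ≡ s [MOD p] := by
    rcases hq with rfl | rfl
    · refine ⟨s % p, Nat.mod_lt _ hp.pos, ?_⟩
      rw [one_mul]
      exact Nat.mod_modEq _ _
    -- `(p + 1) / 2` is the inverse of `2` modulo `p`.
    · refine ⟨(s * ((p + 1) / 2)) % p, Nat.mod_lt _ hp.pos, ?_⟩
      have h1 : 2 * ((s * ((p + 1) / 2)) % p) ≡ 2 * (s * ((p + 1) / 2)) [MOD p] :=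
        (Nat.mod_modEq _ _).mul_left 2
      have h2 : 2 * (s * ((p + 1) / 2)) = s + p * s := by
        have : 2 * ((p + 1) / 2) = p + 1 := by omega
        calc 2 * (s * ((p + 1) / 2)) = s * (2 * ((p + 1) / 2)) := by ring
          _ = _ := by rw [this]; ring
      rw [h2] at h1
      exact h1.trans (by simp [Nat.ModEq])
  obtain ⟨d, hd⟩ : ∃ d, p = c + 1 + d := Nat.exists_eq_add_of_le hc
  have hq1 : 1 ≤ q := by omega
  have hq2 : q ≤ 2 := by omega
  have hcp : p ^ 2 * c + p ^ 2 ≤ p ^ 3 := by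
    have := Nat.mul_le_mul_left (p ^ 2) hc
    calc p ^ 2 * c + p ^ 2 = p ^ 2 * (c + 1) := by ring
      _ ≤ p ^ 2 * p := this
      _ = p ^ 3 := by ring
  have hqc : q * c + q ≤ q * p := by
    have := Nat.mul_le_mul_left q hc
    linarith
  have hqc2 : q * c + 2 ≤ 2 * p := by
    have := Nat.mul_le_mul_right c hq2
    omega
  have h2p : 2 * p ≤ p ^ 2 := by nlinarith
  have hcle : (p ^ 2 + q) * c ≤ s := by
    rw [add_mul]
    omega
  have hmod : p ∣ s - (p ^ 2 + q) * c := by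
    rw [← Nat.modEq_iff_dvd' hcle]
    refine Nat.ModEq.trans ?_ hcs
    have : (p ^ 2 + q) * c = q * c + p * (p * c) := by ring
    rw [this]
    simp [Nat.ModEq]
  obtain ⟨n, hn⟩ := hmod
  have hsn : s = p ^ 2 * c + q * c + p * n := by
    rw [add_mul] at hn hcle
    omega
  have hn1 : p ≤ n + 1 := by
    by_contra hlt
    have : p * n + 2 * p ≤ p ^ 2 := by
      have : p * (n + 2) ≤ p * p := Nat.mul_le_mul_left p (by omega)
      calc p * n + 2 * p = p * (n + 2) := by ring
        _ ≤ p * p := this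
        _ = p ^ 2 := by ring
    omega
  obtain ⟨a, b, hb, hab⟩ : ∃ a b, b < 2 ∧ 2 * a + p * b = n := by
    rcases Nat.even_or_odd n with ⟨k, hk⟩ | hk
    · exact ⟨k, 0, by omega, by omega⟩
    · rw [Nat.odd_iff] at hk
      exact ⟨(n - p) / 2, 1, by omega, by omega⟩
  have hpab : 2 * p * a + p ^ 2 * b = p * n := by rw [← hab]; ring
  refine ⟨a, b, c, hb, hc, ?_, ?_⟩
  · rw [hsn, ← hpab]; ring
  · have h3 : 2 * b ≤ p ^ 2 * b := Nat.mul_le_mul_right b (by nlinarith)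
    have h4 : 2 * (p * a) = 2 * p * a := by ring
    have h5 : q < p ^ 2 := by omega
    have h6 : p ^ 2 * c + q * p ≤ p ^ 3 - p ^ 2 + (q * c + q) + (q * p - q * c - q) := by omega
    have h7 : q * (c + 1 + d) = q * c + q + q * d := by ring
    have h8 : p ^ 2 * (c + 1 + d) = p ^ 2 * c + p ^ 2 + p ^ 2 * d := by ring
    rw [← hd] at h7 h8
    have h9 : p ^ 2 * p = p ^ 3 := by ring
    have h10 : q * d ≤ p ^ 2 * d := Nat.mul_le_mul_right d h5.le
    omega

section Gpow

variable {σ F : Type*} [Field F] {n : ℕ} (g : Fin n → MvPolynomial σ F)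

theorem gpow_add (D E : Fin n →₀ ℕ) : gpow g (D + E) = gpow g D * gpow g E := by
  simp [gpow, pow_add, Finset.prod_mul_distrib]

theorem gpow_single (i : Fin n) (k : ℕ) : gpow g (Finsupp.single i k) = g i ^ k := by
  rw [gpow, Finset.prod_eq_single i]
  · simp
  · intro j _ hj
    rw [Finsupp.single_eq_of_ne hj, pow_zero]
  · simp

end Gpow

/-! ### Homogeneous polynomials, lead terms and `z`-degrees -/

section Homogeneous

variable {F : Type*} [Field F]

theorem isHomogeneous_of_X_pow_mul {σ : Type*} {f : MvPolynomial σ F} {i : σ} {k n : ℕ}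
    (h : (X i ^ k * f).IsHomogeneous (n + k)) : f.IsHomogeneous n := by
  classical
  intro d hd
  have h1 : coeff (Finsupp.single i k + d) (X i ^ k * f) ≠ 0 := by
    rw [X_pow_eq_monomial, coeff_monomial_mul, one_mul]
    exact hd
  have h2 := h h1
  rw [map_add, Finsupp.weight_single, Pi.one_apply, smul_eq_mul, mul_one] at h2
  omega

/-- As `x` is the smallest variable, every monomial of degree `s` containing `x` lies below `y^s`.
Thus lead terms in `y` can be read off modulo `x`. -/
theorem degree_eq_of_isHomogeneous_y {f : MvPolynomial (Fin 3) F} {s : ℕ}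
    (hf : f.IsHomogeneous s) {κ : F} (hκ : κ ≠ 0) {r : MvPolynomial (Fin 3) F}
    (h : f = C κ * X 1 ^ s + X 0 * r) :
    grevlex.degree f = Finsupp.single 1 s ∧ grevlex.leadingCoeff f = κ := by
  classical
  have hx : ∀ e : Fin 3 →₀ ℕ, e 0 = 0 → coeff e (X 0 * r) = 0 := by
    intro e he
    rw [coeff_X_mul', if_neg]
    simpa using he
  have hc : coeff (Finsupp.single 1 s) f = κ := by
    rw [h, coeff_add, hx _ (by simp), coeff_C_mul, coeff_X_pow, if_pos rfl]
    simp
  have hd : grevlex.degree f = Finsupp.single 1 s := by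
    apply degree_eq_of_forall_le
    · rwa [hc]
    · intro e he
      have hs := sum_exponents_eq_of_isHomogeneous hf he
      rw [grevlex_le_iff]
      simp
      by_cases he0 : e 0 = 0
      · have : Finsupp.single 1 s = e := by
          by_contra hne
          apply mem_support_iff.1 he
          rw [h, coeff_add, hx e he0, coeff_C_mul, coeff_X_pow, if_neg hne]
          simp
        have h2 := DFunLike.congr_fun this 2
        simp at h2
        omega
      · omega
  exact ⟨hd, by rw [MonomialOrder.leadingCoeff, hd, hc]⟩

theorem degree_eq_of_isHomogeneous_z {f : MvPolynomial (Fin 3) F} {s : ℕ}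
    (hf : f.IsHomogeneous s) (hc : coeff (Finsupp.single 2 s) f ≠ 0) :
    grevlex.degree f = Finsupp.single 2 s := by
  apply degree_eq_of_forall_le _ hc
  intro e he
  have hs := sum_exponents_eq_of_isHomogeneous hf he
  rw [grevlex_le_iff]
  simp
  omega

theorem degreeOf_sub_lt {σ : Type*} {f g : MvPolynomial σ F} {i : σ} {n : ℕ}
    (hf : degreeOf i f < n) (hg : degreeOf i g < n) : degreeOf i (f - g) < n := by
  rw [sub_eq_add_neg]
  refine lt_of_le_of_lt (degreeOf_add_le _ _ _) (max_lt hf ?_)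
  rw [← neg_one_mul, ← C_1, ← C_neg]
  exact lt_of_le_of_lt (degreeOf_C_mul_le _ _ _) hg

theorem degreeOf_add_lt {σ : Type*} {f g : MvPolynomial σ F} {i : σ} {n : ℕ}
    (hf : degreeOf i f < n) (hg : degreeOf i g < n) : degreeOf i (f + g) < n :=
  lt_of_le_of_lt (degreeOf_add_le _ _ _) (max_lt hf hg)

theorem degreeOf_X_pow_mul {σ : Type*} {i j : σ} (h : i ≠ j) (k : ℕ) (f : MvPolynomial σ F) :
    degreeOf i (X j ^ k * f) = degreeOf i f := by
  rw [mul_comm, degreeOf_mul_X_pow_of_ne k h]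

/-- Homogeneity of degree `s` together with the lead term `κ y ^ s`. -/
structure HasYLead (s : ℕ) (κ : F) (f : MvPolynomial (Fin 3) F) : Prop where
  homog : f.IsHomogeneous s
  ne_zero : κ ≠ 0
  eq : ∃ r, f = C κ * X 1 ^ s + X 0 * r

theorem HasYLead.mul {s t : ℕ} {κ μ : F} {f g : MvPolynomial (Fin 3) F} (hf : HasYLead s κ f)
    (hg : HasYLead t μ g) : HasYLead (s + t) (κ * μ) (f * g) := by
  obtain ⟨r, hr⟩ := hf.eq
  obtain ⟨u, hu⟩ := hg.eq
  refine ⟨hf.homog.mul hg.homog, mul_ne_zero hf.ne_zero hg.ne_zero,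
    ⟨r * (C μ * X 1 ^ t) + f * u, ?_⟩⟩
  rw [hu, hr, C_mul]
  ring

theorem HasYLead.pow {s : ℕ} {κ : F} {f : MvPolynomial (Fin 3) F} (hf : HasYLead s κ f) (n : ℕ) :
    HasYLead (s * n) (κ ^ n) (f ^ n) := by
  induction n with
  | zero => exact ⟨by simpa using isHomogeneous_one _ _, by simp, ⟨0, by simp⟩⟩
  | succ n ih =>
    rw [pow_succ, pow_succ, mul_add, mul_one]
    exact ih.mul hf

theorem HasYLead.degree_eq {s : ℕ} {κ : F} {f : MvPolynomial (Fin 3) F} (hf : HasYLead s κ f) :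
    grevlex.degree f = Finsupp.single 1 s :=
  let ⟨_, hr⟩ := hf.eq
  (degree_eq_of_isHomogeneous_y hf.homog hf.ne_zero hr).1

theorem HasYLead.leadingCoeff_eq {s : ℕ} {κ : F} {f : MvPolynomial (Fin 3) F}
    (hf : HasYLead s κ f) : grevlex.leadingCoeff f = κ :=
  let ⟨_, hr⟩ := hf.eq
  (degree_eq_of_isHomogeneous_y hf.homog hf.ne_zero hr).2

theorem HasYLead.poly_ne_zero {s : ℕ} {κ : F} {f : MvPolynomial (Fin 3) F}
    (hf : HasYLead s κ f) : f ≠ 0 :=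
  grevlex.leadingCoeff_ne_zero_iff.1 (by rw [hf.leadingCoeff_eq]; exact hf.ne_zero)

end Homogeneous

/-! ### The lead monomials of the ring of invariants -/

section LeadExponents

variable {F : Type*} [Field F]

theorem boxSpan_mono {A B : Subalgebra F (MvPolynomial (Fin 3) F)} (hAB : A ≤ B)
    {Y D u : MvPolynomial (Fin 3) F} {n m : ℕ} (hu : u ∈ boxSpan A Y D n m) :
    u ∈ boxSpan B Y D n m := by
  induction hu using Submodule.span_induction with
  | mem u hu => exact Submodule.subset_span hu
  | zero => exact zero_mem _
  | add u v _ _ hu hv => exact add_mem hu hv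
  | smul a u _ hu => exact Submodule.smul_mem _ (⟨a, hAB a.2⟩ : B) hu

/-- The properties of `g₁, g₂, g₃` from which the lead monomials of the algebra `A` of invariants
are determined. -/
structure IsSeed (p q : ℕ) (A : Subalgebra F (MvPolynomial (Fin 3) F))
    (g₁ g₂ g₃ : MvPolynomial (Fin 3) F) (κ₁ κ₂ κ₃ c : F) : Prop where
  x_mem : X 0 ∈ A
  saturated : ∀ h, X 0 * h ∈ A → h ∈ A
  localized : ∀ f ∈ A, ∃ N, X 0 ^ N * f ∈ Algebra.adjoin F {X 0, g₁, g₂}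
  mem₁ : g₁ ∈ A
  mem₂ : g₂ ∈ A
  mem₃ : g₃ ∈ A
  lead₁ : HasYLead (2 * p) κ₁ g₁
  lead₂ : HasYLead (p ^ 2) κ₂ g₂
  lead₃ : HasYLead (p ^ 2 + q) κ₃ g₃
  degreeOf₁ : degreeOf 2 g₁ ≤ p
  degreeOf₂ : degreeOf 2 g₂ ≤ 1
  degreeOf₃ : degreeOf 2 (g₃ - C c * X 0 ^ q * X 2 ^ p ^ 2) < p ^ 2
  c_ne_zero : c ≠ 0
  relation : ∃ b₀ ∈ Algebra.adjoin F {X 0, g₁}, ∃ b₁ ∈ Algebra.adjoin F {X 0, g₁},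
    g₂ ^ 2 = b₀ + b₁ * g₃
  reduction : ∀ w ∈ A, ∀ s, w.IsHomogeneous s → ∀ w₁ w₂, w = X 0 * w₁ + w₂ →
    degreeOf 2 w₂ < p ^ 3 → ∃ α w', w = C α * X 1 ^ s + X 0 * w'

variable {p q : ℕ} {A : Subalgebra F (MvPolynomial (Fin 3) F)}
    {g₁ g₂ g₃ : MvPolynomial (Fin 3) F} {κ₁ κ₂ κ₃ c : F}

theorem IsSeed.saturated_pow (hS : IsSeed p q A g₁ g₂ g₃ κ₁ κ₂ κ₃ c) (k : ℕ)
    {h : MvPolynomial (Fin 3) F} (hh : X 0 ^ k * h ∈ A) : h ∈ A := by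
  induction k with
  | zero => simpa using hh
  | succ k ih => exact ih (hS.saturated _ (by rwa [← mul_assoc, ← pow_succ']))

theorem IsSeed.degreeOf_g₃ (hS : IsSeed p q A g₁ g₂ g₃ κ₁ κ₂ κ₃ c) : degreeOf 2 g₃ ≤ p ^ 2 := by
  have h1 : g₃ = (g₃ - C c * X 0 ^ q * X 2 ^ p ^ 2) + C c * X 0 ^ q * X 2 ^ p ^ 2 := by ring
  rw [h1]
  refine (degreeOf_add_le _ _ _).trans (max_le hS.degreeOf₃.le ?_)
  rw [mul_assoc]
  refine (degreeOf_C_mul_le _ _ _).trans ?_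
  rw [degreeOf_X_pow_mul (by decide), degreeOf_X_self_pow]

/-- By Frobenius this is the `p`-th power of `g₃ - c x^q z^(p²)`. So `z^(p³)` enters `g₃^p` only
with the factor `x^(qp)`. -/
theorem IsSeed.degreeOf_pow_sub (hp : p.Prime) [CharP F p]
    (hS : IsSeed p q A g₁ g₂ g₃ κ₁ κ₂ κ₃ c) :
    degreeOf 2 (g₃ ^ p - C (c ^ p) * X 0 ^ (q * p) * X 2 ^ p ^ 3) < p ^ 3 := by
  have : Fact p.Prime := ⟨hp⟩
  have h1 : g₃ ^ p - C (c ^ p) * X 0 ^ (q * p) * X 2 ^ p ^ 3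
      = (g₃ - C c * X 0 ^ q * X 2 ^ p ^ 2) ^ p := by
    rw [sub_pow_char, mul_pow, mul_pow, C_pow, ← pow_mul, ← pow_mul, ← pow_succ]
  rw [h1]
  refine (degreeOf_pow_le _ _ _).trans_lt ?_
  calc p * degreeOf 2 (g₃ - C c * X 0 ^ q * X 2 ^ p ^ 2) < p * p ^ 2 :=
        Nat.mul_lt_mul_of_pos_left hS.degreeOf₃ hp.pos
    _ = p ^ 3 := by ring

/-- Repeated subtraction of products of `x, g₁, g₂, g₃` from `g₃ ^ p` makes it divisible by ever
higher powers of `x`. -/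
theorem IsSeed.exists_partial_subduction (hp : p.Prime) (hp2 : p ≠ 2) (hq : q = 1 ∨ q = 2)
    [CharP F p] (hS : IsSeed p q A g₁ g₂ g₃ κ₁ κ₂ κ₃ c) (k : ℕ) (hk : k ≤ q * p) :
    ∃ u w, u ∈ boxSpan (Algebra.adjoin F {X 0, g₁}) g₂ g₃ 2 p ∧ u ∈ A ∧ degreeOf 2 u < p ^ 3 ∧
      u.IsHomogeneous (p ^ 3 + q * p) ∧ g₃ ^ p - u = X 0 ^ k * w := by
  have hp3 : 0 < p ^ 3 := pow_pos hp.pos 3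
  induction k with
  | zero =>
    exact ⟨0, g₃ ^ p, zero_mem _, zero_mem _, by rwa [degreeOf_zero], isHomogeneous_zero _ _ _,
      by simp⟩
  | succ k ih =>
    obtain ⟨u, w, hu, huA, hud, huh, hw⟩ := ih (by omega)
    set B := Algebra.adjoin F ({X 0, g₁} : Set (MvPolynomial (Fin 3) F)) with hB
    have hxB : X 0 ∈ B := Algebra.subset_adjoin (by simp)
    have h1B : g₁ ∈ B := Algebra.subset_adjoin (by simp)
    -- As `k < qp`, the term in `z^(p³)` keeps a factor `x` after division by `x^k`, so `w` has
    -- `z`-degree below `p³` modulo `x` and `reduction` applies.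
    obtain ⟨l, hl⟩ : ∃ l, q * p = l + 1 + k := ⟨q * p - k - 1, by omega⟩
    have hwA : w ∈ A := hS.saturated_pow k (by
      rw [← hw]
      exact A.sub_mem (A.pow_mem hS.mem₃ p) huA)
    have hwh : w.IsHomogeneous (p ^ 3 + q * p - k) := by
      apply isHomogeneous_of_X_pow_mul (i := 0) (k := k)
      rw [← hw, Nat.sub_add_cancel (by omega)]
      refine IsHomogeneous.sub ?_ huh
      have := hS.lead₃.homog.pow p
      rwa [show (p ^ 2 + q) * p = p ^ 3 + q * p by ring] at this
    have hw2 : degreeOf 2 (w - X 0 * (C (c ^ p) * X 0 ^ l * X 2 ^ p ^ 3)) < p ^ 3 := by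
      rw [← degreeOf_X_pow_mul (i := 2) (j := 0) (by decide) k]
      have : X 0 ^ k * (w - X 0 * (C (c ^ p) * X 0 ^ l * X 2 ^ p ^ 3))
          = (g₃ ^ p - C (c ^ p) * X 0 ^ (q * p) * X 2 ^ p ^ 3) - u := by
        rw [mul_sub, ← hw, hl]
        ring
      rw [this]
      exact degreeOf_sub_lt (hS.degreeOf_pow_sub hp) hud
    obtain ⟨α, w', hw'⟩ := hS.reduction w hwA _ hwh _ _ (by ring :
      w = X 0 * (C (c ^ p) * X 0 ^ l * X 2 ^ p ^ 3)
        + (w - X 0 * (C (c ^ p) * X 0 ^ l * X 2 ^ p ^ 3))) hw2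
    -- The product that cancels `α y^s`: its exponents stay in the box and its `z`-degree stays
    -- below `p³`, so the induction can go on.
    obtain ⟨a, b, d, hb, hd, hwt, hdeg⟩ := exists_weight_eq hp hp2 hq
      (s := p ^ 3 + q * p - k) (by omega) (by omega)
    have ht := ((hS.lead₁.pow a).mul (hS.lead₂.pow b)).mul (hS.lead₃.pow d)
    rw [hwt] at ht
    set t := g₁ ^ a * g₂ ^ b * g₃ ^ d with htdef
    set μ := κ₁ ^ a * κ₂ ^ b * κ₃ ^ d with hμ
    obtain ⟨r, hr⟩ := ht.eq
    have htA : t ∈ A := A.mul_mem (A.mul_mem (A.pow_mem hS.mem₁ a) (A.pow_mem hS.mem₂ b))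
      (A.pow_mem hS.mem₃ d)
    refine ⟨u + X 0 ^ k * (C (α / μ) * t), w' - C (α / μ) * r, ?_, ?_, ?_, ?_, ?_⟩
    · refine add_mem hu ?_
      have e : X 0 ^ k * (C (α / μ) * t)
          = (⟨X 0 ^ k * C (α / μ) * g₁ ^ a, B.mul_mem (B.mul_mem (B.pow_mem hxB k)
            (B.algebraMap_mem _)) (B.pow_mem h1B a)⟩ : B) • (g₂ ^ b * g₃ ^ d) := by
        rw [Subalgebra.smul_def, smul_eq_mul, htdef]
        ring
      rw [e]
      exact Submodule.smul_mem _ _ (pow_mul_pow_mem_boxSpan _ _ hb hd)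
    · exact A.add_mem huA (A.mul_mem (A.pow_mem hS.x_mem k) (A.mul_mem (A.algebraMap_mem _) htA))
    · refine degreeOf_add_lt hud ?_
      rw [degreeOf_X_pow_mul (by decide)]
      refine (degreeOf_C_mul_le _ _ _).trans_lt (lt_of_le_of_lt ?_ hdeg)
      refine (degreeOf_mul_le _ _ _).trans (add_le_add ((degreeOf_mul_le _ _ _).trans
        (add_le_add ?_ ?_)) ?_)
      · refine (degreeOf_pow_le _ _ _).trans ?_
        rw [mul_comm p]
        exact Nat.mul_le_mul_left a hS.degreeOf₁
      · refine (degreeOf_pow_le _ _ _).trans ?_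
        simpa using Nat.mul_le_mul_left b hS.degreeOf₂
      · refine (degreeOf_pow_le _ _ _).trans ?_
        rw [mul_comm (p ^ 2)]
        exact Nat.mul_le_mul_left d hS.degreeOf_g₃
    · refine huh.add ?_
      have := (isHomogeneous_X_pow (R := F) (0 : Fin 3) k).mul
        ((isHomogeneous_C (Fin 3) (α / μ)).mul ht.homog)
      convert this using 1
      omega
    · have hdiv : (C (α / μ) : MvPolynomial (Fin 3) F) * C μ = C α := by
        rw [← C_mul, div_mul_cancel₀ _ ht.ne_zero]
      rw [sub_add_eq_sub_sub, hw, hw', hr]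
      linear_combination (-X 0 ^ k * X 1 ^ (p ^ 3 + q * p - k)) * hdiv

/-- At `k = qp` the factor `x` in front of `z^(p³)` is used up, and `z^(p³)` is the largest monomial
of its degree. The identity for `g₃^p` is also the second closure condition for the box in `g₂, g₃`.
-/
theorem IsSeed.exists_zLead (hp : p.Prime) (hp2 : p ≠ 2) (hq : q = 1 ∨ q = 2)
    [CharP F p] (hS : IsSeed p q A g₁ g₂ g₃ κ₁ κ₂ κ₃ c) :
    ∃ u v, u ∈ boxSpan (Algebra.adjoin F {X 0, g₁}) g₂ g₃ 2 p ∧ v ∈ A ∧ v ≠ 0 ∧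
      grevlex.degree v = Finsupp.single 2 (p ^ 3) ∧ g₃ ^ p = u + X 0 ^ (q * p) * v := by
  obtain ⟨u, v, hu, huA, hud, huh, hv⟩ := hS.exists_partial_subduction hp hp2 hq (q * p) le_rfl
  have hvA : v ∈ A := hS.saturated_pow (q * p) (by
    rw [← hv]
    exact A.sub_mem (A.pow_mem hS.mem₃ p) huA)
  have hvh : v.IsHomogeneous (p ^ 3) := by
    apply isHomogeneous_of_X_pow_mul (i := 0) (k := q * p)
    rw [← hv]
    refine IsHomogeneous.sub ?_ huh
    have := hS.lead₃.homog.pow p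
    rwa [show (p ^ 2 + q) * p = p ^ 3 + q * p by ring] at this
  have hv2 : degreeOf 2 (v - C (c ^ p) * X 2 ^ p ^ 3) < p ^ 3 := by
    rw [← degreeOf_X_pow_mul (i := 2) (j := 0) (by decide) (q * p)]
    have : X 0 ^ (q * p) * (v - C (c ^ p) * X 2 ^ p ^ 3)
        = (g₃ ^ p - C (c ^ p) * X 0 ^ (q * p) * X 2 ^ p ^ 3) - u := by
      rw [mul_sub, ← hv]
      ring
    rw [this]
    exact degreeOf_sub_lt (hS.degreeOf_pow_sub hp) hud
  have hco : coeff (Finsupp.single 2 (p ^ 3)) v ≠ 0 := by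
    have h0 : coeff (Finsupp.single 2 (p ^ 3)) (v - C (c ^ p) * X 2 ^ p ^ 3) = 0 := by
      by_contra h
      have := monomial_le_degreeOf 2 (mem_support_iff.2 h)
      rw [Finsupp.single_eq_same] at this
      omega
    rw [coeff_sub, coeff_C_mul, coeff_X_pow, if_pos rfl, mul_one, sub_eq_zero] at h0
    rw [h0]
    exact pow_ne_zero p hS.c_ne_zero
  exact ⟨u, v, hu, hvA, fun h => hco (by rw [h, coeff_zero]),
    degree_eq_of_isHomogeneous_z hvh hco, by rw [← hv]; ring⟩

/-- The lead exponents of the algebra of invariants. -/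
theorem IsSeed.exists_degree_eq (hp : p.Prime) (hp2 : p ≠ 2) (hq : q = 1 ∨ q = 2)
    [CharP F p] (hS : IsSeed p q A g₁ g₂ g₃ κ₁ κ₂ κ₃ c) {h : MvPolynomial (Fin 3) F} (hh : h ∈ A)
    (h0 : h ≠ 0) : ∃ E : Fin 5 →₀ ℕ, grevlex.degree h = Finsupp.single 0 (E 0) +
      Finsupp.single 1 (2 * p * E 1 + p ^ 2 * E 2 + (p ^ 2 + q) * E 3) +
      Finsupp.single 2 (p ^ 3 * E 4) := by
  obtain ⟨u, v, hu, hvA, hv0, hvdeg, hv⟩ := hS.exists_zLead hp hp2 hq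
  let g : Fin 5 → MvPolynomial (Fin 3) F := ![X 0, g₁, g₂, g₃, v]
  have hne : ∀ i, g i ≠ 0 := by
    intro i
    fin_cases i
    exacts [X_ne_zero 0, hS.lead₁.poly_ne_zero, hS.lead₂.poly_ne_zero, hS.lead₃.poly_ne_zero, hv0]
  have hdeg : ∀ i, grevlex.degree (g i) = leadExp p q i := by
    intro i
    fin_cases i
    exacts [MonomialOrder.degree_X, hS.lead₁.degree_eq, hS.lead₂.degree_eq, hS.lead₃.degree_eq,
      hvdeg]
  -- These are the exponents in normal form with respect to the reductions of `g₂²` and `g₃^p`.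
  let ι := {E : Fin 5 →₀ ℕ // E 2 < 2 ∧ E 3 < p}
  let f : ι → MvPolynomial (Fin 3) F := fun E => gpow g E.1
  have hf0 : ∀ i, f i ≠ 0 := fun i => gpow_ne_zero hne _
  have hfdeg : ∀ i : ι, grevlex.degree (f i) = _ := fun i => degree_gpow_of_leadExp hne hdeg i.1
  have hinj : Function.Injective fun i => grevlex.degree (f i) := by
    rintro ⟨E, hE⟩ ⟨E', hE'⟩ heq
    simp only [hfdeg] at heq
    have h0 := DFunLike.congr_fun heq 0
    have h1 := DFunLike.congr_fun heq 1
    have h2 := DFunLike.congr_fun heq 2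
    simp at h0 h1 h2
    obtain ⟨ha, hb, hc⟩ := weight_injective hp hp2 hq hE.1 hE'.1 hE.2 hE'.2 h1
    have h4 : E 4 = E' 4 := h2.resolve_right hp.ne_zero
    apply Subtype.ext
    ext i
    fin_cases i <;> simp_all
  set N := Submodule.span F (Set.range f) with hN
  have hmul : ∀ i : Fin 5, i ≠ 2 → i ≠ 3 → ∀ w ∈ N, g i * w ∈ N := by
    intro i h2 h3 w hw
    induction hw using Submodule.span_induction with
    | mem w hw =>
      obtain ⟨⟨E, hE⟩, rfl⟩ := hw
      refine Submodule.subset_span ⟨⟨E + Finsupp.single i 1, ?_⟩, ?_⟩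
      · simpa [Finsupp.single_eq_of_ne h2.symm, Finsupp.single_eq_of_ne h3.symm] using hE
      · simp only [f, gpow_add, gpow_single, pow_one]
        ring
    | zero => simp
    | add u v _ _ hu hv => rw [mul_add]; exact N.add_mem hu hv
    | smul a u _ hu => rw [mul_smul_comm]; exact N.smul_mem a hu
  set B := Algebra.adjoin F ({X 0, g₁, v} : Set (MvPolynomial (Fin 3) F)) with hB
  have hBN : ∀ b ∈ B, ∀ w ∈ N, b * w ∈ N := by
    intro b hb
    induction hb using Algebra.adjoin_induction with
    | mem b hb =>
      rcases hb with rfl | rfl | rfl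
      · exact hmul 0 (by decide) (by decide)
      · exact hmul 1 (by decide) (by decide)
      · exact hmul 4 (by decide) (by decide)
    | algebraMap r => intro w hw; rw [← Algebra.smul_def]; exact N.smul_mem r hw
    | add u v _ _ hu hv => intro w hw; rw [add_mul]; exact N.add_mem (hu w hw) (hv w hw)
    | mul u v _ _ hu hv => intro w hw; rw [mul_assoc]; exact hu _ (hv _ hw)
  have hbox : ∀ w ∈ boxSpan B g₂ g₃ 2 p, w ∈ N := by
    intro w hw
    induction hw using Submodule.span_induction with
    | mem w hw =>
      obtain ⟨⟨i, j⟩, rfl⟩ := hw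
      refine Submodule.subset_span ⟨⟨Finsupp.single 2 (i : ℕ) + Finsupp.single 3 (j : ℕ), ?_⟩, ?_⟩
      · simp
        omega
      · simp only [f, gpow_add, gpow_single]
        rfl
    | zero => exact zero_mem _
    | add u v _ _ hu hv => exact N.add_mem hu hv
    | smul a u _ hu => rw [Subalgebra.smul_def, smul_eq_mul]; exact hBN a a.2 u hu
  have hBB : Algebra.adjoin F {X 0, g₁} ≤ B := Algebra.adjoin_mono (by
    rintro _ (rfl | rfl) <;> simp)
  have hxB : X 0 ∈ B := Algebra.subset_adjoin (by simp)
  have hvB : v ∈ B := Algebra.subset_adjoin (by simp)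
  -- The span `N` contains the whole algebra generated by `x, g₁, g₂, g₃, v`, by box closure over `B
  -- = F[x, g₁, v]`.
  have hclosed : ∀ w ∈ Algebra.adjoin B {g₂, g₃}, w ∈ N := by
    intro w hw
    refine hbox w (adjoin_pair_le_boxSpan g₂ g₃ (by norm_num) hp.pos ?_ ?_ hw)
    · obtain ⟨b₀, hb₀, b₁, hb₁, hrel⟩ := hS.relation
      rw [hrel]
      refine add_mem ?_ ?_
      · have : b₀ = (⟨b₀, hBB hb₀⟩ : B) • (1 : MvPolynomial (Fin 3) F) := by
          rw [Subalgebra.smul_def, smul_eq_mul, mul_one]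
        rw [this]
        exact Submodule.smul_mem _ _ (Submodule.subset_span (.inr ⟨0, by simp, pow_zero _⟩))
      · exact Submodule.smul_mem _ (⟨b₁, hBB hb₁⟩ : B) (Submodule.subset_span (.inl rfl))
    · rw [hv]
      refine add_mem (boxSpan_mono hBB hu) ?_
      have : X 0 ^ (q * p) * v = (⟨X 0 ^ (q * p) * v, B.mul_mem (B.pow_mem hxB _) hvB⟩ : B) •
          (g₂ ^ 0 * g₃ ^ 0) := by
        rw [Subalgebra.smul_def, smul_eq_mul]
        simp
      rw [this]
      exact Submodule.smul_mem _ _ (pow_mul_pow_mem_boxSpan _ _ (by norm_num) hp.pos)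
  have hsub : ∀ w ∈ Algebra.adjoin F {X 0, g₁, g₂}, w ∈ Algebra.adjoin B {g₂, g₃} := by
    intro w hw
    induction hw using Algebra.adjoin_induction with
    | mem w hw =>
      rcases hw with rfl | rfl | rfl
      · exact Subalgebra.algebraMap_mem _ (⟨_, hxB⟩ : B)
      · exact Subalgebra.algebraMap_mem _ (⟨_, hBB (Algebra.subset_adjoin (by simp))⟩ : B)
      · exact Algebra.subset_adjoin (by simp)
    | algebraMap r => exact Subalgebra.algebraMap_mem _ (⟨_, B.algebraMap_mem r⟩ : B)
    | add u v _ _ hu hv => exact add_mem hu hv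
    | mul u v _ _ hu hv => exact mul_mem hu hv
  -- Only the generator `x` has `x` in its lead monomial, so a product with `x` in its lead monomial
  -- is `x` times another normal product.
  have hsat : ∀ (k : ℕ) (w : MvPolynomial (Fin 3) F), X 0 ^ k * w ∈ N → w ∈ N := by
    intro k
    induction k with
    | zero => intro w hw; simpa using hw
    | succ k ih =>
      intro w hw
      refine ih _ (mem_span_of_X_mul_mem grevlex f hf0 hinj 0 ?_ _ ?_)
      · rintro ⟨E, hE⟩ hEx
        rw [hfdeg] at hEx
        simp at hEx
        have hle : Finsupp.single 0 1 ≤ E := by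
          rw [Finsupp.single_le_iff]
          omega
        obtain ⟨D, rfl⟩ := le_iff_exists_add.1 hle
        refine ⟨⟨D, by simpa using hE⟩, ?_⟩
        simp only [f, gpow_add, gpow_single, pow_one]
        rfl
      · rwa [← mul_assoc, ← pow_succ']
  obtain ⟨k, hk⟩ := hS.localized h hh
  obtain ⟨i, hi⟩ := exists_degree_eq_of_mem_span grevlex f hf0 hinj
    (hsat k h (hclosed _ (hsub _ hk))) h0
  exact ⟨i.1, by rw [hi, hfdeg]⟩

end LeadExponents

/-! ### Lead terms of `f1`, `f2` and the expansion of `f3` -/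

section ThirdInvariant

variable {F : Type*} [Field F] {p : ℕ} {M : Matrix (Fin 2) (Fin 3) F}

theorem isHomogeneous_delta : (delta : MvPolynomial (Fin 3) F).IsHomogeneous 2 :=
  (isHomogeneous_X_pow 1 2).sub ((isHomogeneous_X F 0).mul (isHomogeneous_X F 2))

theorem isHomogeneous_of_eq {σ : Type*} {f : MvPolynomial σ F} {n m : ℕ} (hf : f.IsHomogeneous n)
    (h : n = m) : f.IsHomogeneous m :=
  h ▸ hf

theorem isHomogeneous_f1 (hp : 1 < p) : (f1 p M).IsHomogeneous (2 * p) := by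
  refine IsHomogeneous.sub (IsHomogeneous.sub (IsHomogeneous.sub ?_ ?_) ?_) ?_
  · rw [← neg_mul, ← C_neg]
    exact (isHomogeneous_delta.pow p).C_mul _
  · rw [mul_assoc]
    exact isHomogeneous_of_eq (((isHomogeneous_X_pow 0 p).mul (isHomogeneous_X_pow 1 p)).C_mul _)
      (by omega)
  · rw [mul_assoc]
    exact isHomogeneous_of_eq ((isHomogeneous_delta.mul (isHomogeneous_X_pow 0 (2 * p - 2))).C_mul _)
      (by omega)
  · rw [mul_assoc]
    exact isHomogeneous_of_eq
      (((isHomogeneous_X F 1).mul (isHomogeneous_X_pow 0 (2 * p - 1))).C_mul _) (by omega)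

theorem isHomogeneous_f2 (hp : 1 < p) : (f2 p M).IsHomogeneous (p ^ 2) := by
  have h0 : p ≤ p ^ 2 := by nlinarith
  have h1 : 2 ≤ p ^ 2 := by nlinarith
  refine IsHomogeneous.sub (IsHomogeneous.sub (IsHomogeneous.sub ?_ ?_) ?_) ?_
  · exact (isHomogeneous_X_pow 1 (p ^ 2)).C_mul _
  · rw [mul_assoc]
    exact isHomogeneous_of_eq
      (((isHomogeneous_X_pow 1 p).mul (isHomogeneous_X_pow 0 (p ^ 2 - p))).C_mul _) (by omega)
  · rw [mul_assoc]
    exact isHomogeneous_of_eq ((isHomogeneous_delta.mul (isHomogeneous_X_pow 0 (p ^ 2 - 2))).C_mul _)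
      (by omega)
  · rw [mul_assoc]
    exact isHomogeneous_of_eq
      (((isHomogeneous_X F 1).mul (isHomogeneous_X_pow 0 (p ^ 2 - 1))).C_mul _) (by omega)

theorem isHomogeneous_f3Numerator (hp : 1 < p) (hodd : p % 2 = 1) :
    (f3Numerator p M).IsHomogeneous (2 * p ^ 2) := by
  have h0 : p ≤ p ^ 2 := by nlinarith
  refine IsHomogeneous.add (IsHomogeneous.add ?_ ?_) ?_
  · exact isHomogeneous_of_eq ((isHomogeneous_f1 hp).pow p) (by ring)
  · exact isHomogeneous_of_eq (((isHomogeneous_f2 hp).pow 2).C_mul _) (by ring)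
  · rw [mul_assoc]
    refine isHomogeneous_of_eq (((isHomogeneous_X_pow 0 (p ^ 2 - p)).mul
      ((isHomogeneous_f1 hp).pow ((p + 1) / 2))).C_mul _) ?_
    have : 2 * p * ((p + 1) / 2) = p ^ 2 + p := by
      have h2 : 2 * ((p + 1) / 2) = p + 1 := by omega
      calc 2 * p * ((p + 1) / 2) = p * (2 * ((p + 1) / 2)) := by ring
        _ = p ^ 2 + p := by rw [h2]; ring
    omega

theorem hasYLead_f1 (hp : 1 < p) (h123 : gam p M 1 2 3 ≠ 0) [Fact p.Prime] [CharP F p] :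
    HasYLead (2 * p) (-gam p M 1 2 3) (f1 p M) := by
  refine ⟨isHomogeneous_f1 hp, neg_ne_zero.2 h123, ?_⟩
  obtain ⟨k, rfl⟩ := Nat.exists_eq_add_of_le' hp
  have e1 : 2 * (k + 2) - 2 = 2 * k + 2 := by omega
  have e2 : 2 * (k + 2) - 1 = 2 * k + 3 := by omega
  refine ⟨X 0 ^ (k + 1) * (C (gam (k + 2) M 1 2 3) * X 2 ^ (k + 2)
    - C (gam (k + 2) M 1 2 4) * X 1 ^ (k + 2) - C (gam (k + 2) M 1 3 4) * delta * X 0 ^ k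
    - C (gam (k + 2) M 2 3 4) * X 1 * X 0 ^ (k + 1)), ?_⟩
  rw [f1, e1, e2, C_neg]
  have hd : (delta : MvPolynomial (Fin 3) F) ^ (k + 2)
      = X 1 ^ (2 * (k + 2)) - X 0 ^ (k + 2) * X 2 ^ (k + 2) := by
    rw [delta, sub_pow_char, mul_pow, ← pow_mul]
  rw [hd]
  ring

theorem hasYLead_f2 (hp : 2 < p) (h123 : gam p M 1 2 3 ≠ 0) :
    HasYLead (p ^ 2) (gam p M 1 2 3) (f2 p M) := by
  refine ⟨isHomogeneous_f2 (by omega), h123, ?_⟩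
  obtain ⟨a, ha⟩ : ∃ a, p ^ 2 - p = a + 1 := ⟨p ^ 2 - p - 1, by
    have : p < p ^ 2 := by nlinarith
    omega⟩
  obtain ⟨b, hb⟩ : ∃ b, p ^ 2 - 2 = b + 1 := ⟨p ^ 2 - 2 - 1, by
    have : 2 < p ^ 2 := by nlinarith
    omega⟩
  have hb' : p ^ 2 - 1 = b + 2 := by omega
  refine ⟨-(C (gam p M 1 2 5) * X 1 ^ p * X 0 ^ a + C (gam p M 1 3 5) * delta * X 0 ^ b
    + C (gam p M 2 3 5) * X 1 * X 0 ^ (b + 1)), ?_⟩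
  rw [f2, ha, hb, hb']
  ring

theorem degreeOf_z_C_mul_X_pow_mul {i : Fin 3} (hi : 2 ≠ i) (a : F) (k : ℕ)
    (f : MvPolynomial (Fin 3) F) : degreeOf 2 (C a * X i ^ k * f) ≤ degreeOf 2 f := by
  rw [mul_assoc]
  exact (degreeOf_C_mul_le _ _ _).trans (degreeOf_X_pow_mul hi k f).le

theorem degreeOf_z_delta : degreeOf 2 (delta : MvPolynomial (Fin 3) F) ≤ 1 := by
  rw [delta, sub_eq_add_neg]
  refine (degreeOf_add_le _ _ _).trans (max_le ?_ ?_)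
  · rw [degreeOf_X_pow_of_ne 2 (by decide)]
    exact Nat.zero_le _
  · have : -((X 0 : MvPolynomial (Fin 3) F) * X 2) = C (-1) * X 0 ^ 1 * X 2 := by
      rw [C_neg, C_1]; ring
    rw [this]
    refine (degreeOf_z_C_mul_X_pow_mul (by decide) _ _ _).trans ?_
    rw [degreeOf_X_self]

theorem degreeOf_z_C_mul (a : F) (f : MvPolynomial (Fin 3) F) {n : ℕ} (hf : degreeOf 2 f < n) :
    degreeOf 2 (C a * f) < n :=
  (degreeOf_C_mul_le _ _ _).trans_lt hf

theorem degreeOf_z_mul_X_pow {i : Fin 3} (hi : 2 ≠ i) (k : ℕ)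
    (f : MvPolynomial (Fin 3) F) : degreeOf 2 (f * X i ^ k) = degreeOf 2 f :=
  degreeOf_mul_X_pow_of_ne k hi

theorem degreeOf_f1 (hp : 1 < p) : degreeOf 2 (f1 p M) ≤ p := by
  rw [← Nat.lt_succ_iff]
  refine degreeOf_sub_lt (degreeOf_sub_lt (degreeOf_sub_lt ?_ ?_) ?_) ?_
  · rw [← neg_mul, ← C_neg]
    refine degreeOf_z_C_mul _ _ (Nat.lt_succ_of_le ((degreeOf_pow_le _ _ _).trans ?_))
    calc p * degreeOf 2 (delta : MvPolynomial (Fin 3) F) ≤ p * 1 :=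
          Nat.mul_le_mul_left p degreeOf_z_delta
      _ = p := mul_one p
  · rw [degreeOf_z_mul_X_pow (by decide), degreeOf_z_mul_X_pow (by decide), degreeOf_C]
    omega
  · rw [degreeOf_z_mul_X_pow (by decide)]
    exact degreeOf_z_C_mul _ _ (degreeOf_z_delta.trans_lt (by omega))
  · rw [degreeOf_z_mul_X_pow (by decide), ← pow_one (X 1), degreeOf_z_mul_X_pow (by decide),
      degreeOf_C]
    omega

theorem degreeOf_f2 : degreeOf 2 (f2 p M) ≤ 1 := by
  rw [← Nat.lt_succ_iff]
  refine degreeOf_sub_lt (degreeOf_sub_lt (degreeOf_sub_lt ?_ ?_) ?_) ?_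
  · rw [degreeOf_z_mul_X_pow (by decide), degreeOf_C]
    omega
  · rw [degreeOf_z_mul_X_pow (by decide), degreeOf_z_mul_X_pow (by decide), degreeOf_C]
    omega
  · rw [degreeOf_z_mul_X_pow (by decide)]
    exact degreeOf_z_C_mul _ _ (degreeOf_z_delta.trans_lt (by omega))
  · rw [degreeOf_z_mul_X_pow (by decide), ← pow_one (X 1), degreeOf_z_mul_X_pow (by decide),
      degreeOf_C]
    omega

variable [Fact p.Prime] [CharP F p]

theorem f1_pow_eq (hodd : p % 2 = 1) (hp : 2 < p) : f1 p M ^ p =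
    -(C (gam p M 1 2 3 ^ p) * (X 1 ^ (2 * p ^ 2) - X 0 ^ p ^ 2 * X 2 ^ p ^ 2))
      - X 0 ^ p ^ 2 * (C (gam p M 1 2 4 ^ p) * X 1 ^ p ^ 2
        + C (gam p M 1 3 4 ^ p) * delta ^ p * X 0 ^ (p ^ 2 - 2 * p)
        + C (gam p M 2 3 4 ^ p) * X 1 ^ p * X 0 ^ (p ^ 2 - p)) := by
  have hd : ((delta : MvPolynomial (Fin 3) F) ^ p) ^ p
      = X 1 ^ (2 * p ^ 2) - X 0 ^ p ^ 2 * X 2 ^ p ^ 2 := by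
    rw [← pow_mul, ← sq, delta, sub_pow_char_pow, mul_pow, ← pow_mul]
  have h1 : (2 * p - 2) * p = p ^ 2 + (p ^ 2 - 2 * p) := by
    have : 2 * p ≤ p ^ 2 := by nlinarith
    rw [Nat.sub_mul, ← Nat.add_sub_assoc this]
    congr 1
    ring
  have h2 : (2 * p - 1) * p = p ^ 2 + (p ^ 2 - p) := by
    have : p ≤ p ^ 2 := by nlinarith
    rw [Nat.sub_mul, ← Nat.add_sub_assoc this]
    congr 1 <;> ring
  rw [f1, sub_pow_char, sub_pow_char, sub_pow_char, (Nat.odd_iff.2 hodd).neg_pow, mul_pow, hd]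
  simp only [mul_pow, C_pow]
  rw [← pow_mul (X 0) (2 * p - 2), ← pow_mul (X 0) (2 * p - 1), h1, h2]
  simp only [pow_add, sq p, pow_mul]
  ring

/-- Modulo `x^p` only `-γ₁₂₃ y^(2p)` is left of `f1`, and congruences pass to powers. In
`f3Numerator` this power carries the factor `x^(p²-p)`, so the error is a multiple of `x^(p²)`. -/
theorem exists_f1_pow_half_eq (hodd : p % 2 = 1) (hp : 2 < p) :
    ∃ r, degreeOf 2 r < p ^ 2 ∧ f1 p M ^ ((p + 1) / 2) =
      C ((-gam p M 1 2 3) ^ ((p + 1) / 2)) * X 1 ^ (p ^ 2 + p) + X 0 ^ p * r := by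
  have hn : 2 * ((p + 1) / 2) = p + 1 := by omega
  set n := (p + 1) / 2 with hndef
  have hpn : 2 * p * n = p ^ 2 + p := by
    calc 2 * p * n = p * (2 * n) := by ring
      _ = p ^ 2 + p := by rw [hn]; ring
  have hdvd : X 0 ^ p ∣ f1 p M - C (-gam p M 1 2 3) * X 1 ^ (2 * p) := by
    have e1 : 2 * p - 2 = p + (p - 2) := by omega
    have e2 : 2 * p - 1 = p + (p - 1) := by omega
    have hd : (delta : MvPolynomial (Fin 3) F) ^ p
        = X 1 ^ (2 * p) - X 0 ^ p * X 2 ^ p := by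
      rw [delta, sub_pow_char, mul_pow, ← pow_mul]
    refine ⟨C (gam p M 1 2 3) * X 2 ^ p - C (gam p M 1 2 4) * X 1 ^ p
      - C (gam p M 1 3 4) * delta * X 0 ^ (p - 2) - C (gam p M 2 3 4) * X 1 * X 0 ^ (p - 1), ?_⟩
    rw [f1, hd, e1, e2, C_neg, pow_add, pow_add]
    ring
  obtain ⟨r, hr⟩ := hdvd.trans (sub_dvd_pow_sub_pow _ _ n)
  rw [mul_pow, ← C_pow, ← pow_mul, hpn] at hr
  refine ⟨r, ?_, by rw [← hr]; ring⟩
  rw [← degreeOf_X_pow_mul (i := 2) (j := 0) (by decide) p, ← hr]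
  refine degreeOf_sub_lt ?_ ?_
  · refine (degreeOf_pow_le _ _ _).trans_lt ?_
    have := Nat.mul_le_mul_left n (degreeOf_f1 (M := M) (by omega : 1 < p))
    have h3 : 2 * (n * p) = p ^ 2 + p := by rw [← hpn]; ring
    have h4 : p < p ^ 2 := by nlinarith
    omega
  · rw [degreeOf_z_mul_X_pow (by decide), degreeOf_C]
    positivity

/-- The expansion of `f3Numerator` in powers of `x`. -/
theorem exists_f3Numerator_eq (hodd : p % 2 = 1) (hp : 2 < p) :
    ∃ t, degreeOf 2 t < p ^ 2 ∧ f3Numerator p M = X 0 ^ (p ^ 2 - 2) *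
      (C (-2 * gam p M 1 2 3 ^ (p - 1)) * (C (gam p M 1 3 5) * X 1 ^ p ^ 2 * delta
        + C (gam p M 2 3 5) * X 0 * X 1 ^ (p ^ 2 + 1))
      + X 0 ^ 2 * (C (gam p M 1 2 3 ^ p) * X 2 ^ p ^ 2 + t)) := by
  obtain ⟨r, hr, hpow⟩ := exists_f1_pow_half_eq (M := M) hodd hp
  set γ := gam p M 1 2 3 with hγ
  have hpp : p < p ^ 2 := by nlinarith
  have h2p : 2 * p ≤ p ^ 2 := by nlinarith
  -- `f2 = γ₁₂₃ y^(p²) - x^(p²-p) l`, while `-x^(p²) s` is the tail of `f1 ^ p`.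
  set l : MvPolynomial (Fin 3) F := C (gam p M 1 2 5) * X 1 ^ p
    + C (gam p M 1 3 5) * delta * X 0 ^ (p - 2) + C (gam p M 2 3 5) * X 1 * X 0 ^ (p - 1) with hl
  set s : MvPolynomial (Fin 3) F := C (gam p M 1 2 4 ^ p) * X 1 ^ p ^ 2
        + C (gam p M 1 3 4 ^ p) * delta ^ p * X 0 ^ (p ^ 2 - 2 * p)
        + C (gam p M 2 3 4 ^ p) * X 1 ^ p * X 0 ^ (p ^ 2 - p) with hs
  refine ⟨C (γ ^ (p - 2)) * (l ^ 2 * X 0 ^ (p ^ 2 - 2 * p))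
    + C (2 * (-γ) ^ ((p - 3) / 2) * gam p M 1 2 5) * r - s, ?_, ?_⟩
  · refine degreeOf_sub_lt (degreeOf_add_lt (degreeOf_z_C_mul _ _ ?_) (degreeOf_z_C_mul _ _ hr)) ?_
    · rw [degreeOf_z_mul_X_pow (by decide)]
      refine (degreeOf_pow_le _ _ _).trans_lt ?_
      have : degreeOf 2 l < 2 := by
        refine degreeOf_add_lt (degreeOf_add_lt ?_ ?_) ?_
        · rw [degreeOf_z_mul_X_pow (by decide), degreeOf_C]
          omega
        · rw [degreeOf_z_mul_X_pow (by decide)]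
          exact degreeOf_z_C_mul _ _ (degreeOf_z_delta.trans_lt (by omega))
        · rw [degreeOf_z_mul_X_pow (by decide), ← pow_one (X 1), degreeOf_z_mul_X_pow (by decide),
            degreeOf_C]
          omega
      nlinarith
    · refine degreeOf_add_lt (degreeOf_add_lt ?_ ?_) ?_
      · rw [degreeOf_z_mul_X_pow (by decide), degreeOf_C]
        omega
      · rw [degreeOf_z_mul_X_pow (by decide)]
        refine degreeOf_z_C_mul _ _ ((degreeOf_pow_le _ _ _).trans_lt ?_)
        have := Nat.mul_le_mul_left p (degreeOf_z_delta (F := F))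
        omega
      · rw [degreeOf_z_mul_X_pow (by decide), degreeOf_z_mul_X_pow (by decide), degreeOf_C]
        omega
  · have e1 : (X 0 : MvPolynomial (Fin 3) F) ^ p ^ 2 = X 0 ^ (p ^ 2 - 2) * X 0 ^ 2 := by
      rw [← pow_add, Nat.sub_add_cancel (by omega)]
    have e2 : (X 0 : MvPolynomial (Fin 3) F) ^ (p ^ 2 - 1) = X 0 ^ (p ^ 2 - 2) * X 0 := by
      rw [← pow_succ]
      congr 1
      omega
    have e3 : (X 0 : MvPolynomial (Fin 3) F) ^ (p ^ 2 - p) * X 0 ^ p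
        = X 0 ^ (p ^ 2 - 2) * X 0 ^ 2 := by
      rw [← pow_add, ← pow_add]
      congr 1
      omega
    have e4 : ((X 0 : MvPolynomial (Fin 3) F) ^ (p ^ 2 - p)) ^ 2
        = X 0 ^ (p ^ 2 - 2) * X 0 ^ 2 * X 0 ^ (p ^ 2 - 2 * p) := by
      rw [← pow_mul, ← pow_add, ← pow_add]
      congr 1
      omega
    have e5 : f2 p M = C γ * X 1 ^ p ^ 2 - X 0 ^ (p ^ 2 - p) * l := by
      have x1 : (X 0 : MvPolynomial (Fin 3) F) ^ (p ^ 2 - 2) = X 0 ^ (p ^ 2 - p) * X 0 ^ (p - 2) := by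
        rw [← pow_add]
        congr 1
        omega
      have x2 : (X 0 : MvPolynomial (Fin 3) F) ^ (p ^ 2 - 1) = X 0 ^ (p ^ 2 - p) * X 0 ^ (p - 1) := by
        rw [← pow_add]
        congr 1
        omega
      rw [f2, x1, x2, hl]
      ring
    have e6 : X 0 ^ (p ^ 2 - p) * l = C (gam p M 1 2 5) * X 1 ^ p * X 0 ^ (p ^ 2 - p)
        + C (gam p M 1 3 5) * delta * X 0 ^ (p ^ 2 - 2)
        + C (gam p M 2 3 5) * X 1 * (X 0 ^ (p ^ 2 - 2) * X 0) := by
      rw [← e2]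
      have := e5
      rw [f2] at this
      linear_combination this
    -- This makes the terms `y^(2p²)` of `f1^p` and of `γ^(p-2) f2²` cancel.
    have c1 : (C (γ ^ (p - 2)) : MvPolynomial (Fin 3) F) * C γ ^ 2 = C (γ ^ p) := by
      rw [← C_pow, ← C_mul, ← pow_add, Nat.sub_add_cancel (by omega)]
    have c2 : (C (γ ^ (p - 2)) : MvPolynomial (Fin 3) F) * C γ = C (γ ^ (p - 1)) := by
      rw [← C_mul, ← pow_succ]
      congr 3
      omega
    -- The last summand of `f3Numerator` removes the cross term in `x^(p²-p) y^(p²+p)` of `f2²`; the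
    -- signs agree because `p - 1` is even.
    have c3 : (C ((-γ) ^ ((p - 3) / 2)) : MvPolynomial (Fin 3) F) * C ((-γ) ^ ((p + 1) / 2))
        = C (γ ^ (p - 1)) := by
      rw [← C_mul, ← pow_add]
      have : (p - 3) / 2 + (p + 1) / 2 = p - 1 := by omega
      rw [this, Even.neg_pow]
      rw [Nat.even_iff]
      omega
    rw [f3Numerator, f1_pow_eq hodd hp, hpow, e5, ← hγ, ← hs]
    have c4 : (C 2 : MvPolynomial (Fin 3) F) = 2 := map_ofNat C 2
    simp only [C_mul, C_neg, c4, e1]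
    linear_combination (X 1 ^ (2 * p ^ 2)) * c1 - 2 * X 1 ^ p ^ 2 * (X 0 ^ (p ^ 2 - p) * l) * c2
      - 2 * C (γ ^ (p - 1)) * X 1 ^ p ^ 2 * e6 + C (γ ^ (p - 2)) * l ^ 2 * e4
      + 2 * C (gam p M 1 2 5) * X 0 ^ (p ^ 2 - p) * X 1 ^ (p ^ 2 + p) * c3
      + 2 * C ((-γ) ^ ((p - 3) / 2)) * C (gam p M 1 2 5) * r * e3

theorem two_ne_zero_of_odd (hp : 2 < p) : (2 : F) ≠ 0 := by
  have : ((2 : ℕ) : F) ≠ 0 := by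
    rw [Ne, CharP.cast_eq_zero_iff F p]
    intro h
    exact absurd (Nat.le_of_dvd (by norm_num) h) (by omega)
  exact_mod_cast this

theorem exists_f3_eq (hodd : p % 2 = 1) (hp : 2 < p) :
    f3Numerator p M + 2 * X 0 ^ (p ^ 2 - 2) * f3 p M = 0 ∧
    ∃ t, degreeOf 2 t < p ^ 2 ∧ f3 p M =
      C (gam p M 1 2 3 ^ (p - 1)) * (C (gam p M 1 3 5) * X 1 ^ p ^ 2 * delta
        + C (gam p M 2 3 5) * X 0 * X 1 ^ (p ^ 2 + 1))
      + X 0 ^ 2 * (C ((-2)⁻¹ * gam p M 1 2 3 ^ p) * X 2 ^ p ^ 2 + t) := by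
  obtain ⟨t, ht, hN⟩ := exists_f3Numerator_eq (M := M) hodd hp
  have h2 : (2 : F) ≠ 0 := two_ne_zero_of_odd hp
  have c4 : (C 2 : MvPolynomial (Fin 3) F) = 2 := map_ofNat C 2
  have hc : (C ((-2)⁻¹) : MvPolynomial (Fin 3) F) * (-2) = 1 := by
    rw [← c4, ← C_neg, ← C_mul, inv_mul_cancel₀ (neg_ne_zero.2 h2), C_1]
  have hf3 : f3 p M = C ((-2)⁻¹) * (C (-2 * gam p M 1 2 3 ^ (p - 1)) *
      (C (gam p M 1 3 5) * X 1 ^ p ^ 2 * delta + C (gam p M 2 3 5) * X 0 * X 1 ^ (p ^ 2 + 1))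
      + X 0 ^ 2 * (C (gam p M 1 2 3 ^ p) * X 2 ^ p ^ 2 + t)) := by
    rw [f3, hN, X_pow_eq_monomial, divMonomial_monomial_mul]
  constructor
  · rw [hN, hf3]
    linear_combination (-X 0 ^ (p ^ 2 - 2) * (C (-2 * gam p M 1 2 3 ^ (p - 1)) *
      (C (gam p M 1 3 5) * X 1 ^ p ^ 2 * delta + C (gam p M 2 3 5) * X 0 * X 1 ^ (p ^ 2 + 1))
      + X 0 ^ 2 * (C (gam p M 1 2 3 ^ p) * X 2 ^ p ^ 2 + t))) * hc
  · refine ⟨C ((-2)⁻¹) * t, degreeOf_z_C_mul _ _ ht, ?_⟩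
    rw [hf3]
    simp only [C_mul, C_neg, c4]
    linear_combination (C (gam p M 1 2 3 ^ (p - 1)) * (C (gam p M 1 3 5) * X 1 ^ p ^ 2 * delta
        + C (gam p M 2 3 5) * X 0 * X 1 ^ (p ^ 2 + 1))) * hc

end ThirdInvariant

/-! ### Values of the first parameter when `γ₁₃₅ = 0` -/

section Values

variable {F : Type*} [Field F] {p : ℕ} [Fact p.Prime] [CharP F p] {M : Matrix (Fin 2) (Fin 3) F}

theorem card_group : Fintype.card (Multiplicative (Fin 3 → ZMod p)) = p ^ 3 := by
  simp [ZMod.card]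

open Classical in
/-- The set of values of the first parameter on the group. -/
def shiftValues (p : ℕ) [Fact p.Prime] [CharP F p] (M : Matrix (Fin 2) (Fin 3) F) : Finset F :=
  Finset.univ.image (shift p M 0)

theorem shift_mem_shiftValues (g : Multiplicative (Fin 3 → ZMod p)) :
    shift p M 0 g ∈ shiftValues p M := by
  classical
  exact Finset.mem_image_of_mem _ (Finset.mem_univ g)

/-- For `γ₁₃₅ = 0`, `shift_relation_two` is a polynomial equation of degree `p²` in `c₀(g)` alone.
-/
theorem card_shiftValues_le (h123 : gam p M 1 2 3 ≠ 0) (h135 : gam p M 1 3 5 = 0) :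
    (shiftValues p M).card ≤ p ^ 2 := by
  classical
  have hp := one_lt_prime p
  have hpp : p < p ^ 2 := by nlinarith
  let T : Polynomial F := Polynomial.C (gam p M 1 2 3) * Polynomial.X ^ p ^ 2
    - Polynomial.C (gam p M 1 2 5) * Polynomial.X ^ p - Polynomial.C (gam p M 2 3 5) * Polynomial.X
  have hT : T.coeff (p ^ 2) = gam p M 1 2 3 := by
    simp only [T, Polynomial.coeff_sub, Polynomial.coeff_C_mul, Polynomial.coeff_X_pow,
      Polynomial.coeff_X, if_true]
    rw [if_neg (by omega), if_neg (by omega)]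
    ring
  have hT0 : T ≠ 0 := fun h => h123 (by rw [← hT, h, Polynomial.coeff_zero])
  have hdeg : T.natDegree ≤ p ^ 2 := by
    refine (Polynomial.natDegree_sub_le _ _).trans (max_le ((Polynomial.natDegree_sub_le _ _).trans
      (max_le ?_ ?_)) ?_)
    · exact Polynomial.natDegree_C_mul_X_pow_le _ _
    · exact (Polynomial.natDegree_C_mul_X_pow_le _ _).trans hpp.le
    · exact (Polynomial.natDegree_C_mul_le _ _).trans (Polynomial.natDegree_X_le.trans (by omega))
  by_contra hlt
  refine hT0 (Polynomial.eq_zero_of_natDegree_lt_card_of_eval_eq_zero' T (shiftValues p M) ?_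
    (by omega))
  intro a ha
  obtain ⟨g, -, rfl⟩ := Finset.mem_image.1 ha
  have := shift_relation_two p M g
  rw [h135] at this
  simp only [T, Polynomial.eval_sub, Polynomial.eval_mul, Polynomial.eval_C, Polynomial.eval_pow,
    Polynomial.eval_X]
  linear_combination this

theorem exists_shift_zero_eq_zero (h123 : gam p M 1 2 3 ≠ 0) (h135 : gam p M 1 3 5 = 0) :
    ∃ g, shift p M 0 g = 0 ∧ shift p M 1 g ≠ 0 := by
  classical
  have hp := one_lt_prime p
  have hninj : ¬ Function.Injective (shift p M 0) := by
    intro hinj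
    have h1 := card_shiftValues_le h123 h135
    rw [shiftValues, Finset.card_image_of_injective _ hinj, Finset.card_univ, card_group] at h1
    have : p ^ 2 < p ^ 3 := Nat.pow_lt_pow_right hp (by norm_num)
    omega
  rw [Function.not_injective_iff] at hninj
  obtain ⟨g, h, hgh, hne⟩ := hninj
  have h0 : shift p M 0 (g * h⁻¹) = 0 := by rw [shift_mul, shift_inv, hgh, add_neg_cancel]
  refine ⟨g * h⁻¹, h0, fun h1 => hne ?_⟩
  rw [← mul_inv_eq_one]
  exact eq_one_of_shift h123 h0 h1

/-- Let `τ` be a nontrivial element with `c₀(τ) = 0`. If `c₀(g) = 0`, then `c₁(g) τ - c₁(τ) g` is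
killed by rows 1, 2, 3 of `Γ`, so `g` is proportional to `τ` over `F` and is trivial once one
coordinate `j` with `τ_j ≠ 0` vanishes. Hence `g ↦ (c₀(g), g_j)` is injective, and `p³` is at most
`p` times the number of values. -/
theorem le_card_shiftValues (h123 : gam p M 1 2 3 ≠ 0) (h135 : gam p M 1 3 5 = 0) :
    p ^ 2 ≤ (shiftValues p M).card := by
  classical
  obtain ⟨τ, hτ0, hτ1⟩ := exists_shift_zero_eq_zero h123 h135
  have hp := one_lt_prime p
  obtain ⟨j, hj⟩ : ∃ j, (coords p τ : Fin 3 → F) j ≠ 0 := by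
    by_contra! h
    apply hτ1
    rw [← sum_coords_gammaRow_two]
    exact Finset.sum_eq_zero fun t _ => by rw [h t, zero_mul]
  have hker : ∀ g, shift p M 0 g = 0 → (coords p g : Fin 3 → F) j = 0 → g = 1 := by
    intro g hg hgj
    apply eq_one_of_shift h123 hg
    have hv : shift p M 1 g • coords p τ - shift p M 1 τ • coords p g = (0 : Fin 3 → F) := by
      have hlin : ∀ n, ∑ t, (shift p M 1 g • coords p τ - shift p M 1 τ • coords p g : Fin 3 → F) t
          * gammaRow p M n t = shift p M 1 g * ∑ t, coords p τ t * gammaRow p M n t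
            - shift p M 1 τ * ∑ t, coords p g t * gammaRow p M n t := by
        intro n
        rw [Finset.mul_sum, Finset.mul_sum, ← Finset.sum_sub_distrib]
        refine Finset.sum_congr rfl fun t _ => ?_
        simp only [Pi.sub_apply, Pi.smul_apply, smul_eq_mul]
        ring
      apply eq_zero_of_gam_ne_zero p M h123
      · rw [hlin, sum_coords_gammaRow_odd p M _ 0, sum_coords_gammaRow_odd p M _ 0, hτ0, hg]
        simp
      · rw [hlin, sum_coords_gammaRow_two, sum_coords_gammaRow_two]
        ring
      · rw [hlin, sum_coords_gammaRow_odd p M _ 1, sum_coords_gammaRow_odd p M _ 1, hτ0, hg,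
          pow_one, zero_pow (by omega)]
        simp
    have := congrFun hv j
    simp only [Pi.sub_apply, Pi.smul_apply, smul_eq_mul, hgj, mul_zero, sub_zero,
      Pi.zero_apply] at this
    exact (mul_eq_zero.1 this).resolve_right hj
  let φ : Multiplicative (Fin 3 → ZMod p) → F × ZMod p := fun g => (shift p M 0 g, g.toAdd j)
  have hφ : Function.Injective φ := by
    intro g h hgh
    simp only [φ, Prod.mk.injEq] at hgh
    rw [← mul_inv_eq_one]
    apply hker
    · rw [shift_mul, shift_inv, hgh.1, add_neg_cancel]
    · simp [coords, hgh.2]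
  have hcard : Fintype.card (Multiplicative (Fin 3 → ZMod p))
      ≤ (shiftValues p M ×ˢ (Finset.univ : Finset (ZMod p))).card := by
    rw [← Finset.card_univ]
    refine Finset.card_le_card_of_injOn φ (fun g _ => ?_) hφ.injOn
    simp [φ, shift_mem_shiftValues]
  rw [card_group, Finset.card_product, Finset.card_univ, ZMod.card, pow_succ] at hcard
  exact Nat.le_of_mul_le_mul_right hcard (by omega)

/-- Otherwise the `p`-th powers of the `p²` values of `c₀` would all be roots of a nonzero
polynomial of degree `p`. This makes the lead coefficient of `f3 / x` nonzero. -/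
theorem gam_235_ne_zero (h123 : gam p M 1 2 3 ≠ 0) (h135 : gam p M 1 3 5 = 0) :
    gam p M 2 3 5 ≠ 0 := by
  classical
  intro h235
  have hp := one_lt_prime p
  have hpp : p < p ^ 2 := by nlinarith
  let T : Polynomial F := Polynomial.C (gam p M 1 2 3) * Polynomial.X ^ p
    - Polynomial.C (gam p M 1 2 5) * Polynomial.X
  have hT : T.coeff p = gam p M 1 2 3 := by
    simp only [T, Polynomial.coeff_sub, Polynomial.coeff_C_mul, Polynomial.coeff_X_pow,
      Polynomial.coeff_X, if_true]
    rw [if_neg (by omega)]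
    ring
  have hT0 : T ≠ 0 := fun h => h123 (by rw [← hT, h, Polynomial.coeff_zero])
  have hdeg : T.natDegree ≤ p := by
    refine (Polynomial.natDegree_sub_le _ _).trans (max_le ?_ ?_)
    · exact Polynomial.natDegree_C_mul_X_pow_le _ _
    · exact (Polynomial.natDegree_C_mul_le _ _).trans (Polynomial.natDegree_X_le.trans (by omega))
  have hcard : ((shiftValues p M).image (fun a => a ^ p)).card = (shiftValues p M).card :=
    Finset.card_image_of_injective _ (frobenius_inj F p)
  have := le_card_shiftValues h123 h135
  refine hT0 (Polynomial.eq_zero_of_natDegree_lt_card_of_eval_eq_zero' T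
    ((shiftValues p M).image (fun a => a ^ p)) ?_ (by omega))
  intro b hb
  obtain ⟨a, ha, rfl⟩ := Finset.mem_image.1 hb
  obtain ⟨g, -, rfl⟩ := Finset.mem_image.1 ha
  have := shift_relation_two p M g
  rw [h135, h235] at this
  simp only [T, Polynomial.eval_sub, Polynomial.eval_mul, Polynomial.eval_C, Polynomial.eval_pow,
    Polynomial.eval_X, ← pow_mul, ← sq]
  linear_combination this

end Values

/-! ### Invariants modulo `x` -/

section Reduction

variable {F : Type*} [Field F]

/-- Reduction modulo `x`, followed by `y ↦ 1`. -/
def modX : MvPolynomial (Fin 3) F →ₐ[F] Polynomial F :=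
  aeval ![0, 1, Polynomial.X]

theorem modX_X0 : modX (X 0 : MvPolynomial (Fin 3) F) = 0 := by simp [modX]

theorem modX_X1 : modX (X 1 : MvPolynomial (Fin 3) F) = 1 := by simp [modX]

theorem modX_X2 : modX (X 2 : MvPolynomial (Fin 3) F) = Polynomial.X := by simp [modX]

theorem modX_monomial (d : Fin 3 →₀ ℕ) (a : F) :
    modX (monomial d a) = Polynomial.C a * (0 ^ d 0 * Polynomial.X ^ d 2) := by
  rw [modX, aeval_monomial, Finsupp.prod_fintype _ _ (by simp), Fin.prod_univ_three]
  simp [Polynomial.algebraMap_eq]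

theorem natDegree_modX_le (f : MvPolynomial (Fin 3) F) : (modX f).natDegree ≤ degreeOf 2 f := by
  conv_lhs => rw [f.as_sum, map_sum]
  refine Polynomial.natDegree_sum_le_of_forall_le _ _ fun d hd => ?_
  rw [modX_monomial]
  refine le_trans ?_ (monomial_le_degreeOf 2 hd)
  rcases eq_or_ne (d 0) 0 with h | h
  · rw [h, pow_zero, one_mul]
    exact Polynomial.natDegree_C_mul_X_pow_le _ _
  · simp [zero_pow h]

/-- Setting `y = 1` loses nothing on homogeneous polynomials: modulo `x`, the degree and the
exponent of `z` recover the exponent of `y`. -/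
theorem X_dvd_of_modX_eq_zero {u : MvPolynomial (Fin 3) F} {s : ℕ} (hu : u.IsHomogeneous s)
    (h : modX u = 0) : X 0 ∣ u := by
  classical
  rw [X_dvd_iff_modMonomial_eq_zero]
  ext d
  by_cases hd : Finsupp.single 0 1 ≤ d
  · rw [coeff_modMonomial_of_le _ hd, coeff_zero]
  rw [coeff_modMonomial_of_not_le _ hd, coeff_zero]
  have hd0 : d 0 = 0 := by
    rw [Finsupp.single_le_iff] at hd
    omega
  by_contra hne
  have hds := sum_exponents_eq_of_isHomogeneous hu (mem_support_iff.2 hne)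
  apply hne
  have h1 : (modX u).coeff (d 2) = coeff d u := by
    conv_lhs => rw [u.as_sum, map_sum]
    rw [Polynomial.finsetSum_coeff, Finset.sum_eq_single_of_mem d (mem_support_iff.2 hne)]
    · rw [modX_monomial, hd0]
      simp
    · intro e he hed
      have hes := sum_exponents_eq_of_isHomogeneous hu he
      rw [modX_monomial, Polynomial.coeff_C_mul]
      rcases eq_or_ne (e 0) 0 with h0 | h0
      · rw [h0, pow_zero, one_mul, Polynomial.coeff_X_pow, if_neg, mul_zero]
        intro h2
        apply hed
        ext i
        fin_cases i <;> simp <;> omega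
      · simp [zero_pow h0]
  rw [← h1, h, Polynomial.coeff_zero]

theorem modX_pderiv (f : MvPolynomial (Fin 3) F) :
    modX (pderiv 2 f) = Polynomial.derivative (modX f) := by
  induction f using MvPolynomial.induction_on with
  | C a => rw [pderiv_C, map_zero, ← algebraMap_eq, AlgHom.commutes, Polynomial.algebraMap_eq,
      Polynomial.derivative_C]
  | add u v hu hv => simp only [map_add, hu, hv]
  | mul_X u i hu =>
    rw [pderiv_mul, map_add, map_mul, map_mul, hu, map_mul, Polynomial.derivative_mul]
    congr 2
    fin_cases i
    · simp [modX_X0]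
    · simp [modX_X1]
    · simp [modX_X2]

variable {p : ℕ} [Fact p.Prime] [CharP F p] {M : Matrix (Fin 2) (Fin 3) F}

theorem modX_act (g : Multiplicative (Fin 3 → ZMod p)) (f : MvPolynomial (Fin 3) F) :
    modX (act (rep p M g) f)
      = (modX f).comp (Polynomial.X + Polynomial.C (2 * shift p M 0 g)) := by
  have : (modX.comp (act (rep p M g)) : MvPolynomial (Fin 3) F →ₐ[F] Polynomial F)
      = (Polynomial.aeval (Polynomial.X + Polynomial.C (2 * shift p M 0 g))).comp modX := by
    apply MvPolynomial.algHom_ext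
    intro i
    fin_cases i
    · simp [act_x, modX_X0]
    · simp [act_y, modX_X0, modX_X1]
    · simp [act_z, modX]
  exact DFunLike.congr_fun this f

/-- Such a `g` fixes `x` and `y` and sends `z` to `z + c₁(g) x`; this is the first-order Taylor
expansion. -/
theorem exists_act_eq (g : Multiplicative (Fin 3 → ZMod p)) (hg : shift p M 0 g = 0)
    (f : MvPolynomial (Fin 3) F) : ∃ r, act (rep p M g) f
      = f + C (shift p M 1 g) * X 0 * pderiv 2 f + X 0 ^ 2 * r := by
  induction f using MvPolynomial.induction_on with
  | C a => exact ⟨0, by rw [act_C, pderiv_C]; ring⟩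
  | add u v hu hv =>
    obtain ⟨r, hr⟩ := hu
    obtain ⟨s, hs⟩ := hv
    exact ⟨r + s, by rw [map_add, hr, hs, map_add]; ring⟩
  | mul_X u i hu =>
    obtain ⟨r, hr⟩ := hu
    have hi : act (rep p M g) (X i) = X i + C (shift p M 1 g) * X 0 * pderiv 2 (X i) := by
      fin_cases i
      · simp [act_x]
      · simp [act_y, hg]
      · simp [act_z, hg]
    refine ⟨r * (X i + C (shift p M 1 g) * X 0 * pderiv 2 (X i))
      + C (shift p M 1 g) ^ 2 * pderiv 2 u * pderiv 2 (X i), ?_⟩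
    rw [map_mul, hr, hi, pderiv_mul]
    ring

theorem eval_modX_of_mem_invariants {w : MvPolynomial (Fin 3) F} (hw : w ∈ invariants p M)
    (g : Multiplicative (Fin 3 → ZMod p)) :
    (modX w).eval (2 * shift p M 0 g) = (modX w).eval 0 := by
  have h := modX_act (M := M) g w
  rw [(mem_invariants p M w).1 hw g] at h
  conv_rhs => rw [h]
  simp

/-- For an element `τ` with `c₀(τ) = 0` and `c₁(τ) ≠ 0`, the `x`-linear term of the Taylor expansion
has to vanish, so `x` divides `∂w/∂z`. -/
theorem derivative_modX_of_mem_invariants (h123 : gam p M 1 2 3 ≠ 0) (h135 : gam p M 1 3 5 = 0)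
    {w : MvPolynomial (Fin 3) F} (hw : w ∈ invariants p M) :
    Polynomial.derivative (modX w) = 0 := by
  obtain ⟨τ, hτ0, hτ1⟩ := exists_shift_zero_eq_zero h123 h135
  obtain ⟨r, hr⟩ := exists_act_eq τ hτ0 w
  rw [(mem_invariants p M w).1 hw τ] at hr
  have h1 : C (shift p M 1 τ) * pderiv 2 w + X 0 * r = 0 := by
    apply mul_left_cancel₀ (X_ne_zero (0 : Fin 3) : (X 0 : MvPolynomial (Fin 3) F) ≠ 0)
    linear_combination -hr
  have h2 := congrArg modX h1
  rw [map_add, map_mul, map_mul, modX_X0, zero_mul, add_zero, map_zero, modX_pderiv,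
    ← algebraMap_eq, AlgHom.commutes, Polynomial.algebraMap_eq] at h2
  exact (mul_eq_zero.1 h2).resolve_left (Polynomial.C_ne_zero.2 hτ1)

/-- Modulo `x` the group translates `z` by `2c₀(g)`, so the reduction takes one and the same value
at all these points. If `γ₁₃₅ ≠ 0` there are `p³` of them, more than the degree. If `γ₁₃₅ = 0` there
are only `p²`, but the derivative vanishes, so the reduction is a polynomial of degree below `p²` in
`z^p`. -/
theorem modX_eq_C_of_mem_invariants (hp2 : p ≠ 2) (h123 : gam p M 1 2 3 ≠ 0)
    {w : MvPolynomial (Fin 3) F} (hw : w ∈ invariants p M) (hdeg : (modX w).natDegree < p ^ 3) :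
    modX w = Polynomial.C ((modX w).eval 0) := by
  classical
  have hp := one_lt_prime p
  have h2 : (2 : F) ≠ 0 := by
    have : ((2 : ℕ) : F) ≠ 0 := by
      rw [Ne, CharP.cast_eq_zero_iff F p]
      exact fun h => hp2 ((Nat.prime_dvd_prime_iff_eq Fact.out Nat.prime_two).1 h)
    exact_mod_cast this
  rw [← sub_eq_zero]
  by_cases h135 : gam p M 1 3 5 = 0
  · have hexp := Polynomial.expand_contract p (derivative_modX_of_mem_invariants h123 h135 hw)
      (by omega)
    set Θ := Polynomial.contract p (modX w) with hΘ
    have hΘdeg : Θ.natDegree < p ^ 2 := by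
      rw [← hexp, Polynomial.natDegree_expand] at hdeg
      exact Nat.lt_of_mul_lt_mul_right (a := p) (by rwa [← pow_succ])
    have hev : ∀ a, (modX w).eval a = Θ.eval (a ^ p) := by
      intro a
      rw [← hexp, Polynomial.expand_eval]
    have hcard : ((shiftValues p M).image fun a => (2 * a) ^ p).card = (shiftValues p M).card :=
      Finset.card_image_of_injective _ fun a b hab =>
        mul_left_cancel₀ h2 (frobenius_inj F p hab)
    have hle := le_card_shiftValues h123 h135
    have hz : Θ - Polynomial.C (Θ.eval 0) = 0 := by
      refine Polynomial.eq_zero_of_natDegree_lt_card_of_eval_eq_zero' _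
        ((shiftValues p M).image fun a => (2 * a) ^ p) ?_ ?_
      · intro b hb
        obtain ⟨a, ha, rfl⟩ := Finset.mem_image.1 hb
        obtain ⟨g, -, rfl⟩ := Finset.mem_image.1 ha
        have := eval_modX_of_mem_invariants hw g
        rw [hev, hev, zero_pow (by omega)] at this
        rw [Polynomial.eval_sub, this, Polynomial.eval_C, sub_self]
      · rw [Polynomial.natDegree_sub_C]
        omega
    rw [hev, zero_pow (by omega), ← hexp, ← Polynomial.expand_C p, ← map_sub, hz, map_zero]
  · refine Polynomial.eq_zero_of_natDegree_lt_card_of_eval_eq_zero _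
      (f := fun g => 2 * shift p M 0 g) ?_ ?_ ?_
    · exact fun g h hgh => shift_zero_injective h135 (mul_left_cancel₀ h2 hgh)
    · intro g
      rw [Polynomial.eval_sub, eval_modX_of_mem_invariants hw, Polynomial.eval_C, sub_self]
    · rw [Polynomial.natDegree_sub_C, card_group]
      exact hdeg

theorem exists_eq_of_mem_invariants (hp2 : p ≠ 2) (h123 : gam p M 1 2 3 ≠ 0)
    {w : MvPolynomial (Fin 3) F} (hw : w ∈ invariants p M) {s : ℕ} (hs : w.IsHomogeneous s)
    {w₁ w₂ : MvPolynomial (Fin 3) F} (hw12 : w = X 0 * w₁ + w₂) (hdeg : degreeOf 2 w₂ < p ^ 3) :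
    ∃ α w', w = C α * X 1 ^ s + X 0 * w' := by
  have h1 : modX w = modX w₂ := by rw [hw12, map_add, map_mul, modX_X0, zero_mul, zero_add]
  have h2 := modX_eq_C_of_mem_invariants hp2 h123 hw
    (by rw [h1]; exact (natDegree_modX_le _).trans_lt hdeg)
  set α := (modX w).eval 0 with hα
  obtain ⟨w', hw'⟩ := X_dvd_of_modX_eq_zero (u := w - C α * X 1 ^ s) (s := s)
    (hs.sub (by simpa using (isHomogeneous_C (Fin 3) α).mul (isHomogeneous_X_pow 1 s)))
    (by rw [map_sub, map_mul, map_pow, modX_X1, one_pow, mul_one, ← algebraMap_eq,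
      AlgHom.commutes, Polynomial.algebraMap_eq, h2, sub_self])
  exact ⟨α, w', by rw [← hw']; ring⟩

end Reduction

/-! ### Orbit products -/

section Orbit

variable {F : Type*} [Field F] {p : ℕ} [Fact p.Prime] [CharP F p] {M : Matrix (Fin 2) (Fin 3) F}

theorem act_act (g h : Multiplicative (Fin 3 → ZMod p)) (f : MvPolynomial (Fin 3) F) :
    act (rep p M g) (act (rep p M h) f) = act (rep p M (g * h)) f := by
  have hX : ∀ i, act (rep p M g) (act (rep p M h) (X i)) = act (rep p M (g * h)) (X i) := by
    rw [Fin.forall_fin_succ, Fin.forall_fin_two]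
    refine ⟨?_, ?_, ?_⟩
    · rw [act_x, act_x, act_x]
    · change act _ (act _ (X 1)) = act _ (X 1)
      rw [act_y p M (g * h), shift_mul]
      simp only [act_y, map_add, map_mul, act_C, act_x]
      ring
    · change act _ (act _ (X 2)) = act _ (X 2)
      rw [act_z p M (g * h), shift_mul, shift_mul]
      simp only [act_z, act_y, map_add, map_mul, map_pow, map_ofNat, act_C, act_x]
      ring
  have : (act (rep p M g)).comp (act (rep p M h)) = act (rep p M (g * h)) :=
    MvPolynomial.algHom_ext hX
  exact DFunLike.congr_fun this f

theorem act_one (f : MvPolynomial (Fin 3) F) : act (rep p M 1) f = f := by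
  have hs : ∀ i, shift p M i 1 = 0 := fun i => by simp [shift]
  have hX : ∀ i, act (rep p M 1) (X i) = X i := by
    rw [Fin.forall_fin_succ, Fin.forall_fin_two]
    refine ⟨act_x p M 1, (act_y p M 1).trans ?_, (act_z p M 1).trans ?_⟩ <;> simp [hs]
  have : act (rep p M 1) = AlgHom.id F _ := MvPolynomial.algHom_ext hX
  exact DFunLike.congr_fun this f

theorem act_injective (g : Multiplicative (Fin 3 → ZMod p)) :
    Function.Injective (act (rep p M g)) := by
  intro u v huv
  have := congrArg (act (rep p M g⁻¹)) huv
  rwa [act_act, act_act, inv_mul_cancel, act_one, act_one] at this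

theorem orbitProd_mem_invariants (f : MvPolynomial (Fin 3) F) :
    orbitProd p M f ∈ invariants p M := by
  classical
  refine (mem_invariants p M _).2 fun g => ?_
  rw [orbitProd, map_prod]
  set O := Finset.univ.image fun g => act (rep p M g) f with hO
  have himg : O.image (act (rep p M g)) = O := by
    apply Finset.eq_of_subset_of_card_le
    · intro u hu
      obtain ⟨v, hv, rfl⟩ := Finset.mem_image.1 hu
      obtain ⟨h, -, rfl⟩ := Finset.mem_image.1 hv
      rw [act_act]
      exact Finset.mem_image_of_mem _ (Finset.mem_univ _)
    · rw [Finset.card_image_of_injective _ (act_injective g)]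
  conv_rhs => rw [← himg]
  rw [Finset.prod_image ((act_injective g).injOn)]

theorem isHomogeneous_act_X (i : Fin 3) (g : Multiplicative (Fin 3 → ZMod p)) :
    (act (rep p M g) (X i)).IsHomogeneous 1 := by
  rw [act, aeval_X]
  refine IsHomogeneous.sum _ _ _ fun j _ => ?_
  exact (isHomogeneous_X F j).C_mul _

open Classical in
theorem card_orbit_z (hp2 : p ≠ 2) (h123 : gam p M 1 2 3 ≠ 0) :
    (Finset.univ.image fun g => act (rep p M g) (X 2 : MvPolynomial (Fin 3) F)).card = p ^ 3 := by
  rw [Finset.card_image_of_injective, Finset.card_univ, card_group]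
  intro g h hgh
  have h2 : (2 : F) ≠ 0 := by
    have : ((2 : ℕ) : F) ≠ 0 := by
      rw [Ne, CharP.cast_eq_zero_iff F p]
      exact fun h => hp2 ((Nat.prime_dvd_prime_iff_eq Fact.out Nat.prime_two).1 h)
    exact_mod_cast this
  simp only [act_z] at hgh
  have h0 := congrArg (coeff (Finsupp.single 1 1)) hgh
  have h1 := congrArg (coeff (Finsupp.single 0 1)) hgh
  simp only [coeff_add, coeff_C_mul, coeff_X, Finsupp.single_left_inj one_ne_zero] at h0 h1
  simp at h0 h1
  have h3 : shift p M 0 g = shift p M 0 h := h0.resolve_right h2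
  rw [h3] at h1
  exact shift_pair_injective h123 (Prod.ext h3 (add_left_cancel h1))

theorem isHomogeneous_orbitProd_z (hp2 : p ≠ 2) (h123 : gam p M 1 2 3 ≠ 0) :
    (orbitProd p M (X 2)).IsHomogeneous (p ^ 3) := by
  classical
  have h : (orbitProd p M (X 2)).IsHomogeneous
      (∑ _h ∈ Finset.univ.image fun g => act (rep p M g) (X 2 : MvPolynomial (Fin 3) F), 1) := by
    refine IsHomogeneous.prod _ _ _ fun u hu => ?_
    obtain ⟨g, -, rfl⟩ := Finset.mem_image.1 hu
    exact isHomogeneous_act_X 2 g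
  rwa [Finset.sum_const, smul_eq_mul, mul_one, card_orbit_z hp2 h123] at h

theorem degree_act_z (g : Multiplicative (Fin 3 → ZMod p)) :
    act (rep p M g) (X 2) ≠ 0 ∧
      grevlex.degree (act (rep p M g) (X 2)) = Finsupp.single 2 1 := by
  have hc : coeff (Finsupp.single 2 1) (act (rep p M g) (X 2)) ≠ 0 := by
    rw [act_z]
    simp only [coeff_add, coeff_C_mul, coeff_X, Finsupp.single_left_inj one_ne_zero]
    simp
  exact ⟨fun h => hc (by rw [h, coeff_zero]),
    degree_eq_of_isHomogeneous_z (isHomogeneous_act_X 2 g) hc⟩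

theorem degree_orbitProd_z (hp2 : p ≠ 2) (h123 : gam p M 1 2 3 ≠ 0) :
    orbitProd p M (X 2) ≠ 0 ∧
      grevlex.degree (orbitProd p M (X 2)) = Finsupp.single 2 (p ^ 3) := by
  classical
  have hne : ∀ u ∈ Finset.univ.image fun g => act (rep p M g) (X 2 : MvPolynomial (Fin 3) F),
      u ≠ 0 ∧ grevlex.degree u = Finsupp.single 2 1 := by
    intro u hu
    obtain ⟨g, -, rfl⟩ := Finset.mem_image.1 hu
    exact degree_act_z g
  refine ⟨Finset.prod_ne_zero_iff.2 fun u hu => (hne u hu).1, ?_⟩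
  rw [orbitProd, MonomialOrder.degree_prod fun u hu => (hne u hu).1,
    Finset.sum_congr rfl fun u hu => (hne u hu).2, Finset.sum_const, card_orbit_z hp2 h123,
    Finsupp.smul_single, smul_eq_mul, mul_one]

open Classical in
theorem card_orbit_y (h123 : gam p M 1 2 3 ≠ 0) (h135 : gam p M 1 3 5 = 0) :
    (Finset.univ.image fun g => act (rep p M g) (X 1 : MvPolynomial (Fin 3) F)).card = p ^ 2 := by
  have h : (Finset.univ.image fun g => act (rep p M g) (X 1 : MvPolynomial (Fin 3) F))
      = (shiftValues p M).image fun a => X 1 + C a * X 0 := by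
    rw [shiftValues, Finset.image_image]
    refine Finset.image_congr fun g _ => act_y p M g
  rw [h, Finset.card_image_of_injective]
  · exact le_antisymm (card_shiftValues_le h123 h135) (le_card_shiftValues h123 h135)
  · intro a b hab
    exact C_injective _ _ (mul_right_cancel₀ (X_ne_zero 0) (add_left_cancel hab))

theorem hasYLead_orbitProd_y (h123 : gam p M 1 2 3 ≠ 0) (h135 : gam p M 1 3 5 = 0) :
    HasYLead (p ^ 2) 1 (orbitProd p M (X 1)) := by
  classical
  have key : ∀ s : Finset (MvPolynomial (Fin 3) F), (∀ u ∈ s, HasYLead 1 1 u) →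
      HasYLead s.card 1 (∏ u ∈ s, u) := by
    intro s
    induction s using Finset.induction_on with
    | empty =>
      intro _
      exact ⟨by simpa using isHomogeneous_one _ _, one_ne_zero, 0, by simp⟩
    | insert u s hu ih =>
      intro h
      rw [Finset.prod_insert hu, Finset.card_insert_of_notMem hu, add_comm]
      have := (h u (Finset.mem_insert_self _ _)).mul
        (ih fun v hv => h v (Finset.mem_insert_of_mem hv))
      rwa [one_mul] at this
  rw [← card_orbit_y h123 h135]
  refine key _ fun u hu => ?_
  obtain ⟨g, -, rfl⟩ := Finset.mem_image.1 hu
  exact ⟨isHomogeneous_act_X 1 g, one_ne_zero, C (shift p M 0 g), by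
    rw [act_y, C_1, pow_one]; ring⟩

end Orbit

/-! ### The two cases as instances of the general argument -/

section Seeds

variable {F : Type*} [Field F] {p : ℕ} [Fact p.Prime] [CharP F p] {M : Matrix (Fin 2) (Fin 3) F}

theorem mem_invariants_of_X_mul {h : MvPolynomial (Fin 3) F} (hh : X 0 * h ∈ invariants p M) :
    h ∈ invariants p M := by
  refine (mem_invariants p M h).2 fun g => ?_
  have := (mem_invariants p M _).1 hh g
  rw [map_mul, act_x] at this
  exact mul_left_cancel₀ (X_ne_zero 0) this

theorem mem_invariants_of_X_pow_mul (k : ℕ) {h : MvPolynomial (Fin 3) F}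
    (hh : X 0 ^ k * h ∈ invariants p M) : h ∈ invariants p M := by
  induction k with
  | zero => simpa using hh
  | succ k ih => exact ih (mem_invariants_of_X_mul (by rwa [← mul_assoc, ← pow_succ']))

theorem odd_of_ne_two (hp2 : p ≠ 2) : p % 2 = 1 ∧ 2 < p := by
  have h := (Fact.out : p.Prime).eq_two_or_odd.resolve_left hp2
  have := one_lt_prime p
  omega

theorem X_pow_mul_f3_eq (hp2 : p ≠ 2) :
    X 0 ^ (p ^ 2 - 2) * f3 p M = C ((-2)⁻¹) * f3Numerator p M := by
  obtain ⟨hodd, hp⟩ := odd_of_ne_two hp2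
  have h := (exists_f3_eq (M := M) hodd hp).1
  have c4 : (C 2 : MvPolynomial (Fin 3) F) = 2 := map_ofNat C 2
  have hc : (C ((-2)⁻¹) : MvPolynomial (Fin 3) F) * (-2) = 1 := by
    rw [← c4, ← C_neg, ← C_mul, inv_mul_cancel₀ (neg_ne_zero.2 (two_ne_zero_of_odd hp)), C_1]
  linear_combination -C ((-2)⁻¹) * h - X 0 ^ (p ^ 2 - 2) * f3 p M * hc

theorem f3Numerator_mem_invariants : f3Numerator p M ∈ invariants p M := by
  have hC : ∀ c, C c ∈ invariants p M := (invariants p M).algebraMap_mem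
  refine add_mem (add_mem ?_ ?_) ?_
  · exact pow_mem (f1_mem_invariants p M) p
  · exact mul_mem (hC _) (pow_mem (f2_mem_invariants p M) 2)
  · exact mul_mem (mul_mem (hC _) (pow_mem (x_mem_invariants p M) _))
      (pow_mem (f1_mem_invariants p M) _)

theorem f3_mem_invariants (hp2 : p ≠ 2) : f3 p M ∈ invariants p M := by
  apply mem_invariants_of_X_pow_mul (p ^ 2 - 2)
  rw [X_pow_mul_f3_eq hp2]
  exact mul_mem ((invariants p M).algebraMap_mem _) f3Numerator_mem_invariants

theorem isHomogeneous_f3 (hp2 : p ≠ 2) : (f3 p M).IsHomogeneous (p ^ 2 + 2) := by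
  obtain ⟨hodd, hp⟩ := odd_of_ne_two hp2
  apply isHomogeneous_of_X_pow_mul (i := 0) (k := p ^ 2 - 2)
  rw [X_pow_mul_f3_eq hp2]
  have : 2 < p ^ 2 := by nlinarith
  exact isHomogeneous_of_eq ((isHomogeneous_f3Numerator (by omega) hodd).C_mul _) (by omega)

/-- This is `(*)` solved for `f2²`: the first closure condition for the box in `g₂, g₃`. -/
theorem f2_sq_eq (hp2 : p ≠ 2) (h123 : gam p M 1 2 3 ≠ 0) :
    ∃ b₀ ∈ Algebra.adjoin F {X 0, f1 p M}, ∃ b₁ ∈ Algebra.adjoin F {X 0, f1 p M},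
      f2 p M ^ 2 = b₀ + b₁ * f3 p M := by
  obtain ⟨hodd, hp⟩ := odd_of_ne_two hp2
  set B := Algebra.adjoin F ({X 0, f1 p M} : Set (MvPolynomial (Fin 3) F)) with hB
  have hx : X 0 ∈ B := Algebra.subset_adjoin (by simp)
  have h1 : f1 p M ∈ B := Algebra.subset_adjoin (by simp)
  have hC : ∀ c, C c ∈ B := B.algebraMap_mem
  have h := (exists_f3_eq (M := M) hodd hp).1
  have hi : (C ((gam p M 1 2 3 ^ (p - 2))⁻¹) : MvPolynomial (Fin 3) F)
      * C (gam p M 1 2 3 ^ (p - 2)) = 1 := by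
    rw [← C_mul, inv_mul_cancel₀ (pow_ne_zero _ h123), C_1]
  refine ⟨C (-(gam p M 1 2 3 ^ (p - 2))⁻¹) * (f1 p M ^ p
      + C (2 * (-gam p M 1 2 3) ^ ((p - 3) / 2) * gam p M 1 2 5) * X 0 ^ (p ^ 2 - p)
        * f1 p M ^ ((p + 1) / 2)), ?_,
    C (-(gam p M 1 2 3 ^ (p - 2))⁻¹ * 2) * X 0 ^ (p ^ 2 - 2), ?_, ?_⟩
  · exact mul_mem (hC _) (add_mem (pow_mem h1 p)
      (mul_mem (mul_mem (hC _) (pow_mem hx _)) (pow_mem h1 _)))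
  · exact mul_mem (hC _) (pow_mem hx _)
  · have c4 : (C 2 : MvPolynomial (Fin 3) F) = 2 := map_ofNat C 2
    rw [f3Numerator] at h
    rw [C_mul (a := -(gam p M 1 2 3 ^ (p - 2))⁻¹), c4, C_neg]
    linear_combination C ((gam p M 1 2 3 ^ (p - 2))⁻¹) * h - f2 p M ^ 2 * hi

theorem isSeed_generic (hp2 : p ≠ 2) (h123 : gam p M 1 2 3 ≠ 0) (h135 : gam p M 1 3 5 ≠ 0) :
    IsSeed p 2 (invariants p M) (f1 p M) (f2 p M) (f3 p M) (-gam p M 1 2 3) (gam p M 1 2 3)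
      (gam p M 1 2 3 ^ (p - 1) * gam p M 1 3 5) ((-2)⁻¹ * gam p M 1 2 3 ^ p) := by
  obtain ⟨hodd, hp⟩ := odd_of_ne_two hp2
  obtain ⟨-, t, ht, hf3⟩ := exists_f3_eq (M := M) hodd hp
  have h2 : (2 : F) ≠ 0 := two_ne_zero_of_odd hp
  have hpp : 2 < p ^ 2 := by nlinarith
  exact
  { x_mem := x_mem_invariants p M
    saturated := fun _ => mem_invariants_of_X_mul
    localized := fun _ => exists_pow_mul_mem_of_mem_invariants h123
    mem₁ := f1_mem_invariants p M
    mem₂ := f2_mem_invariants p M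
    mem₃ := f3_mem_invariants hp2
    lead₁ := hasYLead_f1 (by omega) h123
    lead₂ := hasYLead_f2 hp h123
    lead₃ := by
      refine ⟨isHomogeneous_f3 hp2, mul_ne_zero (pow_ne_zero _ h123) h135,
        C (gam p M 1 2 3 ^ (p - 1)) * (-C (gam p M 1 3 5) * X 1 ^ p ^ 2 * X 2
          + C (gam p M 2 3 5) * X 1 ^ (p ^ 2 + 1))
          + X 0 * (C ((-2)⁻¹ * gam p M 1 2 3 ^ p) * X 2 ^ p ^ 2 + t), ?_⟩
      rw [hf3, delta, C_mul (a := gam p M 1 2 3 ^ (p - 1))]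
      ring
    degreeOf₁ := degreeOf_f1 (by omega)
    degreeOf₂ := degreeOf_f2
    degreeOf₃ := by
      have : f3 p M - C ((-2)⁻¹ * gam p M 1 2 3 ^ p) * X 0 ^ 2 * X 2 ^ p ^ 2
          = C (gam p M 1 2 3 ^ (p - 1)) * (C (gam p M 1 3 5) * X 1 ^ p ^ 2 * delta
            + C (gam p M 2 3 5) * X 0 ^ 1 * X 1 ^ (p ^ 2 + 1)) + X 0 ^ 2 * t := by
        rw [hf3]
        ring
      rw [this]
      refine degreeOf_add_lt (degreeOf_z_C_mul _ _ (degreeOf_add_lt ?_ ?_)) ?_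
      · exact (degreeOf_z_C_mul_X_pow_mul (by decide) _ _ _).trans_lt
          (degreeOf_z_delta.trans_lt (by omega))
      · rw [degreeOf_z_mul_X_pow (by decide), degreeOf_z_mul_X_pow (by decide), degreeOf_C]
        omega
      · rwa [degreeOf_X_pow_mul (by decide)]
    c_ne_zero := mul_ne_zero (inv_ne_zero (neg_ne_zero.2 h2)) (pow_ne_zero _ h123)
    relation := f2_sq_eq hp2 h123
    reduction := fun w hw s hs w₁ w₂ h12 hdeg => exists_eq_of_mem_invariants hp2 h123 hw hs h12 hdeg }

theorem exists_f3DivX_eq (hp2 : p ≠ 2) (h135 : gam p M 1 3 5 = 0) :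
    X 0 * f3DivX p M = f3 p M ∧ ∃ t, degreeOf 2 t < p ^ 2 ∧ f3DivX p M =
      C (gam p M 1 2 3 ^ (p - 1) * gam p M 2 3 5) * X 1 ^ (p ^ 2 + 1)
      + X 0 * (C ((-2)⁻¹ * gam p M 1 2 3 ^ p) * X 2 ^ p ^ 2 + t) := by
  obtain ⟨hodd, hp⟩ := odd_of_ne_two hp2
  obtain ⟨-, t, ht, hf3⟩ := exists_f3_eq (M := M) hodd hp
  have h : f3 p M = X 0 * (C (gam p M 1 2 3 ^ (p - 1) * gam p M 2 3 5) * X 1 ^ (p ^ 2 + 1)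
      + X 0 * (C ((-2)⁻¹ * gam p M 1 2 3 ^ p) * X 2 ^ p ^ 2 + t)) := by
    rw [hf3, h135, C_0, C_mul (a := gam p M 1 2 3 ^ (p - 1))]
    ring
  have h' : f3DivX p M = C (gam p M 1 2 3 ^ (p - 1) * gam p M 2 3 5) * X 1 ^ (p ^ 2 + 1)
      + X 0 * (C ((-2)⁻¹ * gam p M 1 2 3 ^ p) * X 2 ^ p ^ 2 + t) := by
    rw [f3DivX, h, X_mul_divMonomial]
  exact ⟨by rw [h', h], t, ht, h'⟩

theorem isSeed_special (hp2 : p ≠ 2) (h123 : gam p M 1 2 3 ≠ 0) (h135 : gam p M 1 3 5 = 0) :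
    IsSeed p 1 (invariants p M) (f1 p M) (f2 p M) (f3DivX p M) (-gam p M 1 2 3) (gam p M 1 2 3)
      (gam p M 1 2 3 ^ (p - 1) * gam p M 2 3 5) ((-2)⁻¹ * gam p M 1 2 3 ^ p) := by
  obtain ⟨hodd, hp⟩ := odd_of_ne_two hp2
  obtain ⟨hdiv, t, ht, hf3⟩ := exists_f3DivX_eq (M := M) hp2 h135
  have h2 : (2 : F) ≠ 0 := two_ne_zero_of_odd hp
  have hpp : 2 < p ^ 2 := by nlinarith
  exact
  { x_mem := x_mem_invariants p M
    saturated := fun _ => mem_invariants_of_X_mul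
    localized := fun _ => exists_pow_mul_mem_of_mem_invariants h123
    mem₁ := f1_mem_invariants p M
    mem₂ := f2_mem_invariants p M
    mem₃ := mem_invariants_of_X_mul (by rw [hdiv]; exact f3_mem_invariants hp2)
    lead₁ := hasYLead_f1 (by omega) h123
    lead₂ := hasYLead_f2 hp h123
    lead₃ := by
      refine ⟨?_, mul_ne_zero (pow_ne_zero _ h123) (gam_235_ne_zero h123 h135), _, hf3⟩
      apply isHomogeneous_of_X_pow_mul (i := 0) (k := 1)
      rw [pow_one, hdiv]
      exact isHomogeneous_f3 hp2
    degreeOf₁ := degreeOf_f1 (by omega)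
    degreeOf₂ := degreeOf_f2
    degreeOf₃ := by
      have : f3DivX p M - C ((-2)⁻¹ * gam p M 1 2 3 ^ p) * X 0 ^ 1 * X 2 ^ p ^ 2
          = C (gam p M 1 2 3 ^ (p - 1) * gam p M 2 3 5) * X 1 ^ (p ^ 2 + 1) + X 0 ^ 1 * t := by
        rw [hf3]
        ring
      rw [this]
      refine degreeOf_add_lt ?_ ?_
      · rw [degreeOf_z_mul_X_pow (by decide), degreeOf_C]
        omega
      · rwa [degreeOf_X_pow_mul (by decide)]
    c_ne_zero := mul_ne_zero (inv_ne_zero (neg_ne_zero.2 h2)) (pow_ne_zero _ h123)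
    relation := by
      obtain ⟨b₀, hb₀, b₁, hb₁, h⟩ := f2_sq_eq hp2 h123
      refine ⟨b₀, hb₀, b₁ * X 0, mul_mem hb₁ (Algebra.subset_adjoin (by simp)), ?_⟩
      rw [h, ← hdiv]
      ring
    reduction := fun w hw s hs w₁ w₂ h12 hdeg => exists_eq_of_mem_invariants hp2 h123 hw hs h12 hdeg }

/-- The lead monomials of `A` are known, so any invariants with the right ones will do: `h` is `f2`
or `N_G(y)`, and `N_G(z)` takes the place of `v`. -/
theorem IsSeed.isLeadFamily {q : ℕ} (hp2 : p ≠ 2) (hq : q = 1 ∨ q = 2)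
    (h123 : gam p M 1 2 3 ≠ 0) {g₁ g₂ g₃ h : MvPolynomial (Fin 3) F} {κ₁ κ₂ κ₃ c μ : F}
    (hS : IsSeed p q (invariants p M) g₁ g₂ g₃ κ₁ κ₂ κ₃ c) (hh : h ∈ invariants p M)
    (hlead : HasYLead (p ^ 2) μ h) :
    IsLeadFamily p q (invariants p M) ![X 0, g₁, h, g₃, orbitProd p M (X 2)] := by
  obtain ⟨hN0, hNdeg⟩ := degree_orbitProd_z (M := M) hp2 h123
  have hne : ∀ i, (![X 0, g₁, h, g₃, orbitProd p M (X 2)] : Fin 5 → _) i ≠ 0 := by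
    intro i
    fin_cases i
    exacts [X_ne_zero 0, hS.lead₁.poly_ne_zero, hlead.poly_ne_zero, hS.lead₃.poly_ne_zero, hN0]
  have hdeg : ∀ i, grevlex.degree ((![X 0, g₁, h, g₃, orbitProd p M (X 2)] : Fin 5 → _) i)
      = leadExp p q i := by
    intro i
    fin_cases i
    exacts [MonomialOrder.degree_X, hS.lead₁.degree_eq, hlead.degree_eq, hS.lead₃.degree_eq, hNdeg]
  refine ⟨?_, hne, ?_, hdeg, ?_⟩
  · intro i
    fin_cases i
    exacts [hS.x_mem, hS.mem₁, hh, hS.mem₃, orbitProd_mem_invariants _]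
  · intro i
    fin_cases i
    exacts [isHomogeneous_X F 0, hS.lead₁.homog, hlead.homog, hS.lead₃.homog,
      isHomogeneous_orbitProd_z hp2 h123]
  · intro f hf hf0
    obtain ⟨E, hE⟩ := hS.exists_degree_eq Fact.out hp2 hq hf hf0
    exact ⟨E, by rw [hE, degree_gpow_of_leadExp hne hdeg]⟩

theorem isLiftedBinomial_relation (hp2 : p ≠ 2) (a b : F) :
    IsLiftedBinomial p 2 (2 * p ^ 2) (Finsupp.single 2 2) (Finsupp.single 1 p) a 1
      (X 1 ^ p + C a * X 2 ^ 2 + C b * X 0 ^ (p ^ 2 - p) * X 1 ^ ((p + 1) / 2)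
        + 2 * X 0 ^ (p ^ 2 - 2) * X 3) := by
  classical
  obtain ⟨hodd, hp⟩ := odd_of_ne_two hp2
  have hpp : p < p ^ 2 := by nlinarith
  refine ⟨monomial (Finsupp.single 0 (p ^ 2 - p) + Finsupp.single 1 ((p + 1) / 2)) (-b)
    + monomial (Finsupp.single 0 (p ^ 2 - 2) + Finsupp.single 3 1) (-2), ?_, ?_⟩
  · have c4 : (C 2 : MvPolynomial (Fin 5) F) = 2 := map_ofNat C 2
    have e : ∀ (I J : Fin 5 →₀ ℕ) (u : F), monomial (I + J) u = C u * monomial I 1 * monomial J 1 := by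
      intro I J u
      rw [C_mul_monomial, monomial_mul, mul_one, mul_one]
    have e' : ∀ (I : Fin 5 →₀ ℕ) (u : F), monomial I u = C u * monomial I 1 := by
      intro I u
      rw [C_mul_monomial, mul_one]
    rw [e, e, e' _ a]
    simp only [← X_pow_eq_monomial, C_neg, c4, pow_one]
    ring
  · intro E hE
    rcases Finset.mem_union.1 (support_add hE) with h | h
    · rw [Finset.mem_singleton.1 (support_monomial_subset h)]
      have : 2 * p * ((p + 1) / 2) = p ^ 2 + p := by
        have h2 : 2 * ((p + 1) / 2) = p + 1 := by omega
        calc 2 * p * ((p + 1) / 2) = p * (2 * ((p + 1) / 2)) := by ring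
          _ = p ^ 2 + p := by rw [h2]; ring
      constructor
      · simp
        omega
      · simp [tailWeight]
        omega
    · rw [Finset.mem_singleton.1 (support_monomial_subset h)]
      constructor
      · simp
        omega
      · simp [tailWeight]
        omega

theorem aeval_relation (g : Fin 5 → MvPolynomial (Fin 3) F) (a b : F) :
    aeval g (X 1 ^ p + C a * X 2 ^ 2 + C b * X 0 ^ (p ^ 2 - p) * X 1 ^ ((p + 1) / 2)
        + 2 * X 0 ^ (p ^ 2 - 2) * X 3 : MvPolynomial (Fin 5) F)
      = g 1 ^ p + C a * g 2 ^ 2 + C b * g 0 ^ (p ^ 2 - p) * g 1 ^ ((p + 1) / 2)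
        + 2 * g 0 ^ (p ^ 2 - 2) * g 3 := by
  simp only [map_add, map_mul, map_pow, aeval_X, map_ofNat, aeval_C, algebraMap_eq]

theorem teteATetePoly_eq {n : ℕ} (g : Fin n → MvPolynomial (Fin 3) F) (I J : Fin n →₀ ℕ) :
    teteATetePoly grevlex g I J = monomial I 1 + monomial J
      (-(grevlex.leadingCoeff (gpow g I) / grevlex.leadingCoeff (gpow g J))) := by
  rw [teteATetePoly, sub_eq_add_neg, map_neg]

theorem IsLiftedBinomial.swap {q W : ℕ} {I J : Fin 5 →₀ ℕ} {a b : F} {R : MvPolynomial (Fin 5) F}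
    (h : IsLiftedBinomial p q W I J a b R) : IsLiftedBinomial p q W J I b a R := by
  obtain ⟨Q, hR, hQ⟩ := h
  exact ⟨Q, by rw [hR, add_comm (monomial I a)], hQ⟩

theorem IsLeadFamily.isTeteATete {q : ℕ} {A : Subalgebra F (MvPolynomial (Fin 3) F)}
    {g : Fin 5 → MvPolynomial (Fin 3) F} (hg : IsLeadFamily p q A g) {i j : Fin 5} (hij : i ≠ j)
    {a b : ℕ} (hi0 : i ≠ 0) (hi4 : i ≠ 4) (hj0 : j ≠ 0) (hj4 : j ≠ 4)
    (h : tailWeight p q (Finsupp.single i a) = tailWeight p q (Finsupp.single j b)) :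
    IsTeteATete grevlex g (Finsupp.single i a) (Finsupp.single j b) := by
  constructor
  · rw [degree_gpow_of_leadExp hg.ne_zero hg.deg, degree_gpow_of_leadExp hg.ne_zero hg.deg]
    have e : ∀ k : Fin 5, ∀ c, k ≠ 0 → k ≠ 4 → (Finsupp.single k c : Fin 5 →₀ ℕ) 0 = 0 ∧
        (Finsupp.single k c : Fin 5 →₀ ℕ) 4 = 0 := fun k c h0 h4 =>
      ⟨Finsupp.single_eq_of_ne h0.symm, Finsupp.single_eq_of_ne h4.symm⟩
    rw [tailWeight, tailWeight, (e i a hi0 hi4).2, (e j b hj0 hj4).2] at h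
    rw [(e i a hi0 hi4).1, (e j b hj0 hj4).1, (e i a hi0 hi4).2, (e j b hj0 hj4).2]
    simp only [mul_zero, add_zero] at h
    rw [h]
  · rw [Finset.disjoint_left]
    intro k hk hk'
    exact hij ((Finset.mem_singleton.1 (Finsupp.support_single_subset hk)).symm.trans
      (Finset.mem_singleton.1 (Finsupp.support_single_subset hk')))

end Seeds

end ElemAbelianInv

end

/-! ### Assembly of the two cases -/

open MvPolynomial ElemAbelianInv in
theorem mainTheorem11 (p : ℕ) [Fact p.Prime] (hp : p ≠ 2) (F : Type*) [Field F] [CharP F p]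
    (M : Matrix (Fin 2) (Fin 3) F) (h123 : gam p M 1 2 3 ≠ 0) :
    -- the division that defines `f₃` is exact
    f1 p M ^ p + C (gam p M 1 2 3 ^ (p - 2)) * f2 p M ^ 2
        + C (2 * (-gam p M 1 2 3) ^ ((p - 3) / 2) * gam p M 1 2 5) * X 0 ^ (p ^ 2 - p)
          * f1 p M ^ ((p + 1) / 2)
        + 2 * X 0 ^ (p ^ 2 - 2) * f3 p M = 0 ∧
    -- the case `γ₁₃₅ ≠ 0`
    (gam p M 1 3 5 ≠ 0 →
      IsSagbiBasis grevlex (Set.range (gensGeneric p M)) (invariants p M) ∧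
      (∃ R : MvPolynomial (Fin 5) F, IsSubductionRelation grevlex (gensGeneric p M)
        (X 3 ^ p + C (gam p M 1 3 5 ^ p * gam p M 1 2 3 ^ (p ^ 2 - 2 * p - 1)) * X 1 * X 2 ^ p)
        R) ∧
      ∀ R : MvPolynomial (Fin 5) F, IsSubductionRelation grevlex (gensGeneric p M)
        (X 3 ^ p + C (gam p M 1 3 5 ^ p * gam p M 1 2 3 ^ (p ^ 2 - 2 * p - 1)) * X 1 * X 2 ^ p)
        R →
        IsCompleteIntersectionOn (invariants p M) (gensGeneric p M)
          [X 1 ^ p + C (gam p M 1 2 3 ^ (p - 2)) * X 2 ^ 2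
              + C (2 * (-gam p M 1 2 3) ^ ((p - 3) / 2) * gam p M 1 2 5) * X 0 ^ (p ^ 2 - p)
                * X 1 ^ ((p + 1) / 2)
              + 2 * X 0 ^ (p ^ 2 - 2) * X 3, R]) ∧
    -- the case `γ₁₃₅ = 0`
    (gam p M 1 3 5 = 0 →
      X 0 * f3DivX p M = f3 p M ∧
      IsSagbiBasis grevlex (Set.range (gensSpecial p M)) (invariants p M) ∧
      IsTeteATete grevlex (gensSpecial p M)
        (Finsupp.single 3 p) (Finsupp.single 1 ((p ^ 2 + 1) / 2)) ∧
      IsTeteATete grevlex (gensSpecial p M) (Finsupp.single 1 p) (Finsupp.single 2 2) ∧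
      (∃ R : MvPolynomial (Fin 5) F, IsSubductionRelation grevlex (gensSpecial p M)
        (teteATetePoly grevlex (gensSpecial p M)
          (Finsupp.single 3 p) (Finsupp.single 1 ((p ^ 2 + 1) / 2))) R) ∧
      (∃ R' : MvPolynomial (Fin 5) F, IsSubductionRelation grevlex (gensSpecial p M)
        (teteATetePoly grevlex (gensSpecial p M) (Finsupp.single 1 p) (Finsupp.single 2 2)) R') ∧
      ∀ R R' : MvPolynomial (Fin 5) F,
        IsSubductionRelation grevlex (gensSpecial p M)
          (teteATetePoly grevlex (gensSpecial p M)
            (Finsupp.single 3 p) (Finsupp.single 1 ((p ^ 2 + 1) / 2))) R →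
        IsSubductionRelation grevlex (gensSpecial p M)
          (teteATetePoly grevlex (gensSpecial p M) (Finsupp.single 1 p) (Finsupp.single 2 2)) R' →
        IsCompleteIntersectionOn (invariants p M) (gensSpecial p M) [R, R']) := by
  have hpp : p.Prime := Fact.out
  obtain ⟨hodd, hp3⟩ := odd_of_ne_two hp
  have hrel := (exists_f3_eq (M := M) hodd hp3).1
  rw [f3Numerator] at hrel
  refine ⟨hrel, fun h135 => ?_, fun h135 => ?_⟩
  · have hS := isSeed_generic hp h123 h135
    have hg : IsLeadFamily p 2 (invariants p M) (gensGeneric p M) :=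
      hS.isLeadFamily hp (.inr rfl) h123 hS.mem₂ hS.lead₂
    refine ⟨isSagbiBasis_of_degree hg.ne_zero _ hg.mem hg.lead,
      hg.exists_isSubductionRelation _, fun R hR => ?_⟩
    have hT : (X 3 ^ p + C (gam p M 1 3 5 ^ p * gam p M 1 2 3 ^ (p ^ 2 - 2 * p - 1)) * X 1 * X 2 ^ p :
        MvPolynomial (Fin 5) F) = monomial (Finsupp.single 3 p) 1
          + monomial (Finsupp.single 1 1 + Finsupp.single 2 p)
            (gam p M 1 3 5 ^ p * gam p M 1 2 3 ^ (p ^ 2 - 2 * p - 1)) := by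
      have e : ∀ u : F, monomial (Finsupp.single 1 1 + Finsupp.single 2 p : Fin 5 →₀ ℕ) u
          = C u * monomial (Finsupp.single 1 1) 1 * monomial (Finsupp.single 2 p) 1 := by
        intro u
        rw [C_mul_monomial, monomial_mul, mul_one, mul_one]
      rw [e]
      simp only [← X_pow_eq_monomial, pow_one]
    have hR0 := hR.aeval_eq_zero
    rw [hT] at hR
    have hJ : tailWeight p 2 (Finsupp.single 1 1 + Finsupp.single 2 p) = p * (p ^ 2 + 2) := by
      simp [tailWeight]
      ring
    have hlift := hg.isLiftedBinomial (W := p * (p ^ 2 + 2)) (by simp [tailWeight]; ring) hJ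
      (by simp) (by simp) (by simp) (by simp) (by positivity) (by
        rw [gpow_add, gpow_single, gpow_single, gpow_single]
        have h1 : grevlex.leadingCoeff (gensGeneric p M 1) = -gam p M 1 2 3 :=
          hS.lead₁.leadingCoeff_eq
        have h2 : grevlex.leadingCoeff (gensGeneric p M 2) = gam p M 1 2 3 :=
          hS.lead₂.leadingCoeff_eq
        have h3 : grevlex.leadingCoeff (gensGeneric p M 3)
            = gam p M 1 2 3 ^ (p - 1) * gam p M 1 3 5 := hS.lead₃.leadingCoeff_eq
        rw [MonomialOrder.leadingCoeff_mul, MonomialOrder.leadingCoeff_pow,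
          MonomialOrder.leadingCoeff_pow, MonomialOrder.leadingCoeff_pow, h1, h2, h3, mul_pow,
          ← pow_mul]
        -- `f3^p` has lead coefficient `γ₁₂₃^((p-1)p) γ₁₃₅^p`, and `f1 f2^p` has `-γ₁₂₃^(1+p)`; the
        -- exponent `p² - 2p - 1` is the difference.
        have h4 : (p - 1) * p = (p ^ 2 - 2 * p - 1) + 1 + p := by
          have h5 : 3 * p ≤ p ^ 2 := by nlinarith
          rw [Nat.sub_mul, ← sq]
          omega
        rw [h4, pow_add, pow_add]
        ring) hR
    exact (hg.isCompleteIntersectionOn hpp hp (.inr rfl) (isLiftedBinomial_relation hp _ _) hlift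
      (pow_ne_zero _ h123) one_ne_zero hJ (by simp) (by simp) (by simp; omega)
      ((aeval_relation _ _ _).trans hrel) hR0).1
  · have hS := isSeed_special hp h123 h135
    have hg : IsLeadFamily p 1 (invariants p M) (gensSpecial p M) :=
      hS.isLeadFamily hp (.inl rfl) h123 (orbitProd_mem_invariants _)
        (hasYLead_orbitProd_y h123 h135)
    have hw3 : tailWeight p 1 (Finsupp.single 3 p) = p * (p ^ 2 + 1) := by
      simp [tailWeight]
      ring
    have hw1 : tailWeight p 1 (Finsupp.single 1 ((p ^ 2 + 1) / 2)) = p * (p ^ 2 + 1) := by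
      have h2 : 2 * ((p ^ 2 + 1) / 2) = p ^ 2 + 1 := by
        have : p ^ 2 % 2 = 1 := by rw [Nat.pow_mod, hodd]
        omega
      simp only [tailWeight, Finsupp.single_eq_same]
      simp
      calc 2 * p * ((p ^ 2 + 1) / 2) = p * (2 * ((p ^ 2 + 1) / 2)) := by ring
        _ = _ := by rw [h2]
    have hw1' : tailWeight p 1 (Finsupp.single 1 p) = 2 * p ^ 2 := by
      simp [tailWeight]
      ring
    have hw2 : tailWeight p 1 (Finsupp.single 2 2) = 2 * p ^ 2 := by
      simp [tailWeight]
      ring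
    have hlc : ∀ E, grevlex.leadingCoeff (gpow (gensSpecial p M) E) ≠ 0 := fun E =>
      grevlex.leadingCoeff_ne_zero_iff.2 (gpow_ne_zero hg.ne_zero E)
    refine ⟨(exists_f3DivX_eq hp h135).1, isSagbiBasis_of_degree hg.ne_zero _ hg.mem hg.lead,
      hg.isTeteATete (by decide) (by decide) (by decide) (by decide) (by decide) (hw3.trans hw1.symm),
      hg.isTeteATete (by decide) (by decide) (by decide) (by decide) (by decide)
        (hw1'.trans hw2.symm),
      hg.exists_isSubductionRelation _, hg.exists_isSubductionRelation _, fun R R' hR hR' => ?_⟩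
    have hR0 := hR.aeval_eq_zero
    have hR0' := hR'.aeval_eq_zero
    rw [teteATetePoly_eq] at hR hR'
    have hlift := hg.isLiftedBinomial hw3 hw1 (by simp) (by simp) (by simp) (by simp)
      (by positivity) (by field_simp [hlc]; ring) hR
    have hlift' := hg.isLiftedBinomial hw1' hw2 (by simp) (by simp) (by simp) (by simp)
      (by positivity) (by field_simp [hlc]; ring) hR'
    -- The tête-à-tête starts with `t₁^p`, but the lead monomial for `genOrder` is `t₂²`, hence the
    -- swap; its coefficient is minus a quotient of lead coefficients.
    exact (hg.isCompleteIntersectionOn hpp hp (.inl rfl) hlift'.swap hlift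
      (neg_ne_zero.2 (div_ne_zero (hlc _) (hlc _))) one_ne_zero hw1 (by simp) (by simp)
      (by
        rw [Finsupp.degree_single]
        have : 2 * 2 < p ^ 2 := by nlinarith
        omega) hR0' hR0).2
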